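/- There are an algorithm and constants $C,d\in\mathbb{N}$ such that the following holds for all integers $m\ge 0$, $n\ge 1$, $\Delta\ge 1$, every matrix $A\in\mathbb{Z}^{m\times n}$ all of whose entries have absolute value at most $\Delta$, and all $b\in\mathbb{Z}^m$, $c\in\mathbb{Z}^n$. Given $m,n,A,b,c$, the algorithm solves the integer program $$\max\{c^{T}x : Ax=b,\ x\ge 0,\ x\in\mathbb{Z}^n\},$$ that is, it halts and either reports correctly that there is no feasible point, or reports correctly that $c^Tx$ is unbounded above on the feasible set, or outputs an optimal solution; and it takes at most $$C\cdot 2^{2m}\,\Delta^{m^3+3m^2+2m}\,n^{m^3+5m^2+6m+1}$$ steps. In particular, the number of steps is bounded independently of $b$ and $c$. Here an algorithm is a fixed program of a random access machine over the integers (registers and an indirectly addressed memory) in which each addition, subtraction, multiplication, integer division, assignment of a constant, memory access and sign test is one step. Moreover, all integers written during the computation have at most $C\cdot L^{d}$ binary digits, where $L$ is the encoding length of the input, i.e. $m+n$ plus the total number of binary digits of the entries of $A$, $b$ and $c$. -/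

import Mathlib

/-! ### Integer programs in standard form: max `c ⬝ᵥ x` subject to `A *ᵥ x = b`, `0 ≤ x`, `x` integral -/

namespace IntProg

/-- `x` is feasible for the program `A x = b`, `x ≥ 0`, `x ∈ ℤⁿ`. -/
def IsFeasible {m n : ℕ} (A : Matrix (Fin m) (Fin n) ℤ) (b : Fin m → ℤ) (x : Fin n → ℤ) : Prop :=
  A.mulVec x = b ∧ ∀ j, 0 ≤ x j

/-- `x` is an optimal solution of `max {cᵀx : A x = b, x ≥ 0, x ∈ ℤⁿ}`. -/
def IsOptimal {m n : ℕ} (A : Matrix (Fin m) (Fin n) ℤ) (b : Fin m → ℤ) (c : Fin n → ℤ)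
    (x : Fin n → ℤ) : Prop :=
  IsFeasible A b x ∧ ∀ y, IsFeasible A b y → dotProduct c y ≤ dotProduct c x

/-- The objective takes arbitrarily large values on the feasible set. -/
def IsUnbounded {m n : ℕ} (A : Matrix (Fin m) (Fin n) ℤ) (b : Fin m → ℤ) (c : Fin n → ℤ) : Prop :=
  ∀ M : ℤ, ∃ x, IsFeasible A b x ∧ M < dotProduct c x

/-- Length of the binary encoding of the data `(A, b, c)`, with the dimensions in unary. -/
def inputSize {m n : ℕ} (A : Matrix (Fin m) (Fin n) ℤ) (b : Fin m → ℤ) (c : Fin n → ℤ) : ℕ :=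
  m + n + (∑ i, ∑ j, (A i j).natAbs.size) + (∑ i, (b i).natAbs.size) + ∑ j, (c j).natAbs.size

end IntProg

/-! ### Random access machines over the integers, at unit cost per arithmetic operation -/

namespace RAM

/-- A configuration of the storage: registers, named in the program, and a memory that is
addressed indirectly, through the contents of registers. -/
structure Store where
  reg : ℕ → ℤ
  mem : ℤ → ℤ

/-- The arithmetic operations. -/
inductive Op where
  | add | sub | mul | div

/-- Division is division with remainder (the remainder is nonnegative), and `x / 0 = 0`. -/
def Op.eval : Op → ℤ → ℤ → ℤ
  | .add, x, y => x + y
  | .sub, x, y => x - y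
  | .mul, x, y => x * y
  | .div, x, y => x / y

/-- Elementary instructions:
* `const r k` : register `r` becomes the constant `k`;
* `op o r a a'` : register `r` becomes the result of `o` on the contents of registers `a`, `a'`;
* `load r a` : register `r` becomes the content of the memory cell whose address is in register `a`;
* `store a r` : the memory cell whose address is in register `a` becomes the content of `r`. -/
inductive Instr where
  | const (r : ℕ) (k : ℤ)
  | op (o : Op) (r a a' : ℕ)
  | load (r a : ℕ)
  | store (a r : ℕ)

/-- The integer that an instruction writes. -/
def Instr.value : Instr → Store → ℤ
  | .const _ k, _ => k
  | .op o _ a a', s => o.eval (s.reg a) (s.reg a')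
  | .load _ a, s => s.mem (s.reg a)
  | .store _ r, s => s.reg r

/-- The storage after the execution of an instruction. -/
def Instr.run (i : Instr) (s : Store) : Store :=
  match i with
  | .const r _ => { s with reg := Function.update s.reg r (i.value s) }
  | .op _ r _ _ => { s with reg := Function.update s.reg r (i.value s) }
  | .load r _ => { s with reg := Function.update s.reg r (i.value s) }
  | .store a _ => { s with mem := Function.update s.mem (s.reg a) (i.value s) }

/-- Programs: finite, and built from elementary instructions by sequencing, branching and looping.
The tests are of the form "the content of register `r` is positive". -/
inductive Prog where
  | skip
  | instr (i : Instr)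
  | seq (p q : Prog)
  | ite (r : ℕ) (p q : Prog)
  | loop (r : ℕ) (p : Prog)

/-- `Exec w p s s' t`: the program `p`, started with the storage `s`, halts after exactly `t` steps
with the storage `s'`, and every integer that it writes on its way has at most `w` binary digits.
Each execution of an instruction and each evaluation of a test is one step. -/
inductive Exec (w : ℕ) : Prog → Store → Store → ℕ → Prop where
  | skip (s : Store) : Exec w .skip s s 1
  | instr (i : Instr) (s : Store) (h : (i.value s).natAbs.size ≤ w) :
      Exec w (.instr i) s (i.run s) 1
  | seq {p q : Prog} {s s' s'' : Store} {t t' : ℕ} (hp : Exec w p s s' t)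
      (hq : Exec w q s' s'' t') : Exec w (.seq p q) s s'' (t + t')
  | ite_pos {r : ℕ} {p q : Prog} {s s' : Store} {t : ℕ} (h : 0 < s.reg r)
      (hp : Exec w p s s' t) : Exec w (.ite r p q) s s' (t + 1)
  | ite_neg {r : ℕ} {p q : Prog} {s s' : Store} {t : ℕ} (h : ¬ 0 < s.reg r)
      (hq : Exec w q s s' t) : Exec w (.ite r p q) s s' (t + 1)
  | loop_pos {r : ℕ} {p : Prog} {s s' s'' : Store} {t t' : ℕ} (h : 0 < s.reg r)
      (hp : Exec w p s s' t) (hl : Exec w (.loop r p) s' s'' t') :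
      Exec w (.loop r p) s s'' (t + 1 + t')
  | loop_neg {r : ℕ} {p : Prog} {s : Store} (h : ¬ 0 < s.reg r) : Exec w (.loop r p) s s 1

end RAM

namespace IntProg

/-- The input as one list: the rows of `A` one after the other, then `b`, then `c`. -/
def inputList {m n : ℕ} (A : Matrix (Fin m) (Fin n) ℤ) (b : Fin m → ℤ) (c : Fin n → ℤ) : List ℤ :=
  List.ofFn (fun k : Fin (m * n) => A k.divNat k.modNat) ++ List.ofFn b ++ List.ofFn c

/-- The initial storage: `m` and `n` in registers `0` and `1`, the data in the memory cells
`0, 1, 2, …`, and zero everywhere else. -/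
def initial {m n : ℕ} (A : Matrix (Fin m) (Fin n) ℤ) (b : Fin m → ℤ) (c : Fin n → ℤ) :
    RAM.Store where
  reg r := if r = 0 then (m : ℤ) else if r = 1 then (n : ℤ) else 0
  mem z := if 0 ≤ z then (inputList A b c).getD z.toNat 0 else 0

/-- The final storage `s` answers the program correctly: register `0` holds `0` if the program is
infeasible, `1` if it is unbounded, and otherwise `2`, with an optimal solution in the memory
cells `0, …, n - 1`. -/
def IsAnswer {m n : ℕ} (A : Matrix (Fin m) (Fin n) ℤ) (b : Fin m → ℤ) (c : Fin n → ℤ)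
    (s : RAM.Store) : Prop :=
  (s.reg 0 = 0 ∧ ¬ ∃ x, IsFeasible A b x) ∨
  (s.reg 0 = 1 ∧ IsUnbounded A b c) ∨
  (s.reg 0 = 2 ∧ IsOptimal A b c (fun j : Fin n => s.mem (j : ℕ)))

end IntProg

/-!
Let `D ≥ 1` bound the absolute values of the entries of `A`, and put `K = (n D)ᵐ`; this bounds all
minors of `A`. The program rests on a decomposition of feasible points. If the columns of the
coordinates `x j ≥ K` of a feasible point `x` are dependent, then cofactors of a minor yield a
kernel vector of these columns with entries of absolute value at most `K`
(`exists_kernel_or_functional`), and moving along it makes one of the coordinates smaller than `K`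
without leaving the nonnegative orthant. If no nonnegative kernel vector in the box `[0, K]ⁿ`
improves the objective, then the direction can be chosen such that the objective does not
decrease. Hence every feasible point is dominated by a feasible `x' + x''` with `x'` in the box
`[0, K]ⁿ` and `x'' ≥ 0` supported on independent columns, of which there are at most `m`
(`exists_decomposition`). For the objective `0` this decides feasibility. If a nonnegative kernel
vector in the box does improve the objective, then feasibility implies unboundedness.

For `x'` only the objective value and the left-hand side `A x'` matter. A left-hand side is
encoded as one integer `z` in base `W = 2 n D K + 1`, with `|z| < N = Wᵐ`, and the best point for
each `z` is found by a knapsack recursion in which each column may be used `K` times (`Data.G`,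
`Data.le_G`, `Data.Trace.dominates`). The entry of `z = 0` also tells whether a small nonnegative
kernel vector improves the objective. For `x''` all `nᵐ` tuples of `m` columns are tried. For
independent columns there are functionals `u` with entries in `[-K, K]` that vanish on all columns
of the tuple except one; they are found by enumeration, and the coordinate of `x''` at this column
is the quotient of `u (b - A x')` by the value of `u` at the column (`Data.Solvable.div_eq`). No
test of independence is needed: the resulting point is checked, and the best feasible point is
kept (`runs_compareP`).

The number of steps is `O((m + 1)⁴ N L nᵐ)` with `L = n K`, and `(m + 1)⁴ 3ᵐ = O(4ᵐ)`. All
integers are bounded by a fixed power of the sum of the parameters, and the latter have `O(l³)`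
digits for data of length `l`.

The program is written in a small language of expressions with local variables and of loops, whose
rules (`RAM.Evals`, `RAM.Runs`) bound the number of steps and the size of all integers. Registers
below `32` are variables: `0` and `1` hold `m` and `n`, those from `2` to `17` the parameters
(`Params`), `18` and `19` tell whether a feasible point has been found and its objective value,
`20` and `21` hold the current tuple and the current code during the search, and the ones from
`22` on are auxiliary.
-/

namespace RAM

/-! ### A small imperative language on top of the machine -/

/-- Assign the value `v` to register `r`. -/
def Store.set (s : Store) (r : ℕ) (v : ℤ) : Store := { s with reg := Function.update s.reg r v }

/-- Write the value `v` into the memory cell `a`. -/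
def Store.put (s : Store) (a v : ℤ) : Store := { s with mem := Function.update s.mem a v }

@[simp] theorem Store.set_mem (s : Store) (r : ℕ) (v : ℤ) : (s.set r v).mem = s.mem := rfl
@[simp] theorem Store.put_reg (s : Store) (a v : ℤ) : (s.put a v).reg = s.reg := rfl
@[simp] theorem Store.set_reg_self (s : Store) (r : ℕ) (v : ℤ) : (s.set r v).reg r = v := by
  simp [Store.set]
theorem Store.set_reg_ne (s : Store) {q r : ℕ} (v : ℤ) (h : q ≠ r) :
    (s.set r v).reg q = s.reg q := by
  simp [Store.set, h]
theorem Store.set_reg (s : Store) (q r : ℕ) (v : ℤ) :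
    (s.set r v).reg q = if q = r then v else s.reg q := by
  by_cases h : q = r
  · subst h; simp
  · simp [Store.set_reg_ne, h]
@[simp] theorem Store.put_mem_self (s : Store) (a v : ℤ) : (s.put a v).mem a = v := by
  simp [Store.put]
theorem Store.put_mem_ne (s : Store) {x a : ℤ} (v : ℤ) (h : x ≠ a) :
    (s.put a v).mem x = s.mem x := by
  simp [Store.put, h]
theorem Store.put_mem (s : Store) (x a : ℤ) (v : ℤ) :
    (s.put a v).mem x = if x = a then v else s.mem x := by
  by_cases h : x = a
  · subst h; simp
  · simp [Store.put_mem_ne, h]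

/-- Two stores with the same memory and the same registers below `d`. -/
def Agree (d : ℕ) (s σ : Store) : Prop := s.mem = σ.mem ∧ ∀ r < d, s.reg r = σ.reg r

theorem Agree.refl (d : ℕ) (s : Store) : Agree d s s := ⟨rfl, fun _ _ => rfl⟩

theorem Agree.mono {d e : ℕ} {s σ : Store} (h : Agree e s σ) (hd : d ≤ e) : Agree d s σ :=
  ⟨h.1, fun r hr => h.2 r (hr.trans_le hd)⟩

theorem Agree.trans {d : ℕ} {s σ τ : Store} (h : Agree d s σ) (h' : Agree d σ τ) : Agree d s τ :=
  ⟨h.1.trans h'.1, fun r hr => (h.2 r hr).trans (h'.2 r hr)⟩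

/-- The registers below `d` and all memory cells hold integers of absolute value at most `M`. -/
def Bounded (M d : ℕ) (s : Store) : Prop := (∀ r < d, |s.reg r| ≤ M) ∧ ∀ a, |s.mem a| ≤ M

theorem Bounded.set {M d : ℕ} {s : Store} (h : Bounded M d s) {v : ℤ} (hv : |v| ≤ M) (r : ℕ) :
    Bounded M d (s.set r v) := by
  refine ⟨fun q hq => ?_, h.2⟩
  rw [Store.set_reg]
  split_ifs
  · exact hv
  · exact h.1 q hq

theorem Bounded.set_succ {M d : ℕ} {s : Store} (h : Bounded M d s) {v : ℤ} (hv : |v| ≤ M) :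
    Bounded M (d + 1) (s.set d v) := by
  refine ⟨fun q hq => ?_, h.2⟩
  rw [Store.set_reg]
  split_ifs with hqd
  · exact hv
  · exact h.1 q (by omega)

theorem Bounded.put {M d : ℕ} {s : Store} (h : Bounded M d s) {v : ℤ} (hv : |v| ≤ M) (a : ℤ) :
    Bounded M d (s.put a v) := by
  refine ⟨h.1, fun x => ?_⟩
  rw [Store.put_mem]
  split_ifs
  · exact hv
  · exact h.2 x

/-- Words of `w` binary digits hold all polynomials of moderate degree in integers bounded by `M`;
the degree `64` exceeds the degrees of all expressions that occur below. -/
class Capacity (w M : ℕ) : Prop where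
  two_le : 2 ≤ M
  lt : M ^ 64 < 2 ^ w

theorem Capacity.size_le {w M : ℕ} [h : Capacity w M] {k : ℕ} (hk : k ≤ 64) {v : ℤ}
    (hv : |v| ≤ (M : ℤ) ^ k) : v.natAbs.size ≤ w := by
  rw [Nat.size_le]
  have h1 : (v.natAbs : ℤ) ≤ ((M ^ k : ℕ) : ℤ) := by
    rw [Int.natCast_natAbs]; exact_mod_cast hv
  have h2 : v.natAbs ≤ M ^ k := by exact_mod_cast h1
  exact (h2.trans (Nat.pow_le_pow_right (by linarith [h.two_le]) hk)).trans_lt h.lt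

/-- Arithmetic expressions without loops. -/
inductive Flat where
  | lit (k : ℤ)
  | var (r : ℕ)
  | bin (o : Op) (a b : Flat)
  | load (a : Flat)
  | ite (a b c : Flat)

namespace Flat

instance : Add Flat := ⟨.bin .add⟩
instance : Sub Flat := ⟨.bin .sub⟩
instance : Mul Flat := ⟨.bin .mul⟩
instance : Div Flat := ⟨.bin .div⟩

/-- The value of an expression; `ite a b c` is `b` if `a` is positive, and `c` otherwise. -/
def eval (s : Store) : Flat → ℤ
  | .lit k => k
  | .var r => s.reg r
  | .bin o a b => o.eval (a.eval s) (b.eval s)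
  | .load a => s.mem (a.eval s)
  | .ite a b c => if 0 < a.eval s then b.eval s else c.eval s

/-- An upper bound for the number of steps of the evaluation. -/
def time : Flat → ℕ
  | .lit _ => 1
  | .var _ => 2
  | .bin _ a b => a.time + b.time + 1
  | .load a => a.time + 1
  | .ite a b c => a.time + b.time + c.time + 1

/-- The degree of an expression: all values met in its evaluation are at most `M ^ deg` if the
registers and the memory cells hold values at most `M`. -/
def deg : Flat → ℕ
  | .lit _ => 1
  | .var _ => 1
  | .bin .mul a b => a.deg + b.deg
  | .bin _ a b => max a.deg b.deg + 1
  | .load a => a.deg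
  | .ite a b c => max a.deg (max b.deg c.deg)

/-- All variables are registers below `d`, and all literals are at most `2` in absolute value. -/
def WF (d : ℕ) : Flat → Prop
  | .lit k => |k| ≤ 2
  | .var r => r < d
  | .bin _ a b => a.WF d ∧ b.WF d
  | .load a => a.WF d
  | .ite a b c => a.WF d ∧ b.WF d ∧ c.WF d

/-- The program that leaves the value of the expression in register `d`, using only the registers
from `d` on. -/
def code : Flat → ℕ → Prog
  | .lit k, d => .instr (.const d k)
  | .var r, d => .seq (.instr (.const d 0)) (.instr (.op .add d r d))
  | .bin o a b, d => .seq (a.code d) (.seq (b.code (d + 1)) (.instr (.op o d d (d + 1))))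
  | .load a, d => .seq (a.code d) (.instr (.load d d))
  | .ite a b c, d => .seq (a.code d) (.ite d (b.code d) (c.code d))

@[simp] theorem eval_lit (s : Store) (k : ℤ) : (lit k).eval s = k := rfl
@[simp] theorem eval_var (s : Store) (r : ℕ) : (var r).eval s = s.reg r := rfl
@[simp] theorem eval_add (s : Store) (a b : Flat) : (a + b).eval s = a.eval s + b.eval s := rfl
@[simp] theorem eval_sub (s : Store) (a b : Flat) : (a - b).eval s = a.eval s - b.eval s := rfl
@[simp] theorem eval_mul (s : Store) (a b : Flat) : (a * b).eval s = a.eval s * b.eval s := rfl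
@[simp] theorem eval_div (s : Store) (a b : Flat) : (a / b).eval s = a.eval s / b.eval s := rfl
@[simp] theorem eval_load (s : Store) (a : Flat) : (load a).eval s = s.mem (a.eval s) := rfl
@[simp] theorem eval_ite (s : Store) (a b c : Flat) :
    (ite a b c).eval s = if 0 < a.eval s then b.eval s else c.eval s := rfl
@[simp] theorem time_lit (k : ℤ) : (lit k).time = 1 := rfl
@[simp] theorem time_var (r : ℕ) : (var r).time = 2 := rfl
@[simp] theorem time_add (a b : Flat) : (a + b).time = a.time + b.time + 1 := rfl
@[simp] theorem time_sub (a b : Flat) : (a - b).time = a.time + b.time + 1 := rfl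
@[simp] theorem time_mul (a b : Flat) : (a * b).time = a.time + b.time + 1 := rfl
@[simp] theorem time_div (a b : Flat) : (a / b).time = a.time + b.time + 1 := rfl
@[simp] theorem time_load (a : Flat) : (load a).time = a.time + 1 := rfl
@[simp] theorem time_ite (a b c : Flat) : (ite a b c).time = a.time + b.time + c.time + 1 := rfl
@[simp] theorem deg_lit (k : ℤ) : (lit k).deg = 1 := rfl
@[simp] theorem deg_var (r : ℕ) : (var r).deg = 1 := rfl
@[simp] theorem deg_add (a b : Flat) : (a + b).deg = max a.deg b.deg + 1 := rfl
@[simp] theorem deg_sub (a b : Flat) : (a - b).deg = max a.deg b.deg + 1 := rfl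
@[simp] theorem deg_mul (a b : Flat) : (a * b).deg = a.deg + b.deg := rfl
@[simp] theorem deg_div (a b : Flat) : (a / b).deg = max a.deg b.deg + 1 := rfl
@[simp] theorem deg_load (a : Flat) : (load a).deg = a.deg := rfl
@[simp] theorem deg_ite (a b c : Flat) : (ite a b c).deg = max a.deg (max b.deg c.deg) := rfl
@[simp] theorem wf_lit (d : ℕ) (k : ℤ) : (lit k).WF d ↔ |k| ≤ 2 := Iff.rfl
@[simp] theorem wf_var (d r : ℕ) : (var r).WF d ↔ r < d := Iff.rfl
@[simp] theorem wf_add (d : ℕ) (a b : Flat) : (a + b).WF d ↔ a.WF d ∧ b.WF d := Iff.rfl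
@[simp] theorem wf_sub (d : ℕ) (a b : Flat) : (a - b).WF d ↔ a.WF d ∧ b.WF d := Iff.rfl
@[simp] theorem wf_mul (d : ℕ) (a b : Flat) : (a * b).WF d ↔ a.WF d ∧ b.WF d := Iff.rfl
@[simp] theorem wf_div (d : ℕ) (a b : Flat) : (a / b).WF d ↔ a.WF d ∧ b.WF d := Iff.rfl
@[simp] theorem wf_load (d : ℕ) (a : Flat) : (load a).WF d ↔ a.WF d := Iff.rfl
@[simp] theorem wf_ite (d : ℕ) (a b c : Flat) :
    (ite a b c).WF d ↔ a.WF d ∧ b.WF d ∧ c.WF d := Iff.rfl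

theorem one_le_deg : ∀ f : Flat, 1 ≤ f.deg
  | .lit _ => le_rfl
  | .var _ => le_rfl
  | .bin .mul a _ => by have := one_le_deg a; simp only [deg]; omega
  | .bin .add a b => by simp only [deg]; omega
  | .bin .sub a b => by simp only [deg]; omega
  | .bin .div a b => by simp only [deg]; omega
  | .load a => by have := one_le_deg a; simpa only [deg]
  | .ite a b c => by have := one_le_deg a; simp only [deg]; omega

end Flat

theorem abs_ediv_le_abs (x y : ℤ) : |x / y| ≤ |x| := by
  rcases Int.le_total 0 y with hy | hy
  · rcases hy.eq_or_lt with rfl | hy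
    · simp
    · rw [abs_le]
      constructor
      · rw [Int.le_ediv_iff_mul_le hy]
        nlinarith [neg_abs_le x, abs_nonneg x]
      · have : x / y ≤ |x| / y := Int.ediv_le_ediv hy (le_abs_self x)
        exact this.trans (Int.ediv_le_self _ (abs_nonneg x))
  · rcases hy.eq_or_lt with rfl | hy
    · simp
    · obtain ⟨z, rfl⟩ : ∃ z, y = -z := ⟨-y, by ring⟩
      have hz : 0 < z := by omega
      rw [Int.ediv_neg, abs_neg, abs_le]
      constructor
      · rw [Int.le_ediv_iff_mul_le hz]
        nlinarith [neg_abs_le x, abs_nonneg x]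
      · have : x / z ≤ |x| / z := Int.ediv_le_ediv hz (le_abs_self x)
        exact this.trans (Int.ediv_le_self _ (abs_nonneg x))

theorem Op.abs_eval_le {M : ℕ} (hM : 2 ≤ M) (o : Op) (a b : Flat) {x y : ℤ}
    (hx : |x| ≤ (M : ℤ) ^ a.deg) (hy : |y| ≤ (M : ℤ) ^ b.deg) :
    |o.eval x y| ≤ (M : ℤ) ^ (Flat.bin o a b).deg := by
  have hM1 : (1 : ℤ) ≤ M := by exact_mod_cast (by omega : 1 ≤ M)
  have hM2 : (2 : ℤ) ≤ M := by exact_mod_cast hM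
  have hsum : |x| + |y| ≤ (M : ℤ) ^ (max a.deg b.deg + 1) := by
    have h1 : (M : ℤ) ^ a.deg ≤ M ^ max a.deg b.deg := pow_le_pow_right₀ hM1 (le_max_left _ _)
    have h2 : (M : ℤ) ^ b.deg ≤ M ^ max a.deg b.deg := pow_le_pow_right₀ hM1 (le_max_right _ _)
    rw [pow_succ]
    nlinarith [pow_nonneg (by linarith : (0 : ℤ) ≤ M) (max a.deg b.deg)]
  cases o with
  | add => exact (abs_add_le x y).trans hsum
  | sub => exact (abs_sub x y).trans hsum
  | div => exact (abs_ediv_le_abs x y).trans ((le_add_of_nonneg_right (abs_nonneg y)).trans hsum)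
  | mul =>
    change |x * y| ≤ (M : ℤ) ^ (a.deg + b.deg)
    rw [abs_mul, pow_add]
    gcongr

theorem Agree.of_set {d e : ℕ} {s σ : Store} (h : Agree d s σ) (hd : d ≤ e) (v : ℤ) :
    Agree d s (σ.set e v) :=
  ⟨h.1, fun r hr => by rw [Store.set_reg_ne _ _ (by omega)]; exact h.2 r hr⟩

theorem Agree.set {d : ℕ} {s σ : Store} (h : Agree d s σ) (r : ℕ) (v : ℤ) :
    Agree d (s.set r v) (σ.set r v) :=
  ⟨h.1, fun q hq => by rw [Store.set_reg, Store.set_reg, h.2 q hq]⟩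

theorem Agree.set_succ {d : ℕ} {s σ : Store} (h : Agree d s σ) (v : ℤ) (hv : σ.reg d = v) :
    Agree (d + 1) (s.set d v) σ :=
  ⟨h.1, fun q hq => by
    rw [Store.set_reg]
    split_ifs with hqd
    · rw [hqd, hv]
    · exact h.2 q (by omega)⟩

theorem Agree.put {d : ℕ} {s σ : Store} (h : Agree d s σ) (a v : ℤ) :
    Agree d (s.put a v) (σ.put a v) :=
  ⟨by simp only [Store.put, h.1], fun q hq => h.2 q hq⟩

section
variable {w M : ℕ} [hC : Capacity w M]

theorem Exec.const {d : ℕ} {k : ℤ} {σ : Store} (hk : |k| ≤ M) :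
    Exec w (.instr (.const d k)) σ (σ.set d k) 1 :=
  Exec.instr (.const d k) σ (hC.size_le (k := 1) (by norm_num) (by simpa [Instr.value] using hk))

theorem Exec.move {d r : ℕ} {σ : Store} (hrd : r ≠ d) (hr : |σ.reg r| ≤ M) :
    Exec w (.seq (.instr (.const d 0)) (.instr (.op .add d r d))) σ (σ.set d (σ.reg r)) 2 := by
  have h2 : Exec w (.instr (.op .add d r d)) (σ.set d 0) ((σ.set d 0).set d (σ.reg r)) 1 := by
    have hval : (Instr.op .add d r d).value (σ.set d 0) = σ.reg r := by
      simp [Instr.value, Op.eval, Store.set_reg_ne _ _ hrd]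
    have := Exec.instr (w := w) (.op .add d r d) (σ.set d 0)
      (hC.size_le (k := 1) (by norm_num) (by rw [hval]; simpa using hr))
    simp only [Instr.run, hval] at this
    exact this
  have h1 : Exec w (.instr (.const d 0)) σ (σ.set d 0) 1 := Exec.const (M := M) (by simp)
  have h := Exec.seq h1 h2
  simpa [Store.set] using h

/-- The correctness of the code of an expression. The storage `σ` on which the code runs is only
known up to `Agree`, since the evaluation of the surrounding expression has used registers from `e`
on. -/
theorem Flat.exec {s : Store} {e : ℕ} (hb : Bounded M e s) :
    ∀ (f : Flat), f.WF e → f.deg ≤ 64 → |f.eval s| ≤ (M : ℤ) ^ f.deg ∧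
      ∀ d, e ≤ d → ∀ σ, Agree e s σ → ∃ σ' t, Exec w (f.code d) σ σ' t ∧ t ≤ f.time ∧
        Agree d σ σ' ∧ σ'.reg d = f.eval s
  | .lit k, hwf, _ => by
    have hk : |k| ≤ (M : ℤ) := le_trans hwf (by exact_mod_cast hC.two_le)
    refine ⟨by simpa [deg, eval] using hk, fun d hd σ hσ => ⟨_, _, Exec.const hk, le_rfl, ?_, ?_⟩⟩
    · exact (Agree.refl d σ).of_set le_rfl k
    · simp
  | .var r, hwf, _ => by
    have hr : |s.reg r| ≤ (M : ℤ) := hb.1 r hwf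
    refine ⟨by simpa [deg, eval] using hr, fun d hd σ hσ => ?_⟩
    have h : σ.reg r = s.reg r := (hσ.2 r hwf).symm
    have hrd : r ≠ d := by have : r < e := hwf; omega
    refine ⟨_, _, Exec.move hrd (by rw [h]; exact hr), le_rfl, ?_, ?_⟩
    · exact (Agree.refl d σ).of_set le_rfl _
    · simp [h]
  | .bin o a b, hwf, hdeg => by
    have hab : a.deg ≤ 64 ∧ b.deg ≤ 64 := by cases o <;> simp only [deg] at hdeg <;> omega
    obtain ⟨ha, iha⟩ := Flat.exec hb a hwf.1 hab.1
    obtain ⟨hb', ihb⟩ := Flat.exec hb b hwf.2 hab.2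
    have hle := Op.abs_eval_le hC.two_le o a b ha hb'
    refine ⟨hle, fun d hd σ hσ => ?_⟩
    obtain ⟨σ₁, t₁, h₁, ht₁, hσ₁, hv₁⟩ := iha d hd σ hσ
    obtain ⟨σ₂, t₂, h₂, ht₂, hσ₂, hv₂⟩ :=
      ihb (d + 1) (by omega) σ₁ (hσ.trans (hσ₁.mono hd))
    have hval : (Instr.op o d d (d + 1)).value σ₂ = (Flat.bin o a b).eval s := by
      simp only [Instr.value, eval, hv₂, ← hσ₂.2 d (by omega), hv₁]
    refine ⟨_, _, Exec.seq h₁ (Exec.seq h₂ (Exec.instr _ _ ?_)), ?_, ?_, ?_⟩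
    · rw [hval]; exact hC.size_le hdeg hle
    · simp only [time]; omega
    · exact hσ₁.trans ((hσ₂.mono (by omega)).of_set le_rfl _)
    · simp only [Instr.run, hval, Function.update_self]
  | .load a, hwf, hdeg => by
    obtain ⟨ha, iha⟩ := Flat.exec hb a hwf hdeg
    have hM : (1 : ℤ) ≤ M := by exact_mod_cast (by have := hC.two_le; omega : 1 ≤ M)
    have hle : |s.mem (a.eval s)| ≤ (M : ℤ) ^ a.deg :=
      (hb.2 _).trans (le_self_pow₀ hM (by have := one_le_deg a; omega))
    refine ⟨hle, fun d hd σ hσ => ?_⟩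
    obtain ⟨σ₁, t₁, h₁, ht₁, hσ₁, hv₁⟩ := iha d hd σ hσ
    have hval : (Instr.load d d).value σ₁ = (Flat.load a).eval s := by
      simp only [Instr.value, eval, hv₁, ← hσ₁.1, ← hσ.1]
    refine ⟨_, _, Exec.seq h₁ (Exec.instr _ _ ?_), ?_, ?_, ?_⟩
    · rw [hval]; exact hC.size_le hdeg hle
    · simp only [time]; omega
    · exact hσ₁.of_set le_rfl _
    · simp only [Instr.run, hval, Function.update_self]
  | .ite a b c, hwf, hdeg => by
    have habc : a.deg ≤ 64 ∧ b.deg ≤ 64 ∧ c.deg ≤ 64 := by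
      simp only [deg] at hdeg; omega
    obtain ⟨-, iha⟩ := Flat.exec hb a hwf.1 habc.1
    obtain ⟨hb', ihb⟩ := Flat.exec hb b hwf.2.1 habc.2.1
    obtain ⟨hc', ihc⟩ := Flat.exec hb c hwf.2.2 habc.2.2
    have hM : (1 : ℤ) ≤ M := by exact_mod_cast (by have := hC.two_le; omega : 1 ≤ M)
    constructor
    · simp only [eval]
      split_ifs
      · exact hb'.trans (pow_le_pow_right₀ hM (by simp only [deg]; omega))
      · exact hc'.trans (pow_le_pow_right₀ hM (by simp only [deg]; omega))
    · intro d hd σ hσ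
      obtain ⟨σ₁, t₁, h₁, ht₁, hσ₁, hv₁⟩ := iha d hd σ hσ
      by_cases hpos : 0 < a.eval s
      · obtain ⟨σ₂, t₂, h₂, ht₂, hσ₂, hv₂⟩ := ihb d hd σ₁ (hσ.trans (hσ₁.mono hd))
        refine ⟨σ₂, _, Exec.seq h₁ (Exec.ite_pos (by rw [hv₁]; exact hpos) h₂), ?_,
          hσ₁.trans hσ₂, ?_⟩
        · simp only [time]; omega
        · simp [eval, hpos, hv₂]
      · obtain ⟨σ₂, t₂, h₂, ht₂, hσ₂, hv₂⟩ := ihc d hd σ₁ (hσ.trans (hσ₁.mono hd))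
        refine ⟨σ₂, _, Exec.seq h₁ (Exec.ite_neg (by rw [hv₁]; exact hpos) h₂), ?_,
          hσ₁.trans hσ₂, ?_⟩
        · simp only [time]; omega
        · simp [eval, hpos, hv₂]

end

/-- Expressions with loops and local variables, given by their code: the program `e d` leaves the
value in register `d` and changes no register below `d`. -/
abbrev Expr := ℕ → Prog

/-- `letE e f` is the value of `f` when the register passed to `f` holds the value of `e`. -/
def letE (e : Expr) (f : ℕ → Expr) : Expr := fun d =>
  .seq (e d) (.seq (f d (d + 1)) (.seq (.instr (.const d 0)) (.instr (.op .add d (d + 1) d))))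

/-- `iteE a b c` is `b` if `a` is positive, and `c` otherwise. -/
def iteE (a b c : Expr) : Expr := fun d => .seq (a d) (.ite d (b d) (c d))

/-- `foldE n e f` starts with the value of `e` and updates it by `f` for the indices
`n - 1, …, 1, 0`, in this order. The registers passed to `f` hold the current value and the
index. -/
def foldE (n e : Flat) (f : ℕ → ℕ → Expr) : Expr := fun d =>
  .seq (e.code d) (.seq (n.code (d + 1)) (.loop (d + 1)
    (.seq (.instr (.const (d + 2) 1)) (.seq (.instr (.op .sub (d + 1) (d + 1) (d + 2)))
      (.seq (f d (d + 1) (d + 2))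
        (.seq (.instr (.const d 0)) (.instr (.op .add d (d + 2) d))))))))

/-- The sum of `f i` over the indices `i` below `n`. -/
def sumE (n : Flat) (f : ℕ → Expr) : Expr :=
  foldE n (.lit 0) fun x i => letE (f i) fun y => (Flat.var x + .var y).code

/-- In a storage that agrees with `s` on the memory and the registers below `d`, the code of the
expression `e` leaves the value `v` in register `d` within `t` steps. All storages are assumed to
be bounded by `M`, and no integer written has more than `w` digits. -/
def Evals (w M d : ℕ) (e : Expr) (s : Store) (v : ℤ) (t : ℕ) : Prop :=
  Bounded M d s → ∀ σ, Agree d s σ → ∃ σ' t', Exec w (e d) σ σ' t' ∧ t' ≤ t ∧ Agree d s σ' ∧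
    σ'.reg d = v

theorem Evals.mono {w M d : ℕ} {s : Store} {e : Expr} {v : ℤ} {t t' : ℕ}
    (h : Evals w M d e s v t) (ht : t ≤ t') : Evals w M d e s v t' := fun hb σ hσ => by
  obtain ⟨σ', u, h1, h2, h3⟩ := h hb σ hσ
  exact ⟨σ', u, h1, h2.trans ht, h3⟩

theorem Evals.iteE {w M d : ℕ} {s : Store} {a b c : Expr} {va v : ℤ} {ta tb T : ℕ}
    (ha : Evals w M d a s va ta)
    (hb : 0 < va → Evals w M d b s v tb) (hc : ¬ 0 < va → Evals w M d c s v tb)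
    (hT : ta + tb + 1 ≤ T) : Evals w M d (iteE a b c) s v T := fun hbd σ hσ => by
  obtain ⟨σ₁, t₁, h₁, ht₁, hσ₁, hv₁⟩ := ha hbd σ hσ
  by_cases hpos : 0 < va
  · obtain ⟨σ₂, t₂, h₂, ht₂, hσ₂, hv₂⟩ := hb hpos hbd σ₁ hσ₁
    exact ⟨σ₂, _, Exec.seq h₁ (Exec.ite_pos (by rw [hv₁]; exact hpos) h₂), by omega, hσ₂, hv₂⟩
  · obtain ⟨σ₂, t₂, h₂, ht₂, hσ₂, hv₂⟩ := hc hpos hbd σ₁ hσ₁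
    exact ⟨σ₂, _, Exec.seq h₁ (Exec.ite_neg (by rw [hv₁]; exact hpos) h₂), by omega, hσ₂, hv₂⟩

section
variable {w M : ℕ} [hC : Capacity w M] {d : ℕ} {s : Store}

theorem Evals.flat {f : Flat} {v : ℤ} {t : ℕ} (hwf : f.WF d) (hdeg : f.deg ≤ 64)
    (hv : f.eval s = v) (ht : f.time ≤ t) : Evals w M d f.code s v t := fun hb σ hσ => by
  obtain ⟨σ', u, h1, h2, h3, h4⟩ := (Flat.exec (w := w) hb f hwf hdeg).2 d le_rfl σ hσ
  exact ⟨σ', u, h1, h2.trans ht, hσ.trans h3, h4.trans hv⟩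

theorem Evals.letE {e : Expr} {f : ℕ → Expr} {v v' : ℤ} {t t' T : ℕ} (h : Evals w M d e s v t)
    (hv : |v| ≤ M) (h' : Evals w M (d + 1) (f d) (s.set d v) v' t') (hv' : |v'| ≤ M)
    (hT : t + t' + 2 ≤ T) : Evals w M d (letE e f) s v' T := fun hb σ hσ => by
  obtain ⟨σ₁, t₁, h₁, ht₁, hσ₁, hv₁⟩ := h hb σ hσ
  obtain ⟨σ₂, t₂, h₂, ht₂, hσ₂, hv₂⟩ := h' (hb.set_succ hv) σ₁ (hσ₁.set_succ v hv₁)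
  have h₃ := Exec.move (w := w) (M := M) (d := d) (r := d + 1) (σ := σ₂) (by omega)
    (by rw [hv₂]; exact hv')
  refine ⟨_, _, Exec.seq h₁ (Exec.seq h₂ h₃), by omega, ?_, by simp [hv₂]⟩
  exact (((Agree.refl d s).of_set le_rfl v).trans (hσ₂.mono (by omega))).of_set le_rfl _

/-- The rule for folds: `g c` is the current value when the indices below `c` remain. -/
theorem Evals.foldE {n e : Flat} {f : ℕ → ℕ → Expr} {N : ℕ} {g : ℕ → ℤ} {tb T : ℕ}
    (hn : n.WF d) (hnd : n.deg ≤ 64) (hnv : n.eval s = N) (hN : (N : ℤ) ≤ M)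
    (he : e.WF d) (hed : e.deg ≤ 64) (hev : e.eval s = g N)
    (hg : ∀ c ≤ N, |g c| ≤ M)
    (hf : ∀ c < N, Evals w M (d + 2) (f d (d + 1)) ((s.set d (g (c + 1))).set (d + 1) c) (g c) tb)
    (hT : e.time + n.time + 1 + N * (tb + 5) ≤ T) :
    Evals w M d (foldE n e f) s (g 0) T := fun hb σ hσ => by
  have hloop : ∀ c ≤ N, ∀ σ, Agree (d + 2) ((s.set d (g c)).set (d + 1) c) σ → ∃ σ' t',
      Exec w (.loop (d + 1)
        (.seq (.instr (.const (d + 2) 1)) (.seq (.instr (.op .sub (d + 1) (d + 1) (d + 2)))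
          (.seq (f d (d + 1) (d + 2))
            (.seq (.instr (.const d 0)) (.instr (.op .add d (d + 2) d))))))) σ σ' t' ∧
      t' ≤ 1 + c * (tb + 5) ∧ Agree d s σ' ∧ σ'.reg d = g 0 := by
    intro c
    induction c with
    | zero =>
      intro _ σ hσ
      have h1 : σ.reg (d + 1) = 0 := by simpa using (hσ.2 (d + 1) (by omega)).symm
      have h0 : σ.reg d = g 0 := by
        simpa [Store.set_reg] using (hσ.2 d (by omega)).symm
      refine ⟨σ, 1, Exec.loop_neg (by omega), by omega, ?_, h0⟩
      exact (((Agree.refl d s).of_set le_rfl _).of_set (by omega) _).trans (hσ.mono (by omega))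
    | succ c ih =>
      intro hc σ hσ
      have h1 : σ.reg (d + 1) = c + 1 := by simpa using (hσ.2 (d + 1) (by omega)).symm
      have hM2 := hC.two_le
      have e1 : Exec w (.instr (.const (d + 2) 1)) σ (σ.set (d + 2) 1) 1 :=
        Exec.const (M := M) (by simp; omega)
      have hval : (Instr.op .sub (d + 1) (d + 1) (d + 2)).value (σ.set (d + 2) 1) = c := by
        simp [Instr.value, Op.eval, Store.set_reg, h1]
      have e2 : Exec w (.instr (.op .sub (d + 1) (d + 1) (d + 2))) (σ.set (d + 2) 1)
          ((σ.set (d + 2) 1).set (d + 1) c) 1 := by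
        have := Exec.instr (w := w) (.op .sub (d + 1) (d + 1) (d + 2)) (σ.set (d + 2) 1)
          (hC.size_le (k := 1) (by norm_num) (by
            rw [hval, pow_one, abs_of_nonneg (by omega)]; push_cast at *; omega))
        simp only [Instr.run, hval] at this
        exact this
      have hb2 : Bounded M (d + 2) ((s.set d (g (c + 1))).set (d + 1) c) :=
        (hb.set_succ (hg _ hc)).set_succ (by rw [abs_of_nonneg (by omega)]; omega)
      have hag : Agree (d + 2) ((s.set d (g (c + 1))).set (d + 1) c)
          ((σ.set (d + 2) 1).set (d + 1) c) := by
        refine ⟨hσ.1, fun r hr => ?_⟩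
        have := hσ.2 r hr
        simp only [Store.set_reg] at this ⊢
        split_ifs at this ⊢ <;> omega
      obtain ⟨σ₃, t₃, h₃, ht₃, hσ₃, hv₃⟩ := hf c (by omega) hb2 _ hag
      have h₄ := Exec.move (w := w) (M := M) (d := d) (r := d + 2) (σ := σ₃) (by omega)
        (by rw [hv₃]; exact hg c (by omega))
      obtain ⟨σ₅, t₅, h₅, ht₅, hσ₅, hv₅⟩ := ih (by omega) (σ₃.set d (σ₃.reg (d + 2))) (by
        refine ⟨hσ₃.1, fun r hr => ?_⟩
        have := hσ₃.2 r hr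
        simp only [Store.set_reg] at this ⊢
        split_ifs at this ⊢ <;> omega)
      refine ⟨σ₅, _, Exec.loop_pos (by omega) (Exec.seq e1 (Exec.seq e2 (Exec.seq h₃ h₄))) h₅,
        ?_, hσ₅, hv₅⟩
      rw [add_mul]; omega
  obtain ⟨σ₁, t₁, h₁, ht₁, hσ₁, hv₁⟩ := (Flat.exec (w := w) hb e he hed).2 d le_rfl σ hσ
  obtain ⟨σ₂, t₂, h₂, ht₂, hσ₂, hv₂⟩ :=
    (Flat.exec (w := w) hb n hn hnd).2 (d + 1) (by omega) σ₁ (hσ.trans hσ₁)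
  obtain ⟨σ₃, t₃, h₃, ht₃, hσ₃, hv₃⟩ := hloop N le_rfl σ₂ (by
    refine ((((hσ.trans hσ₁).set_succ (g N) (by rw [hv₁, hev])).trans hσ₂).set_succ N ?_)
    rw [hv₂, hnv])
  exact ⟨σ₃, _, Exec.seq h₁ (Exec.seq h₂ h₃), by omega, hσ₃, hv₃⟩

theorem Evals.sumE {n : Flat} {f : ℕ → Expr} {N : ℕ} {v : ℕ → ℤ} {tb T : ℕ} {B : ℤ}
    (hn : n.WF d) (hnd : n.deg ≤ 64) (hnv : n.eval s = N) (hN : (N : ℤ) ≤ M)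
    (hv : ∀ i < N, |v i| ≤ B) (hB : 0 ≤ B) (hNB : N * B ≤ M) (hBM : B ≤ M)
    (hf : ∀ i < N, ∀ x, Evals w M (d + 2) (f (d + 1)) ((s.set d x).set (d + 1) i) (v i) tb)
    (hT : n.time + 2 + N * (tb + 12) ≤ T) :
    Evals w M d (sumE n f) s (∑ i ∈ Finset.range N, v i) T := by
  have hg : ∀ c ≤ N, |∑ i ∈ Finset.Ico c N, v i| ≤ M := fun c hc => by
    refine (Finset.abs_sum_le_sum_abs _ _).trans
      ((Finset.sum_le_card_nsmul _ _ B fun i hi => hv i (Finset.mem_Ico.1 hi).2).trans ?_)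
    rw [Nat.card_Ico, nsmul_eq_mul]
    refine le_trans ?_ hNB
    gcongr
    omega
  have := Evals.foldE (w := w) (M := M) (d := d) (s := s) (n := n) (e := .lit 0)
    (f := fun x i => RAM.letE (f i) fun y => (Flat.var x + .var y).code)
    (N := N) (g := fun c => ∑ i ∈ Finset.Ico c N, v i) (tb := tb + 7) (T := T)
    hn hnd hnv hN (by simp) (by simp) (by simp) hg
    (fun c hc => by
      refine Evals.letE (hf c hc _) ((hv c hc).trans hBM) (t' := 5) ?_ (hg c hc.le) (by omega)
      refine Evals.flat (by simp) (by simp) ?_ (by simp)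
      simp only [Flat.eval_add, Flat.eval_var, Store.set_reg]
      simp [Finset.sum_eq_sum_Ico_succ_bot hc, add_comm])
    (by simp; linarith)
  simpa [RAM.sumE] using this

end

/-! ### Commands -/

/-- Put the value of an expression into a register. Registers below `32` are the variables of the
programs written in this language; the other ones serve for the evaluation of expressions. -/
def assign (r : ℕ) (e : Expr) : Prog :=
  .seq (e 32) (.seq (.instr (.const r 0)) (.instr (.op .add r 32 r)))

/-- Write the value of `e` into the memory cell with address `a`. -/
def write (a : Flat) (e : Expr) : Prog :=
  .seq (e 32) (.seq (a.code 33) (.instr (.store 33 32)))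

/-- Branch on the sign of an expression. -/
def cond (e : Expr) (p q : Prog) : Prog := .seq (e 32) (.ite 32 p q)

/-- Repeat `p` with `n - 1, …, 1, 0` in register `r`. -/
def forDown (r : ℕ) (n : Flat) (p : Prog) : Prog :=
  .seq (assign r n.code) (.loop r (.seq (assign r (Flat.var r - .lit 1).code) p))

/-- Started in a storage that agrees with `s` on the memory and the variables, the program halts
within `t` steps in a storage with the property `Q`, as far as memory and variables go. All
storages are bounded by `M`, and no integer written has more than `w` digits. -/
def Runs (w M : ℕ) (p : Prog) (s : Store) (t : ℕ) (Q : Store → Prop) : Prop :=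
  Bounded M 32 s → ∃ s', Bounded M 32 s' ∧ Q s' ∧
    ∀ σ, Agree 32 s σ → ∃ σ' t', Exec w p σ σ' t' ∧ t' ≤ t ∧ Agree 32 s' σ'

section
variable {w M : ℕ} {s : Store} {Q : Store → Prop}

theorem Runs.mono {p : Prog} {t t' : ℕ} {Q' : Store → Prop} (h : Runs w M p s t Q)
    (hQ : ∀ s', Q s' → Q' s') (ht : t ≤ t') : Runs w M p s t' Q' := fun hb => by
  obtain ⟨s', hb', hq, h⟩ := h hb
  refine ⟨s', hb', hQ _ hq, fun σ hσ => ?_⟩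
  obtain ⟨σ', u, h1, h2, h3⟩ := h σ hσ
  exact ⟨σ', u, h1, h2.trans ht, h3⟩

theorem Runs.skip (hQ : Q s) : Runs w M .skip s 1 Q := fun hb =>
  ⟨s, hb, hQ, fun σ hσ => ⟨σ, 1, Exec.skip σ, le_rfl, hσ⟩⟩

theorem Runs.seq {p q : Prog} {t t' T : ℕ} (R : Store → Prop) (hp : Runs w M p s t R)
    (hq : ∀ s', R s' → Runs w M q s' t' Q) (hT : t + t' ≤ T) : Runs w M (.seq p q) s T Q :=
  fun hb => by
  obtain ⟨s₁, hb₁, hr, h₁⟩ := hp hb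
  obtain ⟨s₂, hb₂, hq, h₂⟩ := hq s₁ hr hb₁
  refine ⟨s₂, hb₂, hq, fun σ hσ => ?_⟩
  obtain ⟨σ₁, t₁, e₁, ht₁, ha₁⟩ := h₁ σ hσ
  obtain ⟨σ₂, t₂, e₂, ht₂, ha₂⟩ := h₂ σ₁ ha₁
  exact ⟨σ₂, _, Exec.seq e₁ e₂, by omega, ha₂⟩

theorem Runs.cond {e : Expr} {p q : Prog} {v : ℤ} {te t T : ℕ} (he : Evals w M 32 e s v te)
    (hp : 0 < v → Runs w M p s t Q) (hq : ¬ 0 < v → Runs w M q s t Q) (hT : te + t + 1 ≤ T) :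
    Runs w M (cond e p q) s T Q := fun hb => by
  by_cases hv : 0 < v
  · obtain ⟨s₁, hb₁, hr, h₁⟩ := hp hv hb
    refine ⟨s₁, hb₁, hr, fun σ hσ => ?_⟩
    obtain ⟨σ₁, t₁, e₁, ht₁, ha₁, hv₁⟩ := he hb σ hσ
    obtain ⟨σ₂, t₂, e₂, ht₂, ha₂⟩ := h₁ σ₁ ha₁
    exact ⟨σ₂, _, Exec.seq e₁ (Exec.ite_pos (by rw [hv₁]; exact hv) e₂), by omega, ha₂⟩
  · obtain ⟨s₁, hb₁, hr, h₁⟩ := hq hv hb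
    refine ⟨s₁, hb₁, hr, fun σ hσ => ?_⟩
    obtain ⟨σ₁, t₁, e₁, ht₁, ha₁, hv₁⟩ := he hb σ hσ
    obtain ⟨σ₂, t₂, e₂, ht₂, ha₂⟩ := h₁ σ₁ ha₁
    exact ⟨σ₂, _, Exec.seq e₁ (Exec.ite_neg (by rw [hv₁]; exact hv) e₂), by omega, ha₂⟩

variable [hC : Capacity w M]

theorem Runs.assign {r : ℕ} {e : Expr} {v : ℤ} {t T : ℕ} (he : Evals w M 32 e s v t)
    (hr : r < 32) (hv : |v| ≤ M) (hQ : Q (s.set r v)) (hT : t + 2 ≤ T) :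
    Runs w M (assign r e) s T Q := fun hb => by
  refine ⟨_, hb.set hv r, hQ, fun σ hσ => ?_⟩
  obtain ⟨σ₁, t₁, e₁, ht₁, ha₁, hv₁⟩ := he hb σ hσ
  have h := Exec.move (w := w) (M := M) (d := r) (r := 32) (σ := σ₁) (by omega)
    (by rw [hv₁]; exact hv)
  rw [hv₁] at h
  exact ⟨_, _, Exec.seq e₁ h, by omega, ha₁.set r v⟩

theorem Runs.write {a : Flat} {e : Expr} {x v : ℤ} {t T : ℕ} (he : Evals w M 32 e s v t)
    (hv : |v| ≤ M) (ha : a.WF 32) (had : a.deg ≤ 64) (hx : a.eval s = x) (hQ : Q (s.put x v))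
    (hT : t + a.time + 1 ≤ T) : Runs w M (write a e) s T Q := fun hb => by
  refine ⟨_, hb.put hv x, hQ, fun σ hσ => ?_⟩
  obtain ⟨σ₁, t₁, e₁, ht₁, ha₁, hv₁⟩ := he hb σ hσ
  obtain ⟨σ₂, t₂, e₂, ht₂, ha₂, hv₂⟩ :=
    (Flat.exec (w := w) hb a ha had).2 33 (by omega) σ₁ ha₁
  have hval : (Instr.store 33 32).value σ₂ = v := by
    simp only [Instr.value, ← ha₂.2 32 (by omega), hv₁]
  have e₃ := Exec.instr (w := w) (.store 33 32) σ₂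
    (hC.size_le (k := 1) (by norm_num) (by rw [hval, pow_one]; exact hv))
  refine ⟨_, _, Exec.seq e₁ (Exec.seq e₂ e₃), by omega, ?_⟩
  simp only [Instr.run, hval, hv₂, hx]
  exact (ha₁.trans (ha₂.mono (by omega))).put x v

theorem Runs.assign_seq {r : ℕ} {e : Expr} {q : Prog} {v : ℤ} {t t' T : ℕ}
    (he : Evals w M 32 e s v t) (hr : r < 32) (hv : |v| ≤ M) (hq : Runs w M q (s.set r v) t' Q)
    (hT : t + 2 + t' ≤ T) : Runs w M (.seq (RAM.assign r e) q) s T Q :=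
  Runs.seq (fun s' => s' = s.set r v) (Runs.assign he hr hv rfl le_rfl)
    (fun _ hs' => by rw [hs']; exact hq) hT

theorem Runs.write_seq {a : Flat} {e : Expr} {q : Prog} {x v : ℤ} {t t' T : ℕ}
    (he : Evals w M 32 e s v t) (hv : |v| ≤ M) (ha : a.WF 32) (had : a.deg ≤ 64)
    (hx : a.eval s = x) (hq : Runs w M q (s.put x v) t' Q) (hT : t + a.time + 1 + t' ≤ T) :
    Runs w M (.seq (RAM.write a e) q) s T Q :=
  Runs.seq (fun s' => s' = s.put x v) (Runs.write he hv ha had hx rfl le_rfl)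
    (fun _ hs' => by rw [hs']; exact hq) hT

/-- The rule for loops: `I c` holds whenever `c` rounds remain to be done. -/
theorem Runs.forDown {r : ℕ} {n : Flat} {p : Prog} {N : ℕ} {tb T : ℕ} (I : ℕ → Store → Prop)
    (hr : r < 32) (hn : n.WF 32) (hnd : n.deg ≤ 64) (hnv : n.eval s = N) (hN : (N : ℤ) ≤ M)
    (hI : I N (s.set r N))
    (hstep : ∀ c < N, ∀ s', I (c + 1) s' → s'.reg r = c + 1 →
      Runs w M p (s'.set r c) tb (fun s'' => I c s'' ∧ s''.reg r = c))
    (hQ : ∀ s', I 0 s' → Q s') (hT : n.time + 3 + N * (tb + 7) ≤ T) :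
    Runs w M (forDown r n p) s T Q := by
  have hloop : ∀ c ≤ N, ∀ s', I c s' → s'.reg r = c →
      Runs w M (.loop r (.seq (RAM.assign r (Flat.var r - .lit 1).code) p)) s'
        (1 + c * (tb + 7)) Q := by
    intro c
    induction c with
    | zero =>
      intro _ s' hI hs hb
      refine ⟨s', hb, hQ _ hI, fun σ hσ => ⟨σ, 1, Exec.loop_neg ?_, by omega, hσ⟩⟩
      rw [← hσ.2 r hr, hs]; simp
    | succ c ih =>
      intro hc s' hI hs hb
      have h1 : Runs w M (RAM.assign r (Flat.var r - .lit 1).code) s' 6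
          (fun s'' => s'' = s'.set r c) :=
        Runs.assign (Evals.flat (v := c) (by simp; omega) (by simp) (by simp [hs]) le_rfl) hr
          (by rw [abs_of_nonneg (by omega)]; omega) rfl (by simp)
      have h2 := Runs.seq (T := tb + 6) (Q := fun s'' => I c s'' ∧ s''.reg r = c) _ h1
        (fun s'' hs'' => by rw [hs'']; exact hstep c (by omega) s' hI (by rw [hs]; push_cast; rfl))
        (by omega)
      obtain ⟨s₁, hb₁, ⟨hI₁, hr₁⟩, h₁⟩ := h2 hb
      obtain ⟨s₂, hb₂, hQ₂, h₂⟩ := ih (by omega) s₁ hI₁ hr₁ hb₁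
      refine ⟨s₂, hb₂, hQ₂, fun σ hσ => ?_⟩
      obtain ⟨σ₁, t₁, e₁, ht₁, ha₁⟩ := h₁ σ hσ
      obtain ⟨σ₂, t₂, e₂, ht₂, ha₂⟩ := h₂ σ₁ ha₁
      refine ⟨σ₂, _, Exec.loop_pos ?_ e₁ e₂, ?_, ha₂⟩
      · rw [← hσ.2 r hr, hs]; push_cast; omega
      · rw [add_mul]; omega
  refine Runs.seq (t := n.time + 2) _ (Runs.assign (Q := fun s' => s' = s.set r N)
    (Evals.flat hn hnd hnv le_rfl) hr (by rw [abs_of_nonneg (by omega)]; exact hN) rfl le_rfl)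
    (fun s' hs' => by
      subst hs'
      exact hloop N le_rfl _ hI (by simp)) (by omega)

end

end RAM

namespace IntProg

/-! ### Small integer kernel vectors and separating functionals -/

section
variable {m n : ℕ} (A : Matrix (Fin m) (Fin n) ℤ)

/-- No nontrivial integral linear combination of the columns in `S` vanishes. -/
def IndepCols (S : Finset (Fin n)) : Prop :=
  ∀ w : Fin n → ℤ, A.mulVec w = 0 → (∀ l, l ∉ S → w l = 0) → w = 0

theorem sum_single_le {ι κ : Type*} [Fintype ι] [DecidableEq ι] [Fintype κ] (f : κ → ι)
    (hf : Function.Injective f) (v : κ → ℤ) {B : ℤ} (hB : 0 ≤ B) (hv : ∀ a, |v a| ≤ B) (l : ι) :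
    |∑ a, (Pi.single (f a) (v a) : ι → ℤ) l| ≤ B := by
  classical
  by_cases h : ∃ a, f a = l
  · obtain ⟨a, rfl⟩ := h
    rw [Finset.sum_eq_single a]
    · simpa using hv a
    · intro b _ hb
      rw [Pi.single_apply, if_neg]
      exact fun h => hb (hf h.symm)
    · simp
  · rw [Finset.sum_eq_zero]
    · simpa using hB
    · intro a _
      rw [Pi.single_apply, if_neg]
      exact fun h' => h ⟨a, h'.symm⟩

theorem abs_minor_le {D : ℕ} (hD : ∀ i j, |A i j| ≤ (D : ℤ)) (hn : 1 ≤ n) (hD1 : 1 ≤ D) {t : ℕ}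
    (htm : t ≤ m) (htn : t ≤ n) (r : Fin t → Fin m) (s : Fin t → Fin n) :
    |(A.submatrix r s).det| ≤ ((n * D : ℕ) : ℤ) ^ m := by
  have h := Matrix.det_le (A := A.submatrix r s) (abv := AbsoluteValue.abs) (x := (D : ℤ))
    (fun i j => hD _ _)
  refine (show |(A.submatrix r s).det| ≤ _ from h).trans ?_
  have h1 : t.factorial * D ^ t ≤ (n * D) ^ m :=
    calc t.factorial * D ^ t ≤ t ^ t * D ^ t := by gcongr; exact Nat.factorial_le_pow t
      _ ≤ n ^ t * D ^ t := by gcongr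
      _ = (n * D) ^ t := (mul_pow _ _ _).symm
      _ ≤ (n * D) ^ m := Nat.pow_le_pow_right (Nat.mul_pos hn hD1) htm
  simp only [Fintype.card_fin, nsmul_eq_mul]
  exact_mod_cast h1

theorem injective_of_minor_ne_zero {t : ℕ} {r : Fin t → Fin m} {s : Fin t → Fin n}
    (h : (A.submatrix r s).det ≠ 0) : Function.Injective r ∧ Function.Injective s := by
  constructor
  · intro a b hab
    by_contra hne
    exact h (Matrix.det_zero_of_row_eq hne (by ext; simp [hab]))
  · intro a b hab
    by_contra hne
    exact h (Matrix.det_zero_of_column_eq hne (by intro; simp [hab]))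

/-- A column `j` either lies in the rational span of the columns in `S`, and then there is a small
kernel vector witnessing this, or it is separated from them by a small functional. Both arise as
cofactors of the matrices that border a maximal nonvanishing minor of the columns in `S` by the
column `j`. -/
theorem exists_kernel_or_functional {D : ℕ} (hD : ∀ i j, |A i j| ≤ (D : ℤ)) (hn : 1 ≤ n)
    (hD1 : 1 ≤ D) (S : Finset (Fin n)) (j : Fin n) (hj : j ∉ S) :
    (∃ y : Fin n → ℤ, A.mulVec y = 0 ∧ y j ≠ 0 ∧ (∀ l, l ∉ insert j S → y l = 0) ∧
      ∀ l, |y l| ≤ ((n * D : ℕ) : ℤ) ^ m) ∨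
    ∃ u : Fin m → ℤ, (∀ l ∈ S, ∑ i, u i * A i l = 0) ∧ 0 < ∑ i, u i * A i j ∧
      ∀ i, |u i| ≤ ((n * D : ℕ) : ℤ) ^ m := by
  classical
  let P : ℕ → Prop := fun t => ∃ (r : Fin t → Fin m) (s : Fin t → Fin n), (∀ a, s a ∈ S) ∧
    (A.submatrix r s).det ≠ 0
  have hP0 : P 0 := ⟨Fin.elim0, Fin.elim0, fun a => a.elim0, by simp⟩
  have hPm : ∀ t, P t → t ≤ m := fun t ⟨r, s, _, h⟩ => by
    simpa using Fintype.card_le_of_injective r (injective_of_minor_ne_zero A h).1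
  obtain ⟨t, ht, hmax⟩ : ∃ t, P t ∧ ¬ P (t + 1) := by
    refine ⟨Nat.findGreatest P m, Nat.findGreatest_spec (Nat.zero_le _) hP0, fun h => ?_⟩
    have := Nat.le_findGreatest (hPm _ h) h
    omega
  have htm := hPm t ht
  obtain ⟨r, s, hs, hdet⟩ := ht
  have hsinj := (injective_of_minor_ne_zero A hdet).2
  have htn : t ≤ n := by simpa using Fintype.card_le_of_injective s hsinj
  have hB : (0 : ℤ) ≤ ((n * D : ℕ) : ℤ) ^ m := by positivity
  by_cases hall : ∀ i, (A.submatrix (Fin.cons i r : Fin (t + 1) → Fin m)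
      (Fin.cons j s : Fin (t + 1) → Fin n)).det = 0
  · left
    let q : Fin (t + 1) → Fin n := Fin.cons j s
    let v : Fin (t + 1) → ℤ := fun a => (-1) ^ (a : ℕ) * (A.submatrix r (q ∘ a.succAbove)).det
    have hq : Function.Injective q := by
      rw [Fin.cons_injective_iff]
      exact ⟨fun ⟨a, ha⟩ => hj (ha ▸ hs a), hsinj⟩
    refine ⟨fun l => ∑ a, (Pi.single (q a) (v a) : Fin n → ℤ) l, ?_, ?_, ?_, ?_⟩
    · ext i
      have h := hall i
      rw [Matrix.det_succ_row_zero] at h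
      simp only [Matrix.mulVec, dotProduct, Finset.mul_sum, Pi.zero_apply]
      rw [Finset.sum_comm, ← h]
      refine Finset.sum_congr rfl fun a _ => ?_
      rw [Finset.sum_eq_single (q a)]
      · simp only [Pi.single_eq_same, v, Matrix.submatrix_apply, Fin.cons_zero,
          Matrix.submatrix_submatrix]
        have : (Fin.cons i r : Fin (t + 1) → Fin m) ∘ Fin.succ = r := by ext; simp
        rw [this]
        simp only [q]
        ring
      · intro l _ hl
        rw [Pi.single_eq_of_ne hl, mul_zero]
      · simp
    · change ∑ a, (Pi.single (q a) (v a) : Fin n → ℤ) j ≠ 0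
      rw [Finset.sum_eq_single 0]
      · have : q 0 = j := rfl
        rw [this, Pi.single_eq_same]
        have h2 : q ∘ Fin.succ = s := by ext; simp [q]
        simpa [v, h2] using hdet
      · intro a _ ha
        rw [Pi.single_apply, if_neg]
        exact fun h => ha (hq h.symm)
      · simp
    · intro l hl
      refine Finset.sum_eq_zero fun a _ => ?_
      rw [Pi.single_apply, if_neg]
      rintro rfl
      apply hl
      refine Fin.cases ?_ (fun b => ?_) a
      · simp [q]
      · simp [q, hs b]
    · refine sum_single_le q hq v hB fun a => ?_
      rw [abs_mul, abs_pow, abs_neg, abs_one, one_pow, one_mul]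
      exact abs_minor_le A hD hn hD1 htm htn _ _
  · right
    push Not at hall
    obtain ⟨i, hi⟩ := hall
    let q : Fin (t + 1) → Fin m := Fin.cons i r
    let v : Fin (t + 1) → ℤ := fun a => (-1) ^ (a : ℕ) * (A.submatrix (q ∘ a.succAbove) s).det
    have hq : Function.Injective q := (injective_of_minor_ne_zero A hi).1
    let u : Fin m → ℤ := fun l => ∑ a, (Pi.single (q a) (v a) : Fin m → ℤ) l
    have hu : ∀ l, ∑ k, u k * A k l =
        (A.submatrix q (Fin.cons l s : Fin (t + 1) → Fin n)).det := by
      intro l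
      rw [Matrix.det_succ_column_zero]
      simp only [u, Finset.sum_mul]
      rw [Finset.sum_comm]
      refine Finset.sum_congr rfl fun a _ => ?_
      rw [Finset.sum_eq_single (q a)]
      · simp only [Pi.single_eq_same, v, Matrix.submatrix_apply, Fin.cons_zero,
          Matrix.submatrix_submatrix]
        have : (Fin.cons l s : Fin (t + 1) → Fin n) ∘ Fin.succ = s := by ext; simp
        rw [this]
        ring
      · intro k _ hk
        rw [Pi.single_eq_of_ne hk, zero_mul]
      · simp
    have hub : ∀ k, |u k| ≤ ((n * D : ℕ) : ℤ) ^ m := sum_single_le q hq v hB fun a => by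
      rw [abs_mul, abs_pow, abs_neg, abs_one, one_pow, one_mul]
      exact abs_minor_le A hD hn hD1 htm htn _ _
    have hu0 : ∀ l ∈ S, ∑ k, u k * A k l = 0 := by
      intro l hl
      rw [hu]
      by_contra h
      refine hmax ⟨q, Fin.cons l s, fun a => ?_, h⟩
      refine Fin.cases ?_ (fun b => ?_) a
      · simpa using hl
      · simpa using hs b
    have huj : ∑ k, u k * A k j ≠ 0 := by rw [hu]; exact hi
    rcases lt_or_gt_of_ne huj with h | h
    · refine ⟨fun k => - u k, fun l hl => ?_, ?_, fun k => by rw [abs_neg]; exact hub k⟩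
      · simp [hu0 l hl]
      · simpa using h
    · exact ⟨u, hu0, h, hub⟩

variable {A}

theorem sum_functional_mul (u : Fin m → ℤ) (x : Fin n → ℤ) :
    ∑ i, u i * A.mulVec x i = ∑ l, (∑ i, u i * A i l) * x l := by
  simp only [Matrix.mulVec, dotProduct, Finset.mul_sum, Finset.sum_mul]
  rw [Finset.sum_comm]
  exact Finset.sum_congr rfl fun _ _ => Finset.sum_congr rfl fun _ _ => by ring

theorem exists_kernel_of_not_indepCols {D : ℕ} (hD : ∀ i j, |A i j| ≤ (D : ℤ)) (hn : 1 ≤ n)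
    (hD1 : 1 ≤ D) {S : Finset (Fin n)} (hS : ¬ IndepCols A S) :
    ∃ y : Fin n → ℤ, A.mulVec y = 0 ∧ y ≠ 0 ∧ (∀ l, l ∉ S → y l = 0) ∧
      ∀ l, |y l| ≤ ((n * D : ℕ) : ℤ) ^ m := by
  classical
  unfold IndepCols at hS
  push Not at hS
  obtain ⟨w, hw, hwS, hw0⟩ := hS
  obtain ⟨j, hj⟩ := Function.ne_iff.1 hw0
  have hjS : j ∈ S := by by_contra h; exact hj (hwS j h)
  rcases exists_kernel_or_functional A hD hn hD1 (S.erase j) j (by simp) with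
    ⟨y, h1, h2, h3, h4⟩ | ⟨u, h1, h2, -⟩
  · refine ⟨y, h1, fun h => h2 (by simp [h]), ?_, h4⟩
    rwa [Finset.insert_erase hjS] at h3
  · exfalso
    have h := sum_functional_mul (A := A) u w
    rw [hw, Finset.sum_eq_single j] at h
    · simp at h
      rcases h with h | h
      · exact h2.ne' h
      · exact hj h
    · intro l _ hl
      by_cases hlS : l ∈ S
      · rw [h1 l (Finset.mem_erase.2 ⟨hl, hlS⟩), zero_mul]
      · rw [hwS l hlS, mul_zero]
    · simp

theorem IndepCols.exists_functional {D : ℕ} (hD : ∀ i j, |A i j| ≤ (D : ℤ)) (hn : 1 ≤ n)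
    (hD1 : 1 ≤ D) {S : Finset (Fin n)} (hS : IndepCols A S) {j : Fin n} (hj : j ∈ S) :
    ∃ u : Fin m → ℤ, (∀ l ∈ S, l ≠ j → ∑ i, u i * A i l = 0) ∧ 0 < ∑ i, u i * A i j ∧
      ∀ i, |u i| ≤ ((n * D : ℕ) : ℤ) ^ m := by
  classical
  rcases exists_kernel_or_functional A hD hn hD1 (S.erase j) j (by simp) with
    ⟨y, h1, h2, h3, -⟩ | ⟨u, h1, h2, h3⟩
  · rw [Finset.insert_erase hj] at h3
    exact absurd (congrFun (hS y h1 h3) j) h2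
  · exact ⟨u, fun l hl hlj => h1 l (Finset.mem_erase.2 ⟨hlj, hl⟩), h2, h3⟩

theorem IndepCols.card_le {S : Finset (Fin n)} (hS : IndepCols A S) : S.card ≤ m := by
  classical
  have h : LinearIndependent ℤ (fun j : S => A.col j) := by
    rw [Fintype.linearIndependent_iff]
    intro g hg j
    have h0 := hS (fun l => if h : l ∈ S then g ⟨l, h⟩ else 0) (by
      ext i
      have hi := congrFun hg i
      simp only [Finset.sum_apply, Pi.smul_apply, smul_eq_mul, Matrix.col_apply,
        Pi.zero_apply] at hi
      simp only [Matrix.mulVec, dotProduct, Pi.zero_apply]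
      refine Eq.trans ?_ hi
      rw [← Finset.sum_subset (Finset.subset_univ S), ← Finset.sum_coe_sort S]
      · exact Finset.sum_congr rfl fun l _ => by simp [mul_comm]
      · intro l _ hl
        simp [hl]) (by intro l hl; simp [hl])
    simpa using congrFun h0 j
  simpa using h.fintype_card_le_finrank

/-! ### Feasible points with few large coordinates -/

/-- Along a direction with a negative coordinate and steps at most `K`, one can move until some
coordinate is below `K`, without leaving the nonnegative orthant. -/
theorem exists_step {K : ℤ} {S : Finset (Fin n)} {x y : Fin n → ℤ} (hx : ∀ j ∈ S, K ≤ x j)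
    (hy : ∀ j, |y j| ≤ K) {j₀ : Fin n} (hj₀ : j₀ ∈ S) (hneg : y j₀ < 0) :
    ∃ t : ℕ, (∀ j ∈ S, 0 ≤ x j + t * y j) ∧ ∃ j ∈ S, x j + t * y j < K := by
  classical
  have hex : ∃ t : ℕ, ∃ j ∈ S, x j + t * y j < K := by
    refine ⟨(x j₀ - K + 1).toNat, j₀, hj₀, ?_⟩
    have := hx j₀ hj₀
    rw [Int.toNat_of_nonneg (by omega)]
    nlinarith
  refine ⟨Nat.find hex, fun j hj => ?_, Nat.find_spec hex⟩
  have hpos : Nat.find hex ≠ 0 := fun h => by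
    obtain ⟨j, hj, h'⟩ := Nat.find_spec hex
    rw [h] at h'
    have := hx j hj
    simp at h'
    omega
  obtain ⟨k, hk⟩ := Nat.exists_eq_succ_of_ne_zero hpos
  have h1 := Nat.find_min hex (m := k) (by omega)
  push Not at h1
  have h2 := h1 j hj
  rw [hk]
  push_cast
  have := neg_abs_le (y j)
  have := hy j
  linarith [add_mul (k : ℤ) 1 (y j)]

/-- If no small nonnegative kernel vector improves the objective, then every feasible point is
dominated by the sum of a point of the box `[0, K]ⁿ` and a nonnegative point that is supported on
independent columns. As long as the columns of the coordinates from `K` on are dependent, a move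
along a small kernel vector makes one of these coordinates small and does not decrease the
objective. -/
theorem exists_decomposition {D : ℕ} (hD : ∀ i j, |A i j| ≤ (D : ℤ)) (hn : 1 ≤ n)
    (hD1 : 1 ≤ D) (c : Fin n → ℤ)
    (hc : ∀ y : Fin n → ℤ, (∀ j, 0 ≤ y j ∧ y j ≤ ((n * D : ℕ) : ℤ) ^ m) → A.mulVec y = 0 →
      dotProduct c y ≤ 0)
    (x : Fin n → ℤ) (hx : ∀ j, 0 ≤ x j) :
    ∃ (x' x'' : Fin n → ℤ) (S : Finset (Fin n)), (∀ j, 0 ≤ x' j ∧ x' j ≤ ((n * D : ℕ) : ℤ) ^ m) ∧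
      (∀ j, 0 ≤ x'' j) ∧ IndepCols A S ∧ (∀ j, j ∉ S → x'' j = 0) ∧
      A.mulVec (x' + x'') = A.mulVec x ∧ dotProduct c x ≤ dotProduct c (x' + x'') := by
  classical
  generalize hK : ((n * D : ℕ) : ℤ) ^ m = K at *
  have hK0 : 0 < K := by rw [← hK]; have := Nat.mul_pos hn hD1; positivity
  induction hN : (Finset.univ.filter fun j => K ≤ x j).card using Nat.strong_induction_on
    generalizing x with
  | _ N ih =>
    set S := Finset.univ.filter fun j => K ≤ x j with hSdef
    have hmem : ∀ j, j ∈ S ↔ K ≤ x j := fun j => by simp [S]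
    by_cases hS : IndepCols A S
    · refine ⟨fun j => if j ∈ S then 0 else x j, fun j => if j ∈ S then x j else 0, S,
        fun j => ?_, fun j => ?_, hS, fun j hj => if_neg hj, ?_, ?_⟩
      · dsimp only
        split_ifs with h
        · exact ⟨le_rfl, hK0.le⟩
        · exact ⟨hx j, by have := (hmem j).not.1 h; omega⟩
      · dsimp only
        split_ifs with h
        · exact hx j
        · exact le_rfl
      · congr 1
        ext j
        by_cases h : j ∈ S <;> simp [h]
      · refine le_of_eq ?_
        congr 1
        ext j
        by_cases h : j ∈ S <;> simp [h]
    · obtain ⟨y, hy, hy0, hyS, hyK⟩ := exists_kernel_of_not_indepCols hD hn hD1 hS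
      rw [hK] at hyK
      -- Choose the sign of the direction such that it decreases a coordinate and does not
      -- decrease the objective.
      obtain ⟨y, hy, hyS, hyK, ⟨j₀, hneg⟩, hcy⟩ : ∃ y : Fin n → ℤ, A.mulVec y = 0 ∧
          (∀ l, l ∉ S → y l = 0) ∧ (∀ l, |y l| ≤ K) ∧ (∃ j, y j < 0) ∧ 0 ≤ dotProduct c y := by
        by_cases h1 : ∃ j, y j < 0
        · by_cases h2 : 0 ≤ dotProduct c y
          · exact ⟨y, hy, hyS, hyK, h1, h2⟩
          · refine ⟨-y, by rw [Matrix.mulVec_neg, hy, neg_zero], fun l hl => by simp [hyS l hl],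
              fun l => by simpa using hyK l, ?_, by rw [dotProduct_neg]; omega⟩
            by_contra h3
            push Not at h3
            have h4 := hc (-y) (fun j => ⟨h3 j, (le_abs_self _).trans (by simpa using hyK j)⟩)
              (by rw [Matrix.mulVec_neg, hy, neg_zero])
            rw [dotProduct_neg] at h4
            omega
        · push Not at h1
          obtain ⟨j, hj⟩ := Function.ne_iff.1 hy0
          have h4 := hc y (fun j => ⟨h1 j, (le_abs_self _).trans (hyK j)⟩) hy
          refine ⟨-y, by rw [Matrix.mulVec_neg, hy, neg_zero], fun l hl => by simp [hyS l hl],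
              fun l => by simpa using hyK l, ⟨j, ?_⟩, by rw [dotProduct_neg]; omega⟩
          have := h1 j
          have : y j ≠ 0 := hj
          simp only [Pi.neg_apply]
          omega
      have hj₀ : j₀ ∈ S := by by_contra h; rw [hyS _ h] at hneg; omega
      obtain ⟨t, ht0, j₁, hj₁, ht1⟩ := exists_step (fun j hj => (hmem j).1 hj) hyK hj₀ hneg
      have hAx : A.mulVec (x + (t : ℤ) • y) = A.mulVec x := by
        rw [Matrix.mulVec_add, Matrix.mulVec_smul, hy, smul_zero, add_zero]
      have hcx : dotProduct c x ≤ dotProduct c (x + (t : ℤ) • y) := by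
        rw [dotProduct_add, dotProduct_smul, smul_eq_mul]
        have : 0 ≤ (t : ℤ) * dotProduct c y := by positivity
        omega
      have hlt : (Finset.univ.filter fun j => K ≤ (x + (t : ℤ) • y) j).card < N := by
        rw [← hN]
        refine Finset.card_lt_card ⟨fun j hj => ?_, fun h => ?_⟩
        · by_contra hjS
          simp [hyS j hjS] at hj
          exact hjS ((hmem j).2 hj)
        · have := h hj₁
          simp at this
          omega
      obtain ⟨x', x'', T, h1, h2, h3, h4, h5, h6⟩ := ih _ hlt (x + (t : ℤ) • y) (fun j => by
        by_cases hjS : j ∈ S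
        · simpa using ht0 j hjS
        · simpa [hyS j hjS] using hx j) rfl
      exact ⟨x', x'', T, h1, h2, h3, h4, h5.trans hAx, hcx.trans h6⟩

end

/-! ### Aggregated columns and the knapsack recursion -/

open Finset in
theorem eq_zero_of_sum_mul_pow_eq_zero {W : ℤ} (hW : 0 < W) :
    ∀ (m : ℕ) (d : ℕ → ℤ), (∀ i < m, |d i| < W) → ∑ i ∈ range m, d i * W ^ i = 0 →
      ∀ i < m, d i = 0
  | 0, _, _, _ => by simp
  | m + 1, d, hd, h => by
    rw [sum_range_succ'] at h
    have h1 : ∑ i ∈ range m, d (i + 1) * W ^ (i + 1) =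
        W * ∑ i ∈ range m, d (i + 1) * W ^ i := by
      rw [mul_sum]
      exact sum_congr rfl fun i _ => by ring
    rw [h1, pow_zero, mul_one] at h
    have h0 : d 0 = 0 := by
      refine Int.eq_zero_of_abs_lt_dvd (m := W) ?_ (hd 0 (by omega))
      exact ⟨-∑ i ∈ range m, d (i + 1) * W ^ i, by linarith⟩
    have h2 : ∑ i ∈ range m, d (i + 1) * W ^ i = 0 := by
      rw [h0, add_zero] at h
      exact (mul_eq_zero.1 h).resolve_left hW.ne'
    intro i hi
    rcases i with _ | i
    · exact h0
    · exact eq_zero_of_sum_mul_pow_eq_zero hW m (fun i => d (i + 1))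
        (fun i hi => hd (i + 1) (by omega)) h2 i (by omega)

/-- The data of an integer program, with indices in `ℕ` (only indices below `m` and `n` matter),
together with a bound `D` for the coefficients of the constraints. -/
structure Data where
  m : ℕ
  n : ℕ
  D : ℕ
  a : ℕ → ℕ → ℤ
  b : ℕ → ℤ
  c : ℕ → ℤ
  one_le_n : 1 ≤ n
  one_le_D : 1 ≤ D
  abs_a_le : ∀ i j, |a i j| ≤ (D : ℤ)

namespace Data
open Finset
variable (P : Data)

/-- The bound for the coordinates of elementary kernel vectors and functionals. -/
def K : ℕ := (P.n * P.D) ^ P.m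

/-- The base of the encoding of vectors with entries of absolute value at most `n D K`. -/
def W : ℕ := 2 * P.n * P.D * P.K + 1

/-- The number of encoded vectors. -/
def N : ℕ := P.W ^ P.m

/-- The number of layers of the recursion. -/
def L : ℕ := P.n * P.K

/-- The encoded columns. -/
def α (j : ℕ) : ℤ := ∑ i ∈ range P.m, P.a i j * (P.W : ℤ) ^ i

/-- The sum of the absolute values of the objective coefficients. -/
def cSum : ℕ := ∑ j ∈ range P.n, (P.c j).natAbs

/-- An offset that makes the values of all points in the recursion positive. -/
def big : ℕ := 1 + P.L * P.cSum

/-- `G l z` is `0` if `z` is not the code of a combination of columns in which each multiplicity is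
bounded by the number of layers below `l` that belong to the column; otherwise it is `big` plus
the largest objective value of such a combination. Layer `l` belongs to column `l % n`. -/
def G : ℕ → ℤ → ℤ
  | 0, z => if z = 0 then P.big else 0
  | l + 1, z =>
    if 0 < G l (z - P.α (l % P.n)) then max (G l z) (G l (z - P.α (l % P.n)) + P.c (l % P.n))
    else G l z

/-- The sum of the powers of `W` with exponents below `m`. -/
def geo : ℕ := ∑ i ∈ range P.m, P.W ^ i

theorem one_le_K : 1 ≤ P.K :=
  Nat.one_le_pow _ _ (Nat.mul_pos P.one_le_n P.one_le_D)

theorem one_le_N : 1 ≤ P.N := Nat.one_le_pow _ _ (by unfold W; omega)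

/-- The geometric sum, since `W = 2 n D K + 1 = 2 D L + 1`. -/
theorem geo_mul : P.geo * (2 * P.D * P.L) + 1 = P.N := by
  have h := geom_sum_mul_add (2 * P.n * P.D * P.K) P.m
  unfold geo N L
  rw [← show P.W = 2 * P.n * P.D * P.K + 1 from rfl] at h
  rw [← h]
  ring

theorem abs_α_le (j : ℕ) : |P.α j| ≤ ((P.D * P.geo : ℕ) : ℤ) := by
  unfold α geo
  refine (abs_sum_le_sum_abs _ _).trans ?_
  push_cast
  rw [mul_sum]
  refine sum_le_sum fun i _ => ?_
  rw [abs_mul, abs_pow, Nat.abs_cast]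
  exact mul_le_mul_of_nonneg_right (P.abs_a_le i j) (by positivity)

theorem layers_mul_le : 2 * (P.L * (P.D * P.geo)) < P.N := by
  rw [← P.geo_mul]
  have : P.geo * (2 * P.D * P.L) = 2 * (P.L * (P.D * P.geo)) := by ring
  omega

theorem D_mul_geo_lt : P.D * P.geo < P.N := by
  have h := P.layers_mul_le
  have : 1 * (P.D * P.geo) ≤ P.L * (P.D * P.geo) :=
    Nat.mul_le_mul_right _ (Nat.mul_pos P.one_le_n P.one_le_K)
  omega

theorem abs_α_lt (j : ℕ) : |P.α j| < P.N :=
  (P.abs_α_le j).trans_lt (by exact_mod_cast P.D_mul_geo_lt)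

/-- The objective value of a point. -/
def obj (x : ℕ → ℤ) : ℤ := ∑ j ∈ range P.n, P.c j * x j

/-- The left-hand side of a constraint at a point. -/
def row (i : ℕ) (x : ℕ → ℤ) : ℤ := ∑ j ∈ range P.n, P.a i j * x j

/-- The code of the left-hand sides of the constraints. -/
def code (x : ℕ → ℤ) : ℤ := ∑ j ∈ range P.n, P.α j * x j

theorem code_eq (x : ℕ → ℤ) : P.code x = ∑ i ∈ range P.m, P.row i x * (P.W : ℤ) ^ i := by
  unfold code α row
  simp only [sum_mul]
  rw [sum_comm]
  exact sum_congr rfl fun i _ => sum_congr rfl fun j _ => by ring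

theorem row_add (i : ℕ) (x y : ℕ → ℤ) : P.row i (fun j => x j + y j) = P.row i x + P.row i y := by
  simp [row, mul_add, sum_add_distrib]

theorem obj_add (x y : ℕ → ℤ) : P.obj (fun j => x j + y j) = P.obj x + P.obj y := by
  simp [obj, mul_add, sum_add_distrib]

theorem abs_row_le (i : ℕ) {x : ℕ → ℤ} (hx : ∀ j < P.n, 0 ≤ x j) :
    |P.row i x| ≤ P.D * ∑ j ∈ range P.n, x j := by
  unfold row
  refine (abs_sum_le_sum_abs _ _).trans ?_
  rw [mul_sum]
  refine sum_le_sum fun j hj => ?_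
  have := hx j (mem_range.1 hj)
  rw [abs_mul, abs_of_nonneg this]
  exact mul_le_mul_of_nonneg_right (P.abs_a_le i j) this

theorem abs_obj_le {x : ℕ → ℤ} {B : ℤ} (hx : ∀ j < P.n, |x j| ≤ B) :
    |P.obj x| ≤ P.cSum * B := by
  unfold obj cSum
  refine (abs_sum_le_sum_abs _ _).trans ?_
  push_cast
  rw [sum_mul]
  refine sum_le_sum fun j hj => ?_
  rw [abs_mul]
  exact mul_le_mul_of_nonneg_left (hx j (mem_range.1 hj)) (abs_nonneg _)

/-- On points of bounded size, the code determines the left-hand sides of the constraints. -/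
theorem row_eq_of_code_eq {x y : ℕ → ℤ} (hx : ∀ j < P.n, 0 ≤ x j) (hy : ∀ j < P.n, 0 ≤ y j)
    (hxs : ∑ j ∈ range P.n, x j ≤ P.L) (hys : ∑ j ∈ range P.n, y j ≤ P.L)
    (h : P.code x = P.code y) : ∀ i < P.m, P.row i x = P.row i y := by
  have h1 : ∀ i < P.m, P.row i x - P.row i y = 0 := by
    refine eq_zero_of_sum_mul_pow_eq_zero (W := P.W) (by unfold W; positivity) P.m _ ?_ ?_
    · intro i _
      have e1 := (P.abs_row_le i hx).trans
        (mul_le_mul_of_nonneg_left hxs (by positivity : (0 : ℤ) ≤ P.D))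
      have e2 := (P.abs_row_le i hy).trans
        (mul_le_mul_of_nonneg_left hys (by positivity : (0 : ℤ) ≤ P.D))
      refine (abs_sub _ _).trans_lt ((add_le_add e1 e2).trans_lt ?_)
      unfold W L
      push_cast
      linarith
    · rw [code_eq, code_eq] at h
      simp [sub_mul, sum_sub_distrib, h]
  intro i hi
  have := h1 i hi
  omega

theorem G_nonneg : ∀ l z, 0 ≤ P.G l z
  | 0, z => by unfold G; split_ifs <;> simp
  | l + 1, z => by
    unfold G
    split_ifs
    · exact (G_nonneg l z).trans (le_max_left _ _)
    · exact G_nonneg l z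

theorem G_le_succ (l : ℕ) (z : ℤ) : P.G l z ≤ P.G (l + 1) z := by
  rw [G]
  split_ifs
  · exact le_max_left _ _
  · exact le_rfl

theorem G_succ_of_lt {l : ℕ} {z : ℤ} (h : P.G l z < P.G (l + 1) z) :
    0 < P.G l (z - P.α (l % P.n)) ∧
      P.G (l + 1) z = P.G l (z - P.α (l % P.n)) + P.c (l % P.n) := by
  rw [G] at h ⊢
  split_ifs at h ⊢ with h1
  · refine ⟨h1, ?_⟩
    rw [max_def] at h ⊢
    split_ifs at h ⊢ <;> omega
  · omega

theorem abs_c_le {j : ℕ} (hj : j < P.n) : |P.c j| ≤ P.cSum := by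
  rw [← Int.natCast_natAbs]
  exact_mod_cast single_le_sum (f := fun j => (P.c j).natAbs) (fun _ _ => Nat.zero_le _)
    (mem_range.2 hj)

theorem mod_lt (l : ℕ) : l % P.n < P.n := Nat.mod_lt _ P.one_le_n

theorem G_le : ∀ l z, P.G l z ≤ P.big + l * P.cSum
  | 0, z => by unfold G; split_ifs <;> simp
  | l + 1, z => by
    have h1 := G_le l z
    have h2 := G_le l (z - P.α (l % P.n))
    have h3 := (le_abs_self _).trans (P.abs_c_le (P.mod_lt l))
    unfold G
    push_cast
    rw [add_mul]
    have : (0 : ℤ) ≤ P.cSum := by positivity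
    split_ifs
    · refine max_le (by linarith) (by linarith)
    · linarith

theorem abs_le_of_G_pos : ∀ (l : ℕ) (z : ℤ), 0 < P.G l z → |z| ≤ l * ((P.D * P.geo : ℕ) : ℤ)
  | 0, z, h => by
    unfold G at h
    split_ifs at h with hz
    · simp [hz]
    · exact absurd h (lt_irrefl _)
  | l + 1, z, h => by
    have hnn : (0 : ℤ) ≤ ((P.D * P.geo : ℕ) : ℤ) := by positivity
    rcases (P.G_le_succ l z).eq_or_lt with h1 | h1
    · refine (abs_le_of_G_pos l z (h1 ▸ h)).trans ?_
      gcongr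
      simp
    · have h2 := abs_le_of_G_pos l _ (P.G_succ_of_lt h1).1
      have h3 := P.abs_α_le (l % P.n)
      have h4 : |z| ≤ |z - P.α (l % P.n)| + |P.α (l % P.n)| := by
        simpa using abs_add_le (z - P.α (l % P.n)) (P.α (l % P.n))
      push_cast at h2 h3 hnn ⊢
      linarith [add_mul (l : ℤ) 1 ((P.D : ℤ) * P.geo)]

/-- Only codes strictly between `-N` and `N` occur in the recursion. -/
theorem abs_lt_of_G_pos {l : ℕ} (hl : l ≤ P.L) {z : ℤ} (h : 0 < P.G l z) : |z| < P.N := by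
  refine (P.abs_le_of_G_pos l z h).trans_lt ?_
  have h1 := P.layers_mul_le
  have h2 : l * (P.D * P.geo) ≤ P.L * (P.D * P.geo) := Nat.mul_le_mul_right _ hl
  exact_mod_cast (by omega : l * (P.D * P.geo) < P.N)

/-- Adding `t` to the coordinate `j`. -/
theorem sum_mul_update (f x : ℕ → ℤ) {j : ℕ} (hj : j < P.n) (t : ℤ) :
    ∑ i ∈ range P.n, f i * Function.update x j (x j + t) i =
      ∑ i ∈ range P.n, f i * x i + f j * t := by
  have h : ∀ i ∈ range P.n, f i * Function.update x j (x j + t) i =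
      f i * x i + if i = j then f j * t else 0 := by
    intro i _
    by_cases h : i = j
    · subst h; simp; ring
    · simp [h]
  rw [sum_congr rfl h, sum_add_distrib, sum_ite_eq' (range P.n) j, if_pos (mem_range.2 hj)]

theorem sum_update (x : ℕ → ℤ) {j : ℕ} (hj : j < P.n) (t : ℤ) :
    ∑ i ∈ range P.n, Function.update x j (x j + t) i = ∑ i ∈ range P.n, x i + t := by
  simpa using P.sum_mul_update (fun _ => 1) x hj t

theorem obj_pos_of_le {x : ℕ → ℤ} (hx : ∀ j < P.n, |x j| ≤ P.L) : 0 < P.big + P.obj x := by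
  have := (abs_le.1 (P.abs_obj_le hx)).1
  unfold big
  push_cast
  linarith [mul_comm (P.cSum : ℤ) P.L]

/-- The recursion takes every point into account whose coordinates are at most the numbers of
layers that belong to them. -/
theorem le_G (l : ℕ) (hl : l ≤ P.L) : ∀ (x : ℕ → ℤ),
    (∀ j < P.n, 0 ≤ x j ∧ x j ≤ Nat.count (fun i => i % P.n = j) l) →
    P.big + P.obj x ≤ P.G l (P.code x) := by
  induction l with
  | zero =>
    intro x hx
    have h0 : ∀ j < P.n, x j = 0 := fun j hj => by have := hx j hj; simp at this; omega
    have h1 : P.code x = 0 := sum_eq_zero fun j hj => by simp [h0 j (mem_range.1 hj)]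
    have h2 : P.obj x = 0 := sum_eq_zero fun j hj => by simp [h0 j (mem_range.1 hj)]
    simp [h1, h2, G]
  | succ l ih =>
    intro x hx
    set j := l % P.n with hj
    by_cases hxj : x j ≤ Nat.count (fun i => i % P.n = j) l
    · refine (ih (by omega) x fun j' hj' => ⟨(hx j' hj').1, ?_⟩).trans (P.G_le_succ l _)
      by_cases h : j' = j
      · rw [h]; exact hxj
      · have := (hx j' hj').2
        rw [Nat.count_succ, if_neg (fun e => h (by rw [hj]; exact e.symm))] at this
        simpa using this
    · set x' := Function.update x j (x j + -1) with hx'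
      have hb : ∀ j' < P.n, 0 ≤ x' j' ∧ x' j' ≤ Nat.count (fun i => i % P.n = j') l := by
        intro j' hj'
        by_cases h : j' = j
        · subst h
          have h2 := (hx _ hj').2
          rw [Nat.count_succ, if_pos rfl] at h2
          rw [hx', Function.update_self]
          push_cast at h2
          omega
        · have := hx j' hj'
          rw [Nat.count_succ, if_neg (fun e => h (by rw [hj]; exact e.symm))] at this
          rw [hx', Function.update_of_ne h]
          simpa using this
      have h1 := ih (by omega) x' hb
      have hpos : 0 < P.big + P.obj x' := P.obj_pos_of_le fun j' hj' => by
        have h2 := hb j' hj'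
        rw [abs_of_nonneg h2.1]
        refine h2.2.trans ?_
        exact_mod_cast (Nat.count_le (p := fun i => i % P.n = j') (n := l)).trans
          (by omega : l ≤ P.L)
      have hcode : P.code x' = P.code x - P.α j := by
        have := P.sum_mul_update P.α x (P.mod_lt l) (-1)
        rw [code, this, code]; ring
      have hobj : P.obj x' = P.obj x - P.c j := by
        have := P.sum_mul_update P.c x (P.mod_lt l) (-1)
        rw [obj, this, obj]; ring
      rw [hcode] at h1
      rw [G, if_pos (by rw [← hj]; linarith)]
      refine le_trans ?_ (le_max_right _ _)
      rw [← hj]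
      linarith

theorem K_le_count {j : ℕ} (hj : j < P.n) : P.K ≤ Nat.count (fun i => i % P.n = j) P.L := by
  unfold L
  generalize P.K = K
  induction K with
  | zero => simp
  | succ K ih =>
    rw [Nat.mul_succ, Nat.count_add]
    have : 0 < Nat.count (fun k => (P.n * K + k) % P.n = j) P.n := by
      rw [Nat.pos_iff_ne_zero]
      intro h
      have hlt : j < Nat.count (fun k => (P.n * K + k) % P.n = j) P.n + j + 1 := by omega
      have h2 : Nat.count (fun k => (P.n * K + k) % P.n = j) j <
          Nat.count (fun k => (P.n * K + k) % P.n = j) P.n :=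
        Nat.count_strict_mono (by simp [Nat.mod_eq_of_lt hj]) hj
      omega
    omega

/-- The state of the reconstruction of a point from its code `z`, when the layers from `l` on have
been dealt with: `x` is the partial point and `y` the code of the remainder. -/
structure Trace (z : ℤ) (l : ℕ) (x : ℕ → ℤ) (y : ℤ) : Prop where
  nonneg : ∀ j < P.n, 0 ≤ x j
  sum_le : ∑ j ∈ range P.n, x j + l ≤ P.L
  code_eq : P.code x = z - y
  pos : 0 < P.G P.L z → 0 < P.G l y ∧ P.G P.L z = P.G l y + P.obj x

theorem Trace.init (z : ℤ) {x : ℕ → ℤ} (hx : ∀ j < P.n, x j = 0) : P.Trace z P.L x z := by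
  have h : ∀ f : ℕ → ℤ, ∑ j ∈ range P.n, f j * x j = 0 := fun f =>
    sum_eq_zero fun j hj => by rw [hx j (mem_range.1 hj), mul_zero]
  refine ⟨fun j hj => (hx j hj).ge, ?_, ?_, fun h' => ⟨h', ?_⟩⟩
  · have := h (fun _ => 1)
    simp only [one_mul] at this
    rw [this, zero_add]
  · rw [code, h, sub_self]
  · rw [obj, h, add_zero]

variable {P}

/-- If the layer `l` does not increase the entry, then it is not used. -/
theorem Trace.stay {z : ℤ} {l : ℕ} {x : ℕ → ℤ} {y : ℤ} (h : P.Trace z (l + 1) x y)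
    (hG : ¬ P.G l y < P.G (l + 1) y) : P.Trace z l x y := by
  have hG' : P.G (l + 1) y = P.G l y := le_antisymm (not_lt.1 hG) (P.G_le_succ l y)
  refine ⟨h.nonneg, ?_, h.code_eq, fun hp => ?_⟩
  · have := h.sum_le
    push_cast at this
    linarith
  · have := h.pos hp
    rwa [hG'] at this

/-- If the layer `l` increases the entry, then its column is used once more. -/
theorem Trace.take {z : ℤ} {l : ℕ} {x : ℕ → ℤ} {y : ℤ} (h : P.Trace z (l + 1) x y)
    (hG : P.G l y < P.G (l + 1) y) :
    P.Trace z l (Function.update x (l % P.n) (x (l % P.n) + 1)) (y - P.α (l % P.n)) := by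
  obtain ⟨h1, h2⟩ := P.G_succ_of_lt hG
  refine ⟨fun j hj => ?_, ?_, ?_, fun hp => ⟨h1, ?_⟩⟩
  · by_cases hj' : j = l % P.n
    · subst hj'
      rw [Function.update_self]
      have := h.nonneg _ hj
      omega
    · rw [Function.update_of_ne hj']
      exact h.nonneg j hj
  · rw [P.sum_update x (P.mod_lt l)]
    have := h.sum_le
    push_cast at this
    linarith
  · rw [code, P.sum_mul_update P.α x (P.mod_lt l), ← code, h.code_eq]
    ring
  · rw [obj, P.sum_mul_update P.c x (P.mod_lt l), ← obj, (h.pos hp).2, h2]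
    ring

theorem Trace.le_L {z : ℤ} {l : ℕ} {x : ℕ → ℤ} {y : ℤ} (h : P.Trace z l x y) {j : ℕ}
    (hj : j < P.n) : x j ≤ P.L := by
  have h1 := h.sum_le
  have h2 := single_le_sum (f := x) (fun i hi => h.nonneg i (mem_range.1 hi)) (mem_range.2 hj)
  linarith [(by positivity : (0 : ℤ) ≤ l)]

/-- The code of the remainder stays within the range of the table. -/
theorem Trace.abs_le {z : ℤ} {l : ℕ} {x : ℕ → ℤ} {y : ℤ} (h : P.Trace z l x y) :
    |y| ≤ |z| + P.N := by
  have h1 : |P.code x| ≤ ((P.D * P.geo : ℕ) : ℤ) * P.L := by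
    unfold code
    refine (abs_sum_le_sum_abs _ _).trans ?_
    have h2 : ∑ j ∈ range P.n, |P.α j * x j| ≤
        ∑ j ∈ range P.n, ((P.D * P.geo : ℕ) : ℤ) * x j := by
      refine sum_le_sum fun j hj => ?_
      have := h.nonneg j (mem_range.1 hj)
      rw [abs_mul, abs_of_nonneg this]
      exact mul_le_mul_of_nonneg_right (P.abs_α_le j) this
    refine h2.trans ?_
    rw [← mul_sum]
    refine mul_le_mul_of_nonneg_left ?_ (by positivity)
    linarith [h.sum_le, (by positivity : (0 : ℤ) ≤ l)]
  have h2 : ((P.D * P.geo : ℕ) : ℤ) * P.L ≤ P.N := by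
    have := P.layers_mul_le
    exact_mod_cast (by rw [mul_comm] at this; nlinarith : P.D * P.geo * P.L ≤ P.N)
  have h3 : y = z - P.code x := by rw [h.code_eq]; ring
  rw [h3]
  exact (abs_sub _ _).trans (by linarith)

theorem Trace.final {z : ℤ} {x : ℕ → ℤ} {y : ℤ} (h : P.Trace z 0 x y) (hp : 0 < P.G P.L z) :
    P.code x = z ∧ P.G P.L z = P.big + P.obj x := by
  obtain ⟨h1, h2⟩ := h.pos hp
  unfold G at h1
  split_ifs at h1 with hy
  · refine ⟨by rw [h.code_eq, hy, sub_zero], ?_⟩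
    rw [h2, G, if_pos hy]
  · exact absurd h1 (lt_irrefl _)

/-- Every positive entry of the last layer is the value of a small point. -/
theorem exists_trace (z : ℤ) : ∀ l ≤ P.L, ∃ x y, P.Trace z (P.L - l) x y
  | 0, _ => ⟨fun _ => 0, z, Trace.init P z fun _ _ => rfl⟩
  | l + 1, hl => by
    obtain ⟨x, y, h⟩ := exists_trace z l (by omega)
    rw [show P.L - l = (P.L - (l + 1)) + 1 by omega] at h
    by_cases hG : P.G (P.L - (l + 1)) y < P.G (P.L - (l + 1) + 1) y
    · exact ⟨_, _, h.take hG⟩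
    · exact ⟨_, _, h.stay hG⟩

theorem sum_le_L {x : ℕ → ℤ} (hx : ∀ j < P.n, x j ≤ P.K) : ∑ j ∈ range P.n, x j ≤ P.L := by
  refine (sum_le_card_nsmul _ _ (P.K : ℤ) fun j hj => hx j (mem_range.1 hj)).trans ?_
  simp [L]

/-- Each column owns `K` layers, so the last layer takes all points of the box `[0, K]ⁿ` into
account. -/
theorem le_G_of_le_K {x : ℕ → ℤ} (hx : ∀ j < P.n, 0 ≤ x j ∧ x j ≤ P.K) :
    P.big + P.obj x ≤ P.G P.L (P.code x) ∧ 0 < P.G P.L (P.code x) := by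
  have h := P.le_G P.L le_rfl x fun j hj => ⟨(hx j hj).1, (hx j hj).2.trans
    (by exact_mod_cast P.K_le_count hj)⟩
  refine ⟨h, (P.obj_pos_of_le fun j hj => ?_).trans_le h⟩
  rw [abs_of_nonneg (hx j hj).1]
  refine (hx j hj).2.trans ?_
  exact_mod_cast (Nat.le_mul_of_pos_left _ P.one_le_n : P.K ≤ P.n * P.K)

/-- The point reconstructed from the code of a point `x'` of the box `[0, K]ⁿ` has the same
left-hand sides, and its objective value is not smaller. -/
theorem Trace.dominates {x' x : ℕ → ℤ} {y : ℤ} (hx' : ∀ j < P.n, 0 ≤ x' j ∧ x' j ≤ P.K)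
    (h : P.Trace (P.code x') 0 x y) :
    (∀ i < P.m, P.row i x = P.row i x') ∧ P.obj x' ≤ P.obj x := by
  obtain ⟨h1, h2⟩ := le_G_of_le_K hx'
  obtain ⟨h3, h4⟩ := h.final h2
  refine ⟨P.row_eq_of_code_eq h.nonneg (fun j hj => (hx' j hj).1) ?_
    (sum_le_L fun j hj => (hx' j hj).2) h3, by omega⟩
  simpa using h.sum_le

/-- The objective improves along a small nonnegative kernel vector if and only if the entry of `0`
in the last layer exceeds the offset. -/
theorem exists_of_big_lt (h : P.big < P.G P.L 0) :
    ∃ y : ℕ → ℤ, (∀ j < P.n, 0 ≤ y j) ∧ (∀ i < P.m, P.row i y = 0) ∧ 0 < P.obj y := by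
  obtain ⟨x, y, hT⟩ := exists_trace (P := P) 0 P.L le_rfl
  rw [Nat.sub_self] at hT
  obtain ⟨h1, h2⟩ := hT.final ((by positivity : (0 : ℤ) ≤ P.big).trans_lt h)
  refine ⟨x, hT.nonneg, fun i hi => ?_, by omega⟩
  have h3 := P.row_eq_of_code_eq (y := fun _ => 0) hT.nonneg (fun _ _ => le_rfl)
    (by simpa using hT.sum_le) (by simp) (by rw [h1]; simp [code]) i hi
  simpa [row] using h3

theorem obj_nonpos_of_le (h : ¬ P.big < P.G P.L 0) {y : ℕ → ℤ}
    (hy : ∀ j < P.n, 0 ≤ y j ∧ y j ≤ P.K) (hrow : ∀ i < P.m, P.row i y = 0) : P.obj y ≤ 0 := by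
  have h1 := (le_G_of_le_K hy).1
  rw [P.code_eq, sum_eq_zero fun i hi => by rw [hrow i (mem_range.1 hi), zero_mul]] at h1
  omega

end Data

/-! ### Solving for the large coordinates -/

namespace Data
open Finset
variable (P : Data)

/-- The `l`-th entry of the tuple of column indices with code `s`. -/
def σ (s l : ℕ) : ℕ := s / P.n ^ l % P.n

/-- The base of the encoding of functionals with entries of absolute value at most `K`. -/
def B : ℕ := 2 * P.K + 1

/-- The functional with code `e`: its entries are the digits of `e` in base `B`, shifted by `-K`. -/
def u (e i : ℕ) : ℤ := ((e / P.B ^ i % P.B : ℕ) : ℤ) - P.K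

/-- The value of the functional with code `e` at the column `j`. -/
def dot (e j : ℕ) : ℤ := ∑ i ∈ range P.m, P.u e i * P.a i j

/-- The functional with code `e` is positive at the `k`-th column of the tuple with code `s`, and
vanishes at its other columns. -/
def Sep (s k e : ℕ) : Prop :=
  0 < P.dot e (P.σ s k) ∧ ∀ l < P.m, P.σ s l ≠ P.σ s k → P.dot e (P.σ s l) = 0

/-- The number of codes of functionals. -/
def E : ℕ := P.B ^ P.m

/-- The number of codes of tuples. -/
def T : ℕ := P.n ^ P.m

/-- The point `x` is supported on the columns of the tuple with code `s`, and its coordinates can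
be computed from the left-hand sides by separating functionals. -/
def Solvable (s : ℕ) (x : ℕ → ℤ) : Prop :=
  (∀ j < P.n, x j = 0) ∨
    ((∀ j < P.n, x j ≠ 0 → ∃ l < P.m, P.σ s l = j) ∧ ∀ k < P.m, ∃ e < P.E, P.Sep s k e)

theorem σ_lt (s l : ℕ) : P.σ s l < P.n := Nat.mod_lt _ P.one_le_n

theorem one_le_E : 1 ≤ P.E := Nat.one_le_pow _ _ (by unfold B; omega)

theorem abs_u_le (e i : ℕ) : |P.u e i| ≤ P.K := by
  unfold u
  have : e / P.B ^ i % P.B < P.B := Nat.mod_lt _ (by unfold B; omega)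
  have h : P.B = 2 * P.K + 1 := rfl
  rw [abs_le]
  omega

theorem exists_code (n : ℕ) {m : ℕ} (d : Fin m → Fin n) :
    ∃ e < n ^ m, ∀ i : Fin m, e / n ^ (i : ℕ) % n = d i := by
  refine ⟨finFunctionFinEquiv d, (finFunctionFinEquiv d).2, fun i => ?_⟩
  rw [← finFunctionFinEquiv_symm_apply_val, Equiv.symm_apply_apply]

theorem exists_code_functional (v : ℕ → ℤ) (hv : ∀ i < P.m, |v i| ≤ P.K) :
    ∃ e < P.E, ∀ i < P.m, P.u e i = v i := by
  obtain ⟨e, he, h⟩ := exists_code P.B (m := P.m) fun i => ⟨(v i + P.K).toNat, by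
    have := abs_le.1 (hv i i.2)
    unfold B
    omega⟩
  refine ⟨e, he, fun i hi => ?_⟩
  have := abs_le.1 (hv i hi)
  have h1 := h ⟨i, hi⟩
  simp only at h1
  rw [u, h1]
  omega

theorem exists_code_tuple (t : Fin P.m → Fin P.n) : ∃ s < P.T, ∀ l : Fin P.m, P.σ s l = t l :=
  exists_code P.n t

variable {P}

theorem sum_u_mul_row (e : ℕ) (x : ℕ → ℤ) :
    ∑ i ∈ range P.m, P.u e i * P.row i x = ∑ j ∈ range P.n, P.dot e j * x j := by
  simp only [row, dot, mul_sum, sum_mul]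
  rw [sum_comm]
  exact sum_congr rfl fun _ _ => sum_congr rfl fun _ _ => by ring

/-- The quotient computes the coordinate of a solvable point. If the point vanishes, this holds
for all functionals, because `0 / 0 = 0`. -/
theorem Solvable.div_eq {s : ℕ} {x : ℕ → ℤ} (h : P.Solvable s x) {k e : ℕ} (hk : k < P.m)
    (he : (∃ e < P.E, P.Sep s k e) → P.Sep s k e) {r : ℕ → ℤ} (hr : ∀ i < P.m, r i = P.row i x) :
    (∑ i ∈ range P.m, P.u e i * r i) / P.dot e (P.σ s k) = x (P.σ s k) := by
  have h1 : ∑ i ∈ range P.m, P.u e i * r i = ∑ j ∈ range P.n, P.dot e j * x j := by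
    rw [← sum_u_mul_row]
    exact sum_congr rfl fun i hi => by rw [hr i (mem_range.1 hi)]
  rw [h1]
  rcases h with h | ⟨h, hs⟩
  · rw [sum_eq_zero fun j hj => by rw [h j (mem_range.1 hj), mul_zero], h _ (P.σ_lt s k)]
    simp
  · have hsep := he (hs k hk)
    rw [sum_eq_single (P.σ s k)]
    · exact Int.mul_ediv_cancel_left _ hsep.1.ne'
    · intro j hj hne
      by_cases hx : x j = 0
      · rw [hx, mul_zero]
      · obtain ⟨l, hl, rfl⟩ := h j (mem_range.1 hj) hx
        rw [hsep.2 l hl hne, zero_mul]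
    · exact fun hn => absurd (mem_range.2 (P.σ_lt s k)) hn

theorem Solvable.eq_zero_of_forall_ne {s : ℕ} {x : ℕ → ℤ} (h : P.Solvable s x) {j : ℕ}
    (hj : j < P.n) (hne : ∀ l < P.m, P.σ s l ≠ j) : x j = 0 := by
  rcases h with h | ⟨h, -⟩
  · exact h j hj
  · by_contra hx
    obtain ⟨l, hl, h'⟩ := h j hj hx
    exact hne l hl h'

variable (P) in
/-- The constraints are satisfied by `x`. -/
def Feasible (x : ℕ → ℤ) : Prop := (∀ j < P.n, 0 ≤ x j) ∧ ∀ i < P.m, P.row i x = P.b i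

variable (P) in
/-- The points `x'` and `x''` form a decomposition of a feasible point that the search finds from
the tuple with code `s` and the code of `x'`. -/
structure Decomp (s : ℕ) (x' x'' : ℕ → ℤ) : Prop where
  box : ∀ j < P.n, 0 ≤ x' j ∧ x' j ≤ P.K
  nonneg : ∀ j < P.n, 0 ≤ x'' j
  row_eq : ∀ i < P.m, P.row i (fun j => x' j + x'' j) = P.b i
  solvable : P.Solvable s x''

/-- If the objective `c` does not improve along small nonnegative kernel vectors, then each
feasible point is dominated by a point with a decomposition. -/
theorem exists_decomp (c : ℕ → ℤ)
    (hc : ∀ y : ℕ → ℤ, (∀ j < P.n, 0 ≤ y j ∧ y j ≤ P.K) → (∀ i < P.m, P.row i y = 0) →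
      ∑ j ∈ range P.n, c j * y j ≤ 0)
    {x : ℕ → ℤ} (hx : P.Feasible x) :
    ∃ s < P.T, ∃ x' x'', P.Decomp s x' x'' ∧
      ∑ j ∈ range P.n, c j * x j ≤ ∑ j ∈ range P.n, c j * (x' j + x'' j) := by
  classical
  let A : Matrix (Fin P.m) (Fin P.n) ℤ := Matrix.of fun i j => P.a i j
  let ext : (Fin P.n → ℤ) → ℕ → ℤ := fun v j => if h : j < P.n then v ⟨j, h⟩ else 0
  have hext : ∀ v (j : Fin P.n), ext v j = v j := fun v j => by simp [ext]
  have hlt : ∀ v j (hj : j < P.n), ext v j = v ⟨j, hj⟩ := fun v j hj => by simp [ext, hj]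
  have hrow : ∀ (v : Fin P.n → ℤ) (i : Fin P.m), A.mulVec v i = P.row i (ext v) := fun v i => by
    simp only [Matrix.mulVec, dotProduct, row, A, Matrix.of_apply]
    rw [sum_range]
    exact sum_congr rfl fun j _ => by rw [hext]
  have hobj : ∀ v : Fin P.n → ℤ, dotProduct (fun j : Fin P.n => c j) v =
      ∑ j ∈ range P.n, c j * ext v j := fun v => by
    rw [sum_range]
    exact sum_congr rfl fun j _ => by rw [hext]
  have hK : ((P.n * P.D : ℕ) : ℤ) ^ P.m = (P.K : ℤ) := by unfold K; push_cast; rfl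
  have hD : ∀ i j, |A i j| ≤ (P.D : ℤ) := fun i j => P.abs_a_le i j
  have hx0 : ∀ f : ℕ → ℤ, ∑ j ∈ range P.n, f j * ext (fun j => x j) j =
      ∑ j ∈ range P.n, f j * x j := fun f => sum_congr rfl fun j hj =>
    congrArg (f j * ·) (hlt (fun j => x j) j (mem_range.1 hj))
  obtain ⟨x', x'', S, h1, h2, hS, h4, h5, h6⟩ :=
    exists_decomposition hD P.one_le_n P.one_le_D (fun j => c j)
      (fun y hy hAy => by
        rw [hobj]
        rw [hK] at hy
        refine hc _ (fun j hj => ?_) fun i hi => ?_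
        · rw [hlt y j hj]
          exact hy ⟨j, hj⟩
        · rw [← hrow y ⟨i, hi⟩, hAy]; rfl)
      (fun j => x j) (fun j => hx.1 j j.2)
  have hadd : ∀ f : ℕ → ℤ, ∑ j ∈ range P.n, f j * ext (x' + x'') j =
      ∑ j ∈ range P.n, f j * (ext x' j + ext x'' j) := fun f => sum_congr rfl fun j hj => by
    simp only [hlt _ j (mem_range.1 hj), Pi.add_apply]
  have hobj' : ∑ j ∈ range P.n, c j * x j ≤
      ∑ j ∈ range P.n, c j * (ext x' j + ext x'' j) := by
    rwa [hobj, hobj, hx0, hadd] at h6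
  have hrow' : ∀ i < P.m, P.row i (fun j => ext x' j + ext x'' j) = P.b i := fun i hi => by
    have := congrFun h5 ⟨i, hi⟩
    rw [hrow, hrow, row, row, hx0, hadd] at this
    rw [← hx.2 i hi]
    exact this
  have hbox : ∀ j < P.n, 0 ≤ ext x' j ∧ ext x' j ≤ P.K := fun j hj => by
    rw [hlt x' j hj, ← hK]
    exact h1 ⟨j, hj⟩
  have hnn : ∀ j < P.n, 0 ≤ ext x'' j := fun j hj => by
    rw [hlt x'' j hj]
    exact h2 ⟨j, hj⟩
  -- The independent set is enumerated by a tuple, possibly with repetitions, unless it is empty.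
  rcases S.eq_empty_or_nonempty with rfl | hne
  · refine ⟨0, Nat.pow_pos P.one_le_n, ext x', ext x'', ⟨hbox, hnn, hrow', Or.inl ?_⟩, hobj'⟩
    intro j hj
    rw [hlt x'' j hj, h4 _ (by simp)]
  · obtain ⟨t, htS, hSt⟩ : ∃ t : Fin P.m → Fin P.n, (∀ l, t l ∈ S) ∧ ∀ j ∈ S, ∃ l, t l = j := by
      obtain ⟨j₀, hj₀⟩ := hne
      have hcard : Fintype.card S ≤ Fintype.card (Fin P.m) := by
        simpa using hS.card_le
      obtain ⟨f⟩ := Function.Embedding.nonempty_of_card_le hcard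
      have : Nonempty S := ⟨⟨j₀, hj₀⟩⟩
      refine ⟨fun l => (Function.invFun f l : S), fun l => (Function.invFun f l : S).2, ?_⟩
      exact fun j hj => ⟨f ⟨j, hj⟩,
        congrArg Subtype.val (Function.leftInverse_invFun f.injective ⟨j, hj⟩)⟩
    obtain ⟨s, hs, hst⟩ := P.exists_code_tuple t
    refine ⟨s, hs, ext x', ext x'', ⟨hbox, hnn, hrow', Or.inr ⟨fun j hj hxj => ?_,
      fun k hk => ?_⟩⟩, hobj'⟩
    · have hjS : (⟨j, hj⟩ : Fin P.n) ∈ S := by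
        by_contra h
        exact hxj (by rw [hlt x'' j hj, h4 _ h])
      obtain ⟨l, hl⟩ := hSt _ hjS
      exact ⟨l, l.2, by rw [hst l, hl]⟩
    · obtain ⟨v, hv0, hv1, hvK⟩ := hS.exists_functional hD P.one_le_n P.one_le_D
        (htS ⟨k, hk⟩)
      rw [hK] at hvK
      obtain ⟨e, he, heu⟩ := P.exists_code_functional
        (fun i => if h : i < P.m then v ⟨i, h⟩ else 0) (fun i hi => by
          simpa [hi] using hvK ⟨i, hi⟩)
      have hdot : ∀ j : Fin P.n, P.dot e j = ∑ i, v i * A i j := fun j => by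
        rw [dot, sum_range]
        refine sum_congr rfl fun i _ => ?_
        rw [heu i i.2]
        simp [A]
      refine ⟨e, he, ?_, fun l hl hne => ?_⟩
      · rw [hst ⟨k, hk⟩, hdot]; exact hv1
      · rw [hst ⟨l, hl⟩, hst ⟨k, hk⟩] at hne
        rw [hst ⟨l, hl⟩, hdot]
        exact hv0 _ (htS _) (fun h => hne (by rw [h]))

end Data

open RAM

/-! ### The size of the integers -/

namespace Data
open Finset
variable (P : Data)

/-- A bound for the parameters of the algorithm. -/
def H : ℕ := P.m + P.n + P.D + P.K + P.W + P.N + P.L + P.big + P.E + P.T +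
  (∑ i ∈ range P.m, (P.b i).natAbs) + P.cSum + P.B + 2

/-- A bound for all integers that are stored in registers or memory cells: all of them
are polynomials of degree at most `10` in the parameters. -/
def M : ℕ := P.H ^ 10

/-- The integer `x` is at most the `k`-th power of the bound for the parameters. -/
def Size (k : ℕ) (x : ℤ) : Prop := |x| ≤ (P.H : ℤ) ^ k

theorem two_le_H : 2 ≤ P.H := by unfold H; omega

variable {P}

theorem Size.mono {k l : ℕ} {x : ℤ} (h : P.Size k x) (hkl : k ≤ l) : P.Size l x :=
  le_trans h (pow_le_pow_right₀ (by have := P.two_le_H; omega) hkl)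

theorem Size.mul {k l : ℕ} {x y : ℤ} (hx : P.Size k x) (hy : P.Size l y) :
    P.Size (k + l) (x * y) := by
  unfold Size at *
  rw [abs_mul, pow_add]
  gcongr

theorem add_pow_le {k : ℕ} : (P.H : ℤ) ^ k + (P.H : ℤ) ^ k ≤ (P.H : ℤ) ^ (k + 1) := by
  have h : (2 : ℤ) ≤ P.H := by exact_mod_cast P.two_le_H
  rw [pow_succ]
  nlinarith [pow_nonneg (by omega : (0 : ℤ) ≤ P.H) k]

theorem Size.add {k : ℕ} {x y : ℤ} (hx : P.Size k x) (hy : P.Size k y) :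
    P.Size (k + 1) (x + y) :=
  (abs_add_le x y).trans ((add_le_add hx hy).trans add_pow_le)

theorem Size.sub {k : ℕ} {x y : ℤ} (hx : P.Size k x) (hy : P.Size k y) :
    P.Size (k + 1) (x - y) :=
  (abs_sub x y).trans ((add_le_add hx hy).trans add_pow_le)

theorem Size.div {k : ℕ} {x : ℤ} (hx : P.Size k x) (y : ℤ) : P.Size k (x / y) :=
  (abs_ediv_le_abs x y).trans hx

theorem Size.abs_le_M {k : ℕ} {x : ℤ} (hx : P.Size k x) (hk : k ≤ 10 := by norm_num) :
    |x| ≤ (P.M : ℤ) := by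
  have := hx.mono hk
  unfold Size at this
  unfold M
  push_cast
  exact this

theorem size_natCast {x k : ℕ} (h : x ≤ P.H ^ k) : P.Size k x := by
  unfold Size
  rw [Nat.abs_cast]
  exact_mod_cast h

theorem size_of_le_H {x : ℕ} (h : x ≤ P.H) : P.Size 1 x := size_natCast (by simpa using h)

theorem size_of_abs_le {k : ℕ} {x y : ℤ} (h : |x| ≤ y) (hy : P.Size k y) : P.Size k x :=
  h.trans ((le_abs_self y).trans hy)

theorem Size.sum {k N : ℕ} {v : ℕ → ℤ} (hN : N ≤ P.H) (hv : ∀ i < N, P.Size k (v i)) :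
    P.Size (k + 1) (∑ i ∈ range N, v i) := by
  unfold Size
  refine (abs_sum_le_sum_abs _ _).trans
    ((sum_le_card_nsmul _ _ ((P.H : ℤ) ^ k) fun i hi => hv i (mem_range.1 hi)).trans ?_)
  rw [card_range, nsmul_eq_mul, pow_succ, mul_comm]
  gcongr

theorem le_M_of_le_H {x : ℕ} (h : x ≤ P.H) : (x : ℤ) ≤ P.M :=
  (le_abs_self _).trans (size_of_le_H h).abs_le_M

theorem size_one : P.Size 0 1 := by simp [Size]
theorem size_zero : P.Size 0 0 := by simp [Size]

theorem m_le_H : P.m ≤ P.H := by unfold H; omega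
theorem n_le_H : P.n ≤ P.H := by unfold H; omega
theorem D_le_H : P.D ≤ P.H := by unfold H; omega
theorem K_le_H : P.K ≤ P.H := by unfold H; omega
theorem W_le_H : P.W ≤ P.H := by unfold H; omega
theorem N_le_H : P.N ≤ P.H := by unfold H; omega
theorem L_le_H : P.L ≤ P.H := by unfold H; omega
theorem big_le_H : P.big ≤ P.H := by unfold H; omega
theorem E_le_H : P.E ≤ P.H := by unfold H; omega
theorem T_le_H : P.T ≤ P.H := by unfold H; omega
theorem B_le_H : P.B ≤ P.H := by unfold H; omega
theorem cSum_le_H : P.cSum ≤ P.H := by unfold H; omega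

theorem size_a (i j : ℕ) : P.Size 1 (P.a i j) :=
  size_of_abs_le (P.abs_a_le i j) (size_of_le_H D_le_H)

theorem size_b {i : ℕ} (hi : i < P.m) : P.Size 1 (P.b i) := by
  refine size_of_abs_le (y := ((P.b i).natAbs : ℤ)) (by simp) (size_of_le_H ?_)
  have := single_le_sum (f := fun i => (P.b i).natAbs) (fun _ _ => Nat.zero_le _)
    (mem_range.2 hi)
  unfold H
  omega

theorem size_c {j : ℕ} (hj : j < P.n) : P.Size 1 (P.c j) :=
  size_of_abs_le (P.abs_c_le hj) (size_of_le_H cSum_le_H)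

theorem size_α (j : ℕ) : P.Size 1 (P.α j) :=
  size_of_abs_le (P.abs_α_lt j).le (size_of_le_H N_le_H)

theorem size_u (e i : ℕ) : P.Size 1 (P.u e i) :=
  size_of_abs_le (P.abs_u_le e i) (size_of_le_H K_le_H)

theorem size_dot (e j : ℕ) : P.Size 3 (P.dot e j) :=
  Size.sum m_le_H fun i _ => (size_u e i).mul (size_a i j)

theorem size_G {l : ℕ} (hl : l ≤ P.L) (z : ℤ) : P.Size 2 (P.G l z) := by
  refine size_of_abs_le (y := ((P.big + P.big : ℕ) : ℤ)) ?_ ?_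
  · rw [abs_of_nonneg (P.G_nonneg l z)]
    refine (P.G_le l z).trans ?_
    have h1 : l * P.cSum ≤ P.L * P.cSum := Nat.mul_le_mul_right _ hl
    have h2 : P.big = 1 + P.L * P.cSum := rfl
    exact_mod_cast (by omega : P.big + l * P.cSum ≤ P.big + P.big)
  · push_cast
    exact (size_of_le_H big_le_H).add (size_of_le_H big_le_H)

end Data

/-! ### The program: expressions -/

open Data

/-- The address of the encoded columns; it is the first one after the data. -/
def Data.adrα (P : Data) : ℕ := P.m * P.n + P.m + P.n

/-- The address of the codes of functionals. -/
def Data.adrU (P : Data) : ℕ := P.adrα + P.n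

/-- The address of the first part of the current point. -/
def Data.adrX (P : Data) : ℕ := P.adrU + P.m

/-- The address of the second part of the current point. -/
def Data.adrY (P : Data) : ℕ := P.adrX + P.n

/-- The address of the best point. -/
def Data.adrZ (P : Data) : ℕ := P.adrY + P.n

/-- The address of the table of the recursion. -/
def Data.adrG (P : Data) : ℕ := P.adrZ + P.n

/-- The memory holds the data of the integer program. -/
structure Input (P : Data) (s : Store) : Prop where
  reg_m : s.reg 0 = P.m
  reg_n : s.reg 1 = P.n
  mem_a : ∀ i < P.m, ∀ j < P.n, s.mem (i * P.n + j) = P.a i j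
  mem_b : ∀ i < P.m, s.mem (P.m * P.n + i) = P.b i
  mem_c : ∀ j < P.n, s.mem (P.m * P.n + P.m + j) = P.c j

/-- The registers from `2` to `17` hold the parameters of the algorithm. -/
structure Params (P : Data) (s : Store) : Prop extends Input P s where
  reg_D : s.reg 2 = P.D
  reg_K : s.reg 3 = P.K
  reg_W : s.reg 4 = P.W
  reg_N : s.reg 5 = P.N
  reg_L1 : s.reg 6 = P.L + 1
  reg_big : s.reg 7 = P.big
  reg_U : s.reg 8 = P.adrU
  reg_α : s.reg 9 = P.adrα
  reg_X : s.reg 10 = P.adrX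
  reg_Y : s.reg 11 = P.adrY
  reg_Z : s.reg 12 = P.adrZ
  reg_G : s.reg 13 = P.adrG
  reg_E : s.reg 14 = P.E
  reg_T : s.reg 15 = P.T
  reg_B : s.reg 16 = P.B
  reg_L : s.reg 17 = P.L

theorem Input.set {P : Data} {s : Store} (h : Input P s) {r : ℕ} (hr : 2 ≤ r) (v : ℤ) :
    Input P (s.set r v) := by
  obtain ⟨h1, h2, h3, h4, h5⟩ := h
  refine ⟨?_, ?_, h3, h4, h5⟩ <;> rwa [Store.set_reg_ne _ _ (by omega)]

theorem Input.put {P : Data} {s : Store} (h : Input P s) {x : ℤ} (hx : P.adrα ≤ x) (v : ℤ) :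
    Input P (s.put x v) := by
  obtain ⟨h1, h2, h3, h4, h5⟩ := h
  unfold adrα at hx
  push_cast at hx
  refine ⟨h1, h2, fun i hi j hj => ?_, fun i hi => ?_, fun j hj => ?_⟩
  · rw [Store.put_mem_ne, h3 i hi j hj]
    have : (i + 1) * P.n ≤ P.m * P.n := Nat.mul_le_mul_right _ hi
    have h' : ((i : ℤ) + 1) * P.n ≤ P.m * P.n := by exact_mod_cast this
    rw [add_mul] at h'
    omega
  · rw [Store.put_mem_ne, h4 i hi]
    omega
  · rw [Store.put_mem_ne, h5 j hj]
    omega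

theorem Params.set {P : Data} {s : Store} (h : Params P s) {r : ℕ} (hr : 18 ≤ r) (v : ℤ) :
    Params P (s.set r v) := by
  obtain ⟨h0, h2, h3, h4, h5, h6, h7, h8, h9, h10, h11, h12, h13, h14, h15, h16, h17⟩ := h
  refine ⟨h0.set (by omega) v, ?_, ?_, ?_, ?_, ?_, ?_, ?_, ?_, ?_, ?_, ?_, ?_, ?_, ?_, ?_, ?_⟩ <;>
    rwa [Store.set_reg_ne _ _ (by omega)]

theorem Params.put {P : Data} {s : Store} (h : Params P s) {x : ℤ} (hx : P.adrα ≤ x) (v : ℤ) :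
    Params P (s.put x v) := by
  obtain ⟨h0, h2, h3, h4, h5, h6, h7, h8, h9, h10, h11, h12, h13, h14, h15, h16, h17⟩ := h
  exact ⟨h0.put hx v, h2, h3, h4, h5, h6, h7, h8, h9, h10, h11, h12, h13, h14, h15, h16, h17⟩

/-- The power with the base in register `b` and the exponent in register `e`. -/
def powE (b e : ℕ) : Expr := foldE (.var e) (.lit 1) fun x _ => (Flat.var x * .var b).code

/-- The digit number `i` of `e` in base `b` (all three in registers). -/
def digitE (e b i : ℕ) : Expr :=
  letE (powE b i) fun p => (Flat.var e / .var p - .var e / .var p / .var b * .var b).code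

/-- The functional with code in register `e`, evaluated at the column with index in register `j`. -/
def dotE (e j : ℕ) : Expr :=
  sumE (.var 0) fun i => letE (digitE e 16 i) fun g =>
    ((Flat.var g - .var 3) * .load (.var i * .var 1 + .var j)).code

/-- The indicator of `Data.Sep`. -/
def sepE (s k e : ℕ) : Expr :=
  letE (digitE s 1 k) fun p => letE (dotE e p) fun q =>
    iteE (Flat.var q).code
      (letE (sumE (.var 0) fun l => letE (digitE s 1 l) fun p' =>
        iteE ((Flat.var p' - .var p) * (Flat.var p' - .var p)).code
          (letE (dotE e p') fun q' => (Flat.ite (.var q' * .var q') (.lit 1) (.lit 0)).code)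
          (Flat.lit 0).code)
        fun t => (Flat.ite (.var t) (.lit 0) (.lit 1)).code)
      (Flat.lit 0).code

/-- The code of a functional that satisfies `Data.Sep`, if there is one. -/
def findE (s k : ℕ) : Expr :=
  foldE (.var 14) (.lit 0) fun x e => letE (sepE s k e) fun t =>
    (Flat.ite (.var t) (.var e) (.var x)).code

/-- The encoded column with index in register `j`, by Horner's rule. -/
def alphaE (j : ℕ) : Expr :=
  foldE (.var 0) (.lit 0) fun x i =>
    (Flat.var x * .var 4 + .load (.var i * .var 1 + .var j)).code

section
variable {w M : ℕ} [hC : Capacity w M] {d : ℕ} {s : Store}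

theorem evals_powE {b e x k : ℕ} (hb : b < d) (he : e < d) (hbx : s.reg b = x)
    (hek : s.reg e = k) (hk : (k : ℤ) ≤ M) (hx : 1 ≤ x) (hpow : ((x ^ k : ℕ) : ℤ) ≤ M) :
    Evals w M d (powE b e) s ((x ^ k : ℕ) : ℤ) (4 + k * 10) := by
  have := Evals.foldE (w := w) (M := M) (d := d) (s := s) (n := .var e) (e := .lit 1)
    (f := fun y _ => (Flat.var y * .var b).code) (N := k) (g := fun c => ((x ^ (k - c) : ℕ) : ℤ))
    (tb := 5) (T := 4 + k * 10) (by simpa using he) (by simp) (by simpa using hek) hk (by simp)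
    (by simp) (by simp)
    (fun c _ => by
      rw [Nat.abs_cast]
      refine le_trans ?_ hpow
      exact_mod_cast Nat.pow_le_pow_right hx (Nat.sub_le k c))
    (fun c hc => by
      refine Evals.flat (by simp; omega) (by simp) ?_ (by simp)
      simp (disch := omega) only [Flat.eval_mul, Flat.eval_var, Store.set_reg_ne,
        Store.set_reg_self, hbx]
      rw [show k - c = (k - (c + 1)) + 1 by omega, pow_succ]
      push_cast
      ring)
    (by simp)
  simpa [powE] using this

theorem evals_digitE {e b i x y k : ℕ} (he : e < d) (hb : b < d) (hi : i < d) (hex : s.reg e = x)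
    (hby : s.reg b = y) (hik : s.reg i = k) (hk : (k : ℤ) ≤ M) (hy : 1 ≤ y)
    (hpow : ((y ^ k : ℕ) : ℤ) ≤ M) (hyM : (y : ℤ) ≤ M) :
    Evals w M d (digitE e b i) s ((x / y ^ k % y : ℕ) : ℤ) (23 + k * 10) := by
  refine Evals.letE (evals_powE hb hi hby hik hk hy hpow) (by rwa [Nat.abs_cast])
    (t' := 17) ?_ ?_ (by omega)
  · refine Evals.flat (by simp; omega) (by simp) ?_ (by simp)
    simp (disch := omega) only [Flat.eval_sub, Flat.eval_div, Flat.eval_mul, Flat.eval_var,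
      Store.set_reg_ne, Store.set_reg_self, hex, hby]
    have := Int.emod_add_mul_ediv ((x : ℤ) / ((y ^ k : ℕ) : ℤ)) y
    push_cast at this ⊢
    linarith [mul_comm (y : ℤ) ((x : ℤ) / (y : ℤ) ^ k / y)]
  · rw [Nat.abs_cast]
    refine le_trans ?_ hyM
    exact_mod_cast (Nat.mod_lt _ hy).le

end

section
variable {w : ℕ} {P : Data} [hC : Capacity w P.M] {d : ℕ} {s : Store}

theorem evals_sumE {n : Flat} {f : ℕ → Expr} {N k : ℕ} {v : ℕ → ℤ} {tb T : ℕ}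
    (hn : n.WF d) (hnd : n.deg ≤ 64) (hnv : n.eval s = N) (hN : N ≤ P.H)
    (hv : ∀ i < N, P.Size k (v i)) (hk : k ≤ 9)
    (hf : ∀ i < N, ∀ x, Evals w P.M (d + 2) (f (d + 1)) ((s.set d x).set (d + 1) i) (v i) tb)
    (hT : n.time + 2 + N * (tb + 12) ≤ T) :
    Evals w P.M d (sumE n f) s (∑ i ∈ Finset.range N, v i) T := by
  have h1 : P.Size (1 + k) (N * (P.H : ℤ) ^ k) :=
    (size_of_le_H hN).mul (by
      have : (P.H : ℤ) ^ k = ((P.H ^ k : ℕ) : ℤ) := by push_cast; rfl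
      rw [this]
      exact size_natCast le_rfl)
  have h2 : P.Size k ((P.H : ℤ) ^ k) := by simp [Size]
  exact Evals.sumE hn hnd hnv (le_M_of_le_H hN) hv (by positivity)
    ((le_abs_self _).trans (h1.abs_le_M (by omega)))
    ((le_abs_self _).trans (h2.abs_le_M (by omega))) hf hT

theorem lt_M_of_lt_m {k : ℕ} (hk : k < P.m) : (k : ℤ) ≤ P.M :=
  le_M_of_le_H (hk.le.trans m_le_H)

theorem evals_sigmaE (hp : Input P s) {r i t k : ℕ} (hd : 32 ≤ d) (hr : r < d) (hi : i < d)
    (hrt : s.reg r = t) (hik : s.reg i = k) (hk : k < P.m) :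
    Evals w P.M d (digitE r 1 i) s (P.σ t k) (23 + P.m * 10) := by
  refine (evals_digitE (b := 1) hr (by omega) hi hrt hp.reg_n hik (lt_M_of_lt_m hk) P.one_le_n
    (le_M_of_le_H ?_) (le_M_of_le_H n_le_H)).mono (by omega)
  exact (Nat.pow_le_pow_right P.one_le_n hk.le).trans T_le_H

theorem evals_functionalE (hp : Params P s) {r i e k : ℕ} (hd : 32 ≤ d) (hr : r < d) (hi : i < d)
    (hre : s.reg r = e) (hik : s.reg i = k) (hk : k < P.m) :
    Evals w P.M d (digitE r 16 i) s ((e / P.B ^ k % P.B : ℕ) : ℤ) (23 + P.m * 10) := by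
  have hB : 1 ≤ P.B := by unfold B; omega
  refine (evals_digitE (b := 16) hr (by omega) hi hre hp.reg_B hik (lt_M_of_lt_m hk) hB
    (le_M_of_le_H ?_) (le_M_of_le_H B_le_H)).mono (by omega)
  exact (Nat.pow_le_pow_right hB hk.le).trans E_le_H

theorem size_digit (e k : ℕ) : P.Size 1 ((e / P.B ^ k % P.B : ℕ) : ℤ) :=
  size_of_le_H ((Nat.mod_lt _ (by unfold B; omega)).le.trans B_le_H)

theorem evals_dotE (hp : Params P s) {re rj e j : ℕ} (hd : 32 ≤ d) (hre : re < d) (hrj : rj < d)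
    (he : s.reg re = e) (hj : s.reg rj = j) (hjn : j < P.n) :
    Evals w P.M d (dotE re rj) s (P.dot e j) (60 * (P.m + 1) ^ 2) := by
  refine evals_sumE (k := 2) (tb := 40 + P.m * 10) (by simp; omega) (by simp)
    (by simpa using hp.reg_m) m_le_H (fun i _ => (size_u e i).mul (size_a i j)) (by norm_num)
    (fun i hi x => ?_) (by simp; nlinarith)
  have hp1 := (hp.set (r := d) (by omega) x).set (r := d + 1) (by omega) i
  refine Evals.letE (t' := 15) (evals_functionalE hp1 (by omega) (by omega) (by omega)
    (e := e) (k := i) (by simp (disch := omega) only [Store.set_reg_ne, he]) (by simp) hi)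
    (size_digit e i).abs_le_M ?_ ((size_u e i).mul (size_a i j)).abs_le_M (by omega)
  refine Evals.flat (by simp; omega) (by simp) ?_ (by simp)
  simp (disch := omega) only [Flat.eval_sub, Flat.eval_mul, Flat.eval_var, Flat.eval_load,
    Flat.eval_add, Store.set_reg_ne, Store.set_reg_self, hp.reg_K, hp.reg_n, hj, Store.set_mem,
    hp.mem_a i hi j hjn]
  rfl

open Classical in
theorem evals_sepE (hp : Params P s) {rs rk re t k e : ℕ} (hd : 32 ≤ d) (hrs : rs < d)
    (hrk : rk < d) (hre : re < d) (ht : s.reg rs = t) (hk : s.reg rk = k) (he : s.reg re = e)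
    (hkm : k < P.m) :
    Evals w P.M d (sepE rs rk re) s (if P.Sep t k e then 1 else 0) (400 * (P.m + 1) ^ 3) := by
  have hone : ∀ (p : Prop) [Decidable p], |(if p then 1 else 0 : ℤ)| ≤ P.M := fun p _ => by
    refine Size.abs_le_M (k := 0) ?_
    split_ifs
    exacts [size_one, size_zero]
  refine Evals.letE (T := 400 * (P.m + 1) ^ 3) (t' := 360 * (P.m + 1) ^ 3)
    (evals_sigmaE hp.toInput hd hrs hrk ht hk hkm) ?_ ?_ (hone _) ?_
  · exact (size_of_le_H ((P.σ_lt t k).le.trans n_le_H)).abs_le_M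
  · have hp1 := hp.set (r := d) (by omega) (P.σ t k)
    refine Evals.letE (t' := 290 * (P.m + 1) ^ 3) (evals_dotE hp1 (e := e) (j := P.σ t k)
      (by omega) (by omega) (by omega) (by simp (disch := omega) only [Store.set_reg_ne, he])
      (by simp) (P.σ_lt t k)) (size_dot e _).abs_le_M ?_ (hone _) ?_
    · have hp2 := hp1.set (r := d + 1) (by omega) (P.dot e (P.σ t k))
      refine Evals.iteE (ta := 2) (tb := 280 * (P.m + 1) ^ 3) (va := P.dot e (P.σ t k))
        (Evals.flat (by simp) (by simp) (by simp) (by simp)) (fun hpos => ?_) (fun hpos => ?_) ?_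
      · refine Evals.letE (t' := 6)
          (v := ∑ l ∈ Finset.range P.m,
            if P.σ t l ≠ P.σ t k ∧ P.dot e (P.σ t l) ≠ 0 then (1 : ℤ) else 0)
          (evals_sumE (P := P) (k := 0) (tb := 120 * (P.m + 1) ^ 2)
            (T := 200 * (P.m + 1) ^ 3) (by simp) (by simp)
            (by simpa using hp2.reg_m) m_le_H (fun l _ => ?_) (by norm_num) (fun l hl x => ?_) ?_)
          ?_ ?_ (hone _) ?_
        · split_ifs
          exacts [size_one, size_zero]
        · have hp4 := (hp2.set (r := d + 1 + 1) (by omega) x).set (r := d + 1 + 1 + 1) (by omega) l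
          refine Evals.letE (t' := 80 * (P.m + 1) ^ 2) (evals_sigmaE hp4.toInput (by omega)
            (t := t) (k := l) (by omega) (by omega)
            (by simp (disch := omega) only [Store.set_reg_ne, ht]) (by simp) hl)
            (size_of_le_H ((P.σ_lt t l).le.trans n_le_H)).abs_le_M ?_ (hone _) ?_
          · have hp5 := hp4.set (r := d + 1 + 1 + 2) (by omega) (P.σ t l)
            refine Evals.iteE (ta := 11) (tb := 68 * (P.m + 1) ^ 2)
              (va := ((P.σ t l : ℤ) - P.σ t k) * ((P.σ t l : ℤ) - P.σ t k))
              (Evals.flat (by simp; omega) (by simp) ?_ (by simp)) (fun h => ?_) (fun h => ?_) ?_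
            · simp (disch := omega) only [Flat.eval_sub, Flat.eval_mul, Flat.eval_var,
                Store.set_reg_ne, Store.set_reg_self]
            · have hne : P.σ t l ≠ P.σ t k := fun h' => by simp [h'] at h
              refine Evals.letE (t' := 5 + 2 + 1) (evals_dotE hp5 (e := e) (j := P.σ t l)
                (by omega) (by omega) (by omega)
                (by simp (disch := omega) only [Store.set_reg_ne, he])
                (by simp) (P.σ_lt t l)) (size_dot e _).abs_le_M ?_ (hone _) ?_
              · refine Evals.flat (by simp) (by simp) ?_ (by simp)
                simp only [Flat.eval_ite, Flat.eval_mul, Flat.eval_var, Store.set_reg_self,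
                  Flat.eval_lit, mul_self_pos, ne_eq, hne, not_false_eq_true, true_and]
              · nlinarith
            · have heq : P.σ t l = P.σ t k := by
                by_contra hne
                exact h (mul_self_pos.2 (by omega))
              refine Evals.flat (by simp) (by simp) ?_ (by simp; nlinarith)
              simp [heq]
            · nlinarith
          · nlinarith
        · simp
          nlinarith
        · refine (Size.sum (P := P) (k := 0) m_le_H fun l _ => ?_).abs_le_M
          split_ifs
          exacts [size_one, size_zero]
        · refine Evals.flat (by simp) (by simp) ?_ (by simp)
          simp only [Flat.eval_ite, Flat.eval_var, Store.set_reg_self, Flat.eval_lit]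
          have hnn : ∀ l ∈ Finset.range P.m,
              (0 : ℤ) ≤ if P.σ t l ≠ P.σ t k ∧ P.dot e (P.σ t l) ≠ 0 then 1 else 0 :=
            fun l _ => by split_ifs <;> simp
          by_cases hs : P.Sep t k e
          · rw [if_pos hs, if_neg]
            rw [Finset.sum_eq_zero, lt_self_iff_false]
            · exact not_false
            · intro l hl
              rw [if_neg]
              exact fun h => h.2 (hs.2 l (Finset.mem_range.1 hl) h.1)
          · rw [if_neg hs, if_pos]
            by_contra h0
            have h1 := (Finset.sum_eq_zero_iff_of_nonneg hnn).1
              (le_antisymm (not_lt.1 h0) (Finset.sum_nonneg hnn))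
            refine hs ⟨hpos, fun l hl hne => ?_⟩
            have := h1 l (Finset.mem_range.2 hl)
            by_contra hdot
            rw [if_pos ⟨hne, hdot⟩] at this
            exact one_ne_zero this
        · nlinarith [Nat.one_le_pow 3 (P.m + 1) (by omega)]
      · rw [if_neg fun hs => hpos hs.1]
        exact Evals.flat (by simp) (by simp) (by simp)
          (by simp; nlinarith [Nat.one_le_pow 3 (P.m + 1) (by omega)])
      · nlinarith [Nat.one_le_pow 3 (P.m + 1) (by omega)]
    · nlinarith [Nat.one_le_pow 2 (P.m + 1) (by omega)]
  · nlinarith [Nat.one_le_pow 2 (P.m + 1) (by omega)]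

end

/-! ### The program: the current point -/

/-- The least code from `c` on of a functional that satisfies `Sep`, and `0` if there is none. -/
noncomputable def Data.findFrom (P : Data) (s k c : ℕ) : ℕ :=
  open Classical in
  ((List.range' c (P.E - c)).find? fun e => decide (P.Sep s k e)).getD 0

open Classical in
theorem Data.findFrom_succ {P : Data} {s k c : ℕ} (hc : c < P.E) :
    P.findFrom s k c = if P.Sep s k c then c else P.findFrom s k (c + 1) := by
  unfold findFrom
  rw [show P.E - c = (P.E - (c + 1)) + 1 by omega, List.range'_succ, List.find?_cons]
  by_cases h : P.Sep s k c <;> simp [h]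

open Classical in
theorem Data.findFrom_lt (P : Data) (s k c : ℕ) : P.findFrom s k c < P.E := by
  unfold findFrom
  cases h : (List.range' c (P.E - c)).find? fun e => decide (P.Sep s k e) with
  | none => simpa using Nat.lt_of_lt_of_le Nat.zero_lt_one P.one_le_E
  | some e =>
    have := List.mem_of_find?_eq_some h
    rw [List.mem_range'_1] at this
    simp
    omega

open Classical in
theorem Data.sep_findFrom {P : Data} {s k : ℕ} (h : ∃ e < P.E, P.Sep s k e) :
    P.Sep s k (P.findFrom s k 0) := by
  unfold findFrom
  cases h' : (List.range' 0 (P.E - 0)).find? fun e => decide (P.Sep s k e) with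
  | none =>
    obtain ⟨e, he, hs⟩ := h
    rw [List.find?_eq_none] at h'
    exact absurd hs (by simpa using h' e (by rw [List.mem_range'_1]; omega))
  | some e =>
    have := List.find?_some h'
    simpa using this

/-- The value of `f` at the columns, summed with the coefficients of the constraint with index in
register `i`. -/
def rowE (i : ℕ) (f : ℕ → Flat) : Expr :=
  sumE (.var 1) fun j => (.load (.var i * .var 1 + .var j) * f j).code

/-- The value of `f` at the columns, summed with the objective coefficients. -/
def objE (f : ℕ → Flat) : Expr :=
  sumE (.var 1) fun j => (.load (.var 0 * .var 1 + .var 0 + .var j) * f j).code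

/-- The entry with index in register `j` of the array with start in register `a`. -/
def entry (a j : ℕ) : Flat := .load (.var a + .var j)

/-- The quotient that computes the coordinate that belongs to the `k`-th entry of the tuple with
code in register `s`. -/
def quotE (s k : ℕ) : Expr :=
  letE (entry 8 k).code fun e => letE (digitE s 1 k) fun p => letE (dotE e p) fun q =>
    letE (sumE (.var 0) fun i => letE (digitE e 16 i) fun g => letE (rowE i (entry 10)) fun r =>
      ((Flat.var g - .var 3) * (.load (.var 0 * .var 1 + .var i) - .var r)).code)
      fun t => (Flat.var t / .var q).code

/-- The sum of the two parts of the current point. -/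
def pointE (j : ℕ) : Flat := entry 10 j + entry 11 j

/-- The number of constraints that the current point violates. -/
def violatedE : Expr :=
  sumE (.var 0) fun i => letE (rowE i pointE) fun r =>
    (Flat.ite ((.var r - .load (.var 0 * .var 1 + .var i)) *
      (.var r - .load (.var 0 * .var 1 + .var i))) (.lit 1) (.lit 0)).code

/-- The number of negative coordinates of the second part of the current point. -/
def negativeE : Expr :=
  sumE (.var 1) fun j => (Flat.ite (.lit 0 - entry 11 j) (.lit 1) (.lit 0)).code

/-- The array that starts at the address `a`. -/
def arr (s : Store) (a : ℕ) : ℕ → ℤ := fun j => s.mem (a + j)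

@[simp] theorem arr_set (s : Store) (r : ℕ) (v : ℤ) (a : ℕ) : arr (s.set r v) a = arr s a := rfl

section
variable {w : ℕ} {P : Data} [hC : Capacity w P.M] {d : ℕ} {s : Store}

theorem evals_findE (hp : Params P s) {rs rk t k : ℕ} (hd : 32 ≤ d) (hrs : rs < d)
    (hrk : rk < d) (ht : s.reg rs = t) (hk : s.reg rk = k) (hkm : k < P.m) :
    Evals w P.M d (findE rs rk) s (P.findFrom t k 0) (500 * (P.m + 1) ^ 3 * P.E) := by
  classical
  refine Evals.foldE (N := P.E) (g := fun c => (P.findFrom t k c : ℤ))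
    (tb := 420 * (P.m + 1) ^ 3)
    (by simp; omega) (by simp) (by simpa using hp.reg_E) (le_M_of_le_H E_le_H) (by simp) (by simp)
    (by simp [findFrom])
    (fun c _ => (size_of_le_H ((P.findFrom_lt t k c).le.trans E_le_H)).abs_le_M)
    (fun c hc => ?_) ?_
  · have hp1 := (hp.set (r := d) (by omega) (P.findFrom t k (c + 1))).set (r := d + 1)
      (by omega) c
    have hlt : P.Size 1 (P.findFrom t k c) := size_of_le_H ((P.findFrom_lt t k c).le.trans E_le_H)
    refine Evals.letE (t' := 7) (evals_sepE hp1 (e := c) (t := t) (k := k) (by omega) (by omega)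
      (by omega) (by omega) (by simp (disch := omega) only [Store.set_reg_ne, ht])
      (by simp (disch := omega) only [Store.set_reg_ne, hk]) (by simp) hkm)
      (Size.abs_le_M (k := 0) ?_) ?_ hlt.abs_le_M ?_
    · split_ifs
      exacts [size_one, size_zero]
    · refine Evals.flat (by simp) (by simp) ?_ (by simp)
      rw [findFrom_succ hc]
      simp (disch := omega) only [Flat.eval_ite, Flat.eval_var, Store.set_reg_ne,
        Store.set_reg_self]
      split_ifs <;> simp_all
    · nlinarith [Nat.one_le_pow 3 (P.m + 1) (by omega)]
  · simp
    have h1 := Nat.one_le_pow 3 (P.m + 1) (by omega)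
    have h2 := P.one_le_E
    have h3 : P.E * 1 ≤ P.E * (P.m + 1) ^ 3 := Nat.mul_le_mul_left _ h1
    nlinarith

theorem evals_alphaE (hp : Params P s) {rj j : ℕ} (hd : 32 ≤ d) (hrj : rj < d)
    (hj : s.reg rj = j) (hjn : j < P.n) :
    Evals w P.M d (alphaE rj) s (P.α j) (50 * (P.m + 1)) := by
  have hsize : ∀ c ≤ P.m, P.Size 3 (∑ i ∈ Finset.range (P.m - c), P.a (c + i) j * (P.W : ℤ) ^ i) :=
    fun c _ => by
    refine Size.sum (k := 1 + 1) ((Nat.sub_le _ _).trans m_le_H) fun i hi =>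
      (size_a _ _).mul (l := 1) ?_
    have : P.W ^ i ≤ P.W ^ P.m := Nat.pow_le_pow_right (by unfold W; omega) (by omega)
    have h := size_of_le_H (P := P) (this.trans N_le_H)
    push_cast at h
    exact h
  have := Evals.foldE (w := w) (M := P.M) (d := d) (s := s) (n := .var 0) (e := .lit 0)
    (f := fun x i => (Flat.var x * .var 4 + .load (.var i * .var 1 + .var rj)).code)
    (N := P.m) (g := fun c => ∑ i ∈ Finset.range (P.m - c), P.a (c + i) j * (P.W : ℤ) ^ i)
    (tb := 15) (T := 50 * (P.m + 1))
    (by simp; omega) (by simp) (by simpa using hp.reg_m) (le_M_of_le_H m_le_H) (by simp) (by simp)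
    (by simp) (fun c hc => (hsize c hc).abs_le_M)
    (fun c hc => by
      refine Evals.flat (by simp; omega) (by simp) ?_ (by simp)
      simp (disch := omega) only [Flat.eval_mul, Flat.eval_var, Flat.eval_load,
        Flat.eval_add, Store.set_reg_ne, Store.set_reg_self, hp.reg_W, hp.reg_n, hj, Store.set_mem,
        hp.mem_a c hc j hjn]
      rw [show P.m - c = (P.m - (c + 1)) + 1 by omega, Finset.sum_range_succ', Finset.sum_mul]
      simp only [add_zero, pow_zero, mul_one, add_left_inj]
      refine Finset.sum_congr rfl fun i _ => ?_
      rw [show c + 1 + i = c + (i + 1) by ring, pow_succ]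
      ring)
    (by simp; omega)
  simpa [alphaE, α] using this

theorem evals_rowE (hp : Params P s) {f : ℕ → Flat} {v : ℕ → ℤ} {k ri i : ℕ} (hd : 32 ≤ d)
    (hri : ri < d) (hi : s.reg ri = i) (him : i < P.m) (hwf : (f (d + 1)).WF (d + 2))
    (hdeg : (f (d + 1)).deg ≤ 50) (htime : (f (d + 1)).time ≤ 15)
    (hf : ∀ j < P.n, ∀ x, (f (d + 1)).eval ((s.set d x).set (d + 1) j) = v j)
    (hv : ∀ j < P.n, P.Size k (v j)) (hk : k ≤ 8) :
    Evals w P.M d (rowE ri f) s (P.row i v) (41 * P.n) := by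
  refine evals_sumE (k := 1 + k) (tb := 25) (by simp; omega) (by simp)
    (by simpa using hp.reg_n) n_le_H (fun j hj => (size_a i j).mul (hv j hj)) (by omega)
    (fun j hj x => ?_) (by simp; have := P.one_le_n; omega)
  refine Evals.flat ?_ ?_ ?_ ?_
  · simp only [Flat.wf_mul, Flat.wf_load, Flat.wf_add, Flat.wf_var]
    exact ⟨by omega, hwf⟩
  · simp only [Flat.deg_mul, Flat.deg_load, Flat.deg_add, Flat.deg_var]
    omega
  · simp (disch := omega) only [Flat.eval_mul, Flat.eval_load, Flat.eval_add, Flat.eval_var,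
      Store.set_reg_ne, Store.set_reg_self, hi, hp.reg_n, Store.set_mem, hp.mem_a i him j hj,
      hf j hj x]
  · simp only [Flat.time_mul, Flat.time_load, Flat.time_add, Flat.time_var]
    omega

theorem evals_objE (hp : Params P s) {f : ℕ → Flat} {v : ℕ → ℤ} {k : ℕ} (hd : 32 ≤ d)
    (hwf : (f (d + 1)).WF (d + 2))
    (hdeg : (f (d + 1)).deg ≤ 50) (htime : (f (d + 1)).time ≤ 15)
    (hf : ∀ j < P.n, ∀ x, (f (d + 1)).eval ((s.set d x).set (d + 1) j) = v j)
    (hv : ∀ j < P.n, P.Size k (v j)) (hk : k ≤ 8) :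
    Evals w P.M d (objE f) s (P.obj v) (45 * P.n) := by
  refine evals_sumE (k := 1 + k) (tb := 28) (by simp; omega) (by simp)
    (by simpa using hp.reg_n) n_le_H (fun j hj => (size_c hj).mul (hv j hj)) (by omega)
    (fun j hj x => ?_) (by simp; have := P.one_le_n; omega)
  refine Evals.flat ?_ ?_ ?_ ?_
  · simp only [Flat.wf_mul, Flat.wf_load, Flat.wf_add, Flat.wf_var]
    exact ⟨by omega, hwf⟩
  · simp only [Flat.deg_mul, Flat.deg_load, Flat.deg_add, Flat.deg_var]
    omega
  · simp (disch := omega) only [Flat.eval_mul, Flat.eval_load, Flat.eval_add, Flat.eval_var,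
      Store.set_reg_ne, Store.set_reg_self, hp.reg_m, hp.reg_n, Store.set_mem, hp.mem_c j hj,
      hf j hj x]
  · simp only [Flat.time_mul, Flat.time_load, Flat.time_add, Flat.time_var]
    omega

theorem evals_quotE (hp : Params P s) {rs rk t k e : ℕ} (hd : 32 ≤ d) (hrs : rs < d)
    (hrk : rk < d) (ht : s.reg rs = t) (hk : s.reg rk = k) (hkm : k < P.m)
    (he : s.mem (P.adrU + k : ℕ) = e) (heE : e < P.E)
    (hX : ∀ j < P.n, P.Size 1 (arr s P.adrX j)) :
    Evals w P.M d (quotE rs rk) s ((∑ i ∈ Finset.range P.m,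
      P.u e i * (P.b i - P.row i (arr s P.adrX))) / P.dot e (P.σ t k))
      (300 * (P.m + 1) ^ 2 * P.n) := by
  have hn := P.one_le_n
  have hrow : ∀ i, P.Size 3 (P.row i (arr s P.adrX)) := fun i =>
    Size.sum (k := 2) n_le_H fun j hj => (size_a i j).mul (hX j hj)
  have hnum : ∀ i < P.m, P.Size 5 (P.u e i * (P.b i - P.row i (arr s P.adrX))) := fun i hi =>
    (size_u e i).mul (Size.sub (k := 3) ((size_b hi).mono (by norm_num)) (hrow i))
  have hsum := Size.sum m_le_H hnum
  have hres := hsum.div (P.dot e (P.σ t k))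
  have hm2 := Nat.one_le_pow 2 (P.m + 1) (by omega)
  have hm1 : P.m + 1 ≤ (P.m + 1) ^ 2 := by nlinarith
  have hm3 : (P.m + 1) ^ 2 * 1 ≤ (P.m + 1) ^ 2 * P.n := Nat.mul_le_mul_left _ hn
  refine Evals.letE (v := e) (t := 6) (t' := 290 * (P.m + 1) ^ 2 * P.n)
    (Evals.flat (by simp [entry]; omega) (by simp [entry]) ?_ (by simp [entry]))
    (size_of_le_H (heE.le.trans E_le_H)).abs_le_M ?_ hres.abs_le_M (by nlinarith)
  · simp only [entry, Flat.eval_load, Flat.eval_add, Flat.eval_var, hp.reg_U, hk]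
    rw [← he]; push_cast; rfl
  have hp1 := hp.set (r := d) (by omega) e
  refine Evals.letE (t' := 250 * (P.m + 1) ^ 2 * P.n)
    (evals_sigmaE hp1.toInput (r := rs) (i := rk) (t := t) (k := k) (by omega) (by omega)
    (by omega) (by simp (disch := omega) only [Store.set_reg_ne, ht])
    (by simp (disch := omega) only [Store.set_reg_ne, hk]) hkm)
    (size_of_le_H ((P.σ_lt t k).le.trans n_le_H)).abs_le_M ?_ hres.abs_le_M (by nlinarith)
  have hp2 := hp1.set (r := d + 1) (by omega) (P.σ t k)
  refine Evals.letE (t' := 180 * (P.m + 1) ^ 2 * P.n)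
    (evals_dotE hp2 (e := e) (j := P.σ t k) (by omega) (by omega) (by omega)
    (by simp (disch := omega) only [Store.set_reg_ne, Store.set_reg_self]) (by simp)
    (P.σ_lt t k)) (size_dot e _).abs_le_M ?_ hres.abs_le_M (by nlinarith)
  have hp3 := hp2.set (r := d + 1 + 1) (by omega) (P.dot e (P.σ t k))
  refine Evals.letE (t' := 5) (t := 170 * (P.m + 1) ^ 2 * P.n) (evals_sumE (P := P) (k := 5)
    (tb := 60 + P.m * 10 + 41 * P.n) (by simp)
    (by simp) (by simpa using hp3.reg_m) m_le_H hnum (by norm_num) (fun i hi x => ?_) ?_)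
    hsum.abs_le_M ?_ hres.abs_le_M (by nlinarith)
  · have hp5 := (hp3.set (r := d + 1 + 1 + 1) (by omega) x).set (r := d + 1 + 1 + 1 + 1)
      (by omega) i
    refine Evals.letE (t' := 41 * P.n + 26)
      (evals_functionalE hp5 (e := e) (k := i) (by omega) (by omega)
      (by omega) (by simp (disch := omega) only [Store.set_reg_ne, Store.set_reg_self])
      (by simp) hi) (size_digit e i).abs_le_M ?_ (hnum i hi).abs_le_M (by omega)
    have hp6 := hp5.set (r := d + 1 + 1 + 1 + 2) (by omega) ((e / P.B ^ i % P.B : ℕ) : ℤ)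
    refine Evals.letE (t' := 18) (evals_rowE hp6 (k := 1) (v := arr s P.adrX) (i := i) (by omega)
      (by omega) (by simp (disch := omega) only [Store.set_reg_ne, Store.set_reg_self]) hi
      (by simp [entry]; omega) (by simp [entry]) (by simp [entry]) (fun j _ y => ?_) hX
      (by norm_num)) (hrow i).abs_le_M ?_ (hnum i hi).abs_le_M (by omega)
    · simp (disch := omega) only [entry, Flat.eval_load, Flat.eval_add, Flat.eval_var,
        Store.set_reg_ne, Store.set_reg_self, hp.reg_X, Store.set_mem, arr]
    · refine Evals.flat (by simp) (by simp) ?_ (by simp)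
      simp (disch := omega) only [Flat.eval_mul, Flat.eval_sub, Flat.eval_load, Flat.eval_add,
        Flat.eval_var, Store.set_reg_ne, Store.set_reg_self, hp.reg_K, hp.reg_m, hp.reg_n,
        Store.set_mem, hp.mem_b i hi]
      rfl
  · simp
    nlinarith
  · refine Evals.flat (by simp) (by simp) ?_ (by simp)
    simp (disch := omega) only [Flat.eval_div, Flat.eval_var, Store.set_reg_ne,
      Store.set_reg_self]

open Classical in
theorem evals_violatedE (hp : Params P s) {k : ℕ} (hd : 32 ≤ d)
    (hX : ∀ j < P.n, P.Size k (arr s P.adrX j + arr s P.adrY j)) (hk : k ≤ 8) :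
    Evals w P.M d violatedE s (∑ i ∈ Finset.range P.m,
      if P.row i (fun j => arr s P.adrX j + arr s P.adrY j) = P.b i then 0 else 1)
      (100 * (P.m + 1) * P.n) := by
  have hn := P.one_le_n
  have hone : ∀ (p : Prop) [Decidable p], P.Size 0 (if p then 0 else 1 : ℤ) := fun p _ => by
    split_ifs
    exacts [size_zero, size_one]
  refine evals_sumE (k := 0) (tb := 41 * P.n + 30) (by simp; omega) (by simp)
    (by simpa using hp.reg_m) m_le_H (fun i _ => hone _) (by norm_num) (fun i hi x => ?_)
    (by simp; nlinarith)
  have hp2 := (hp.set (r := d) (by omega) x).set (r := d + 1) (by omega) i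
  refine Evals.letE (t' := 28) (evals_rowE hp2 (k := k)
    (v := fun j => arr s P.adrX j + arr s P.adrY j) (i := i) (by omega)
    (by omega) (by simp) hi (by simp [pointE, entry]; omega) (by simp [pointE, entry])
    (by simp [pointE, entry]) (fun j _ y => ?_) hX hk)
    ((Size.sum (k := 1 + k) n_le_H fun j hj => (size_a i j).mul (hX j hj)).abs_le_M (by omega))
    ?_ (hone _).abs_le_M (by omega)
  · simp (disch := omega) only [pointE, entry, Flat.eval_load, Flat.eval_add, Flat.eval_var,
      Store.set_reg_ne, Store.set_reg_self, hp.reg_X, hp.reg_Y, Store.set_mem, arr]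
  · refine Evals.flat (by simp) (by simp) ?_ (by simp)
    simp (disch := omega) only [Flat.eval_mul, Flat.eval_sub, Flat.eval_load, Flat.eval_add,
      Flat.eval_ite, Flat.eval_lit, Flat.eval_var, Store.set_reg_ne, Store.set_reg_self, hp.reg_m,
      hp.reg_n, Store.set_mem, hp.mem_b i hi, mul_self_pos, sub_ne_zero]
    split_ifs <;> simp_all

theorem evals_negativeE (hp : Params P s) (hd : 32 ≤ d) :
    Evals w P.M d negativeE s (∑ j ∈ Finset.range P.n, if arr s P.adrY j < 0 then 1 else 0)
      (30 * P.n) := by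
  have hn := P.one_le_n
  refine evals_sumE (k := 0) (tb := 13) (by simp; omega) (by simp)
    (by simpa using hp.reg_n) n_le_H (fun j _ => ?_) (by norm_num) (fun j hj x => ?_)
    (by simp; omega)
  · split_ifs
    exacts [size_one, size_zero]
  · refine Evals.flat (by simp [entry]; omega) (by simp [entry]) ?_ (by simp [entry])
    simp (disch := omega) only [entry, Flat.eval_load, Flat.eval_add, Flat.eval_var, Flat.eval_lit,
      Flat.eval_ite, Flat.eval_sub, Store.set_reg_ne, Store.set_reg_self, hp.reg_Y, Store.set_mem,
      arr]
    split_ifs <;> omega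

end

/-! ### The program: search for the best point -/

/-- The address of the entry for layer `l` and code `z` in the table of the recursion. -/
def Data.pos (P : Data) (l : ℕ) (z : ℤ) : ℤ := P.adrG + l + (z + 2 * P.N) * (P.L + 1)

/-- The encoded columns and the table of the recursion are available. -/
structure Ready (P : Data) (s : Store) : Prop extends Params P s where
  mem_α : ∀ j < P.n, s.mem (P.adrα + j) = P.α j
  mem_G : ∀ l ≤ P.L, ∀ z, -(2 * P.N : ℤ) ≤ z → s.mem (P.pos l z) = P.G l z

theorem Data.adrG_le_pos {P : Data} {l : ℕ} {z : ℤ} (hz : -(2 * P.N : ℤ) ≤ z) :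
    (P.adrG : ℤ) ≤ P.pos l z := by
  unfold pos
  have : 0 ≤ (z + 2 * P.N) * ((P.L : ℤ) + 1) := mul_nonneg (by linarith) (by positivity)
  omega

theorem Ready.set {P : Data} {s : Store} (h : Ready P s) {r : ℕ} (hr : 18 ≤ r) (v : ℤ) :
    Ready P (s.set r v) := ⟨h.toParams.set hr v, h.mem_α, h.mem_G⟩

theorem Ready.put {P : Data} {s : Store} (h : Ready P s) {x : ℤ} (hx : P.adrU ≤ x)
    (hx' : x < P.adrG) (v : ℤ) : Ready P (s.put x v) := by
  have hU : P.adrU = P.adrα + P.n := rfl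
  refine ⟨h.toParams.put (by omega) v, fun j hj => ?_, fun l hl z hz => ?_⟩
  · rw [Store.put_mem_ne _ _ (by omega), h.mem_α j hj]
  · have := P.adrG_le_pos (l := l) hz
    rw [Store.put_mem_ne _ _ (by omega), h.mem_G l hl z hz]

theorem arr_put (s : Store) (a j : ℕ) (v : ℤ) :
    arr (s.put (a + j) v) a = Function.update (arr s a) j v := by
  ext i
  unfold arr
  by_cases h : i = j
  · subst h; simp
  · rw [Function.update_of_ne h, Store.put_mem_ne]
    omega

theorem arr_put_of_ne (s : Store) {a : ℕ} {x : ℤ} (v : ℤ) {i : ℕ} (h : (a : ℤ) + i ≠ x) :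
    arr (s.put x v) a i = arr s a i := Store.put_mem_ne _ _ h

/-- The storages agree on what the treatment of one code has to preserve. -/
structure Keep (P : Data) (s s' : Store) : Prop where
  reg : ∀ r, 18 ≤ r → r < 22 → s'.reg r = s.reg r
  arr_U : ∀ k < P.m, arr s' P.adrU k = arr s P.adrU k
  arr_Z : ∀ j < P.n, arr s' P.adrZ j = arr s P.adrZ j

theorem Keep.refl (P : Data) (s : Store) : Keep P s s :=
  ⟨fun _ _ _ => rfl, fun _ _ => rfl, fun _ _ => rfl⟩

theorem Keep.trans {P : Data} {s s' s'' : Store} (h : Keep P s s') (h' : Keep P s' s'') :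
    Keep P s s'' :=
  ⟨fun r h1 h2 => (h'.reg r h1 h2).trans (h.reg r h1 h2),
    fun k hk => (h'.arr_U k hk).trans (h.arr_U k hk),
    fun j hj => (h'.arr_Z j hj).trans (h.arr_Z j hj)⟩

theorem Keep.set {P : Data} {s s' : Store} (h : Keep P s s') {r : ℕ} (hr : 22 ≤ r) (v : ℤ) :
    Keep P s (s'.set r v) :=
  ⟨fun q h1 h2 => by rw [Store.set_reg_ne _ _ (by omega)]; exact h.reg q h1 h2, h.arr_U, h.arr_Z⟩

theorem Keep.put {P : Data} {s s' : Store} (h : Keep P s s') {x : ℤ} (hx : P.adrX ≤ x)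
    (hx' : x < P.adrZ) (v : ℤ) : Keep P s (s'.put x v) := by
  have hX : P.adrX = P.adrU + P.m := rfl
  refine ⟨h.reg, fun k hk => ?_, fun j hj => ?_⟩
  · rw [arr_put_of_ne _ _ (by omega), h.arr_U k hk]
  · rw [arr_put_of_ne _ _ (by omega), h.arr_Z j hj]

/-- Set both parts of the current point to zero. -/
def clearP : Prog :=
  forDown 23 (.var 1) (.seq (write (.var 10 + .var 23) (Flat.lit 0).code)
    (write (.var 11 + .var 23) (Flat.lit 0).code))

/-- Reconstruct the first part of the current point from its code. Register `22` holds the code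
of the remainder, increased by `2 N`. -/
def traceP : Prog :=
  .seq (assign 22 (Flat.var 21 + .var 5).code)
    (forDown 23 (.var 17)
      (cond (Flat.load (.var 13 + .var 23 + .lit 1 + .var 22 * .var 6) -
          .load (.var 13 + .var 23 + .var 22 * .var 6)).code
        (.seq (assign 24 (Flat.var 23 - .var 23 / .var 1 * .var 1).code)
          (.seq (write (.var 10 + .var 24) (entry 10 24 + .lit 1).code)
            (assign 22 (.var 22 - entry 9 24 : Flat).code)))
        .skip))

/-- Compute the second part of the current point, from the right-hand sides that the first part
leaves over. -/
def solveP : Prog :=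
  forDown 23 (.var 0) (.seq (assign 24 (digitE 20 1 23)) (write (.var 11 + .var 24) (quotE 20 23)))

/-- If the current point is feasible and better than the best point so far, then it becomes the
best point. -/
def compareP : Prog :=
  cond violatedE .skip (cond negativeE .skip
    (.seq (assign 25 (objE pointE))
      (cond (Flat.ite (.var 18) (.var 25 - .var 19) (.lit 1)).code
        (.seq (assign 18 (Flat.lit 1).code) (.seq (assign 19 (Flat.var 25).code)
          (forDown 23 (.var 1) (write (.var 12 + .var 23) (pointE 23).code))))
        .skip)))

/-- The treatment of one code: register `20` holds the code of the tuple and register `21` holds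
`z + N`, where `z` is the code of the point to be reconstructed. -/
def candidateP : Prog := .seq clearP (.seq traceP (.seq solveP compareP))

/-- The treatment of one tuple: find the separating functionals, and try all codes. -/
def tupleP : Prog :=
  .seq (forDown 23 (.var 0) (write (.var 8 + .var 23) (findE 20 23)))
    (forDown 21 (.lit 2 * .var 5 + .lit 1) candidateP)

section
variable {w : ℕ} {P : Data} [hC : Capacity w P.M] {s : Store}

theorem runs_clearP (h : Ready P s) : Runs w P.M clearP s (40 * P.n) fun s' => Ready P s' ∧
    Keep P s s' ∧ (∀ j < P.n, arr s' P.adrX j = 0) ∧ ∀ j < P.n, arr s' P.adrY j = 0 := by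
  have hX : P.adrX = P.adrU + P.m := rfl
  have hY : P.adrY = P.adrX + P.n := rfl
  have hZ : P.adrZ = P.adrY + P.n := rfl
  have hG : P.adrG = P.adrZ + P.n := rfl
  refine Runs.forDown (N := P.n) (tb := 14) (fun c s' => Ready P s' ∧ Keep P s s' ∧
    ∀ j < P.n, c ≤ j → arr s' P.adrX j = 0 ∧ arr s' P.adrY j = 0) (by norm_num) (by simp)
    (by simp) (by simpa using h.reg_n) (le_M_of_le_H n_le_H)
    ⟨h.set (by norm_num) _, (Keep.refl P s).set (by norm_num) _, fun j h1 h2 => by omega⟩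
    (fun c hc s' ⟨h1, h2, h3⟩ _ => ?_)
    (fun s' ⟨h1, h2, h3⟩ => ⟨h1, h2, fun j hj => (h3 j hj (by omega)).1,
      fun j hj => (h3 j hj (by omega)).2⟩)
    (by simp; have := P.one_le_n; omega)
  have h1' := h1.set (r := 23) (by norm_num) c
  have h2' := h2.set (r := 23) (by norm_num) c
  refine Runs.write_seq (t' := 7) (v := 0) (x := P.adrX + c)
    (Evals.flat (by simp) (by simp) (by simp) le_rfl) (by simp)
    (by simp) (by simp) (by simp [h1'.reg_X]) ?_ (by simp)
  have h1'' := h1'.put (x := P.adrX + c) (by omega) (by omega) 0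
  have h2'' := h2'.put (x := P.adrX + c) (by omega) (by omega) 0
  refine Runs.write (v := 0) (x := P.adrY + c)
    (Evals.flat (by simp) (by simp) (by simp) le_rfl) (by simp)
    (by simp) (by simp) (by simp [h1''.reg_Y]) ?_ (by simp)
  refine ⟨⟨h1''.put (by omega) (by omega) 0, h2''.put (by omega) (by omega) 0,
    fun j hj hcj => ?_⟩, by simp⟩
  rw [arr_put_of_ne _ _ (by omega), arr_put, arr_put, arr_set]
  rcases hcj.eq_or_lt with rfl | hlt
  · simp
  · have := h3 j hj hlt
    rw [Function.update_of_ne (by omega), Function.update_of_ne (by omega),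
      arr_put_of_ne _ _ (by omega)]
    exact this

theorem runs_traceP (h : Ready P s) {c : ℕ} (hc : s.reg 21 = c) (hcN : c ≤ 2 * P.N)
    (hX0 : ∀ j < P.n, arr s P.adrX j = 0) (hY0 : ∀ j < P.n, arr s P.adrY j = 0) :
    Runs w P.M traceP s (120 * P.L + 20) fun s' => Ready P s' ∧ Keep P s s' ∧
      (∀ j < P.n, arr s' P.adrY j = 0) ∧ ∃ y, P.Trace (c - P.N) 0 (arr s' P.adrX) y := by
  have hX : P.adrX = P.adrU + P.m := rfl
  have hY : P.adrY = P.adrX + P.n := rfl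
  have hZ : P.adrZ = P.adrY + P.n := rfl
  have hG : P.adrG = P.adrZ + P.n := rfl
  have hzN : |(c : ℤ) - P.N| ≤ P.N := by rw [abs_le]; omega
  have hsz : ∀ y : ℤ, |y| ≤ 2 * P.N → P.Size 4 (y + 2 * P.N) := fun y hy => by
    have h2 : P.Size 2 (((2 * P.N : ℕ)) : ℤ) := size_natCast (by
      have := P.two_le_H
      have := P.N_le_H
      nlinarith)
    push_cast at h2
    exact ((size_of_abs_le hy h2).add h2).mono (by norm_num)
  refine Runs.assign_seq (t' := 120 * P.L + 10) (v := c - P.N + 2 * P.N)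
    (Evals.flat (by simp) (by simp) (by simp [h.reg_N, hc]; ring) le_rfl)
    (by norm_num) (hsz _ (by linarith [abs_nonneg ((c : ℤ) - P.N)])).abs_le_M ?_ (by simp; omega)
  have h0 := h.set (r := 22) (by norm_num) (c - P.N + 2 * P.N)
  refine Runs.forDown (N := P.L) (tb := 100) (fun l s' => Ready P s' ∧ Keep P s s' ∧
    (∀ j < P.n, arr s' P.adrY j = 0) ∧
    ∃ y, s'.reg 22 = y + 2 * P.N ∧ P.Trace (c - P.N) l (arr s' P.adrX) y) (by norm_num) (by simp)
    (by simp) (by simpa using h0.reg_L) (le_M_of_le_H L_le_H)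
    ⟨h0.set (by norm_num) _, ((Keep.refl P s).set (by norm_num) _).set (by norm_num) _, hY0,
      c - P.N, by simp [Store.set_reg], Trace.init P _ hX0⟩
    (fun l hl s' ⟨h1, h2, h3, y, hy, hT⟩ _ => ?_)
    (fun s' ⟨h1, h2, h3, y, _, hT⟩ => ⟨h1, h2, h3, y, hT⟩)
    (by simp; omega)
  have hyN : |y| ≤ 2 * P.N := by have := hT.abs_le; linarith
  have hy1 : -(2 * P.N : ℤ) ≤ y := (abs_le.1 hyN).1
  have h1' := h1.set (r := 23) (by norm_num) l
  have h2' := h2.set (r := 23) (by norm_num) l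
  have hpos1 : s'.mem (P.adrG + l + 1 + (y + 2 * P.N) * (P.L + 1)) = P.G (l + 1) y := by
    rw [← h1.mem_G (l + 1) hl y hy1]
    exact congrArg _ (by unfold pos; push_cast; ring)
  have hpos0 : s'.mem (P.adrG + l + (y + 2 * P.N) * (P.L + 1)) = P.G l y :=
    h1.mem_G l hl.le y hy1
  refine Runs.cond (te := 28) (t := 70) (v := P.G (l + 1) y - P.G l y)
    (Evals.flat (by simp) (by simp) ?_ (by simp)) (fun hpos => ?_) (fun hpos => ?_) (by norm_num)
  · simp (disch := omega) only [Flat.eval_sub, Flat.eval_load, Flat.eval_add, Flat.eval_mul,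
      Flat.eval_var, Flat.eval_lit, Store.set_reg_ne, Store.set_reg_self, h1.reg_G, h1.reg_L1, hy,
      Store.set_mem, hpos1, hpos0]
  · have hjn : l % P.n < P.n := P.mod_lt l
    refine Runs.assign_seq (t' := 50) (v := ((l % P.n : ℕ) : ℤ)) (t := 11)
      (Evals.flat (by simp) (by simp) ?_ (by simp)) (by norm_num)
      (size_of_le_H (hjn.le.trans n_le_H)).abs_le_M ?_ (by norm_num)
    · simp (disch := omega) only [Flat.eval_sub, Flat.eval_div, Flat.eval_mul,
        Flat.eval_var, Store.set_reg_ne, Store.set_reg_self, h1.reg_n]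
      have := Int.emod_add_mul_ediv (l : ℤ) P.n
      push_cast
      linarith [mul_comm ((l : ℤ) / P.n) P.n]
    have h1'' := h1'.set (r := 24) (by norm_num) (l % P.n : ℕ)
    have h2'' := h2'.set (r := 24) (by norm_num) (l % P.n : ℕ)
    have hT' := hT.take (by omega)
    set j := l % P.n with hj
    have hXj : P.Size 2 (arr s' P.adrX j + 1) :=
      Size.add (k := 1) (size_of_abs_le (y := P.L) (by
        rw [abs_of_nonneg (hT.nonneg j hjn)]; exact hT.le_L hjn) (size_of_le_H L_le_H))
        (size_one.mono (by norm_num))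
    refine Runs.write_seq (t' := 20) (x := P.adrX + j) (v := arr s' P.adrX j + 1)
      (Evals.flat (t := 8) (by simp [entry]) (by simp [entry]) ?_ (by simp [entry]))
      hXj.abs_le_M (by simp) (by simp)
      ?_ ?_ (by simp)
    · simp (disch := omega) only [entry, Flat.eval_load, Flat.eval_add, Flat.eval_lit,
        Flat.eval_var, Store.set_reg_ne, Store.set_reg_self, h1.reg_X, Store.set_mem, arr]
    · simp (disch := omega) only [Flat.eval_add, Flat.eval_var, Store.set_reg_ne,
        Store.set_reg_self, h1.reg_X]
    have hjX : (P.adrX : ℤ) ≤ P.adrX + j := by omega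
    have h3' := h1''.put (x := P.adrX + j) (by omega) (by omega) (arr s' P.adrX j + 1)
    have h4' := h2''.put (x := P.adrX + j) (by omega) (by omega) (arr s' P.adrX j + 1)
    have hyN' := hT'.abs_le
    refine Runs.assign (v := y - P.α j + 2 * P.N)
      (Evals.flat (t := 10) (by simp [entry]) (by simp [entry]) ?_ (by simp [entry])) (by norm_num)
      (hsz _ (by linarith)).abs_le_M ⟨⟨h3'.set (by norm_num) _, h4'.set (by norm_num) _,
        fun i hi => ?_, y - P.α j, by simp, ?_⟩, ?_⟩ (by norm_num)
    · have hα := h3'.mem_α j hjn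
      simp (disch := omega) only [entry, Flat.eval_load, Flat.eval_add, Flat.eval_sub,
        Flat.eval_var, Store.put_reg, Store.set_reg_ne, Store.set_reg_self, h1.reg_α, hy, hα]
      ring
    · rw [arr_set, arr_put_of_ne _ _ (by omega)]
      exact h3 i hi
    · rw [arr_set, arr_put]
      exact hT'
    · simp [Store.set_reg]
  · exact (Runs.skip ⟨⟨h1', h2', h3, y, by simp [Store.set_reg, hy], hT.stay (by omega)⟩,
      by simp⟩).mono (fun _ h => h) (by norm_num)

end

/-! ### Correctness of the treatment of a point -/

/-- Register `18` tells whether a feasible point has been found, register `19` holds the objective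
value of the best one. It is at least the value of all points with a decomposition whose tuple
code and code satisfy `C`. -/
structure Best (P : Data) (C : ℕ → ℤ → Prop) (s : Store) : Prop where
  found : s.reg 18 = 0 ∨ s.reg 18 = 1 ∧ P.Feasible (arr s P.adrZ) ∧
    P.obj (arr s P.adrZ) = s.reg 19
  le : ∀ t x' x'', C t (P.code x') → P.Decomp t x' x'' →
    s.reg 18 = 1 ∧ P.obj (fun j => x' j + x'' j) ≤ s.reg 19

theorem Data.row_congr {P : Data} (i : ℕ) {x y : ℕ → ℤ} (h : ∀ j < P.n, x j = y j) :
    P.row i x = P.row i y :=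
  Finset.sum_congr rfl fun j hj => by rw [h j (Finset.mem_range.1 hj)]

theorem Data.obj_congr {P : Data} {x y : ℕ → ℤ} (h : ∀ j < P.n, x j = y j) :
    P.obj x = P.obj y :=
  Finset.sum_congr rfl fun j hj => by rw [h j (Finset.mem_range.1 hj)]

theorem Data.Feasible.congr {P : Data} {x y : ℕ → ℤ} (hx : P.Feasible x)
    (h : ∀ j < P.n, y j = x j) : P.Feasible y :=
  ⟨fun j hj => by rw [h j hj]; exact hx.1 j hj, fun i hi => by
    rw [row_congr i h]; exact hx.2 i hi⟩

theorem Best.mono {P : Data} {C C' : ℕ → ℤ → Prop} {s : Store} (h : Best P C s)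
    (hC : ∀ t z, C' t z → C t z) : Best P C' s :=
  ⟨h.found, fun t x' x'' hc => h.le t x' x'' (hC _ _ hc)⟩

theorem Best.keep {P : Data} {C : ℕ → ℤ → Prop} {s s' : Store} (h : Best P C s)
    (h18 : s'.reg 18 = s.reg 18) (h19 : s'.reg 19 = s.reg 19)
    (hZ : ∀ j < P.n, arr s' P.adrZ j = arr s P.adrZ j) : Best P C s' := by
  refine ⟨?_, fun t x' x'' h1 h2 => ?_⟩
  · rw [h18, h19]
    rcases h.found with h | ⟨h1, h2, h3⟩
    · exact Or.inl h
    · exact Or.inr ⟨h1, h2.congr hZ, by rw [obj_congr hZ, h3]⟩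
  · rw [h18, h19]
    exact h.le t x' x'' h1 h2

section
variable {w : ℕ} {P : Data} [hC : Capacity w P.M] {s : Store}

/-- Whenever a solvable point has the left-hand sides that are left over, it is the second part of
the current point that is computed. -/
theorem runs_solveP (h : Ready P s) {t : ℕ} (ht : s.reg 20 = t)
    (hU : ∀ k < P.m, arr s P.adrU k = P.findFrom t k 0)
    (hX1 : ∀ j < P.n, P.Size 1 (arr s P.adrX j)) (hY0 : ∀ j < P.n, arr s P.adrY j = 0) :
    Runs w P.M solveP s (400 * (P.m + 1) ^ 3 * P.n) fun s' => Ready P s' ∧ Keep P s s' ∧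
      (∀ j < P.n, arr s' P.adrX j = arr s P.adrX j) ∧ (∀ j < P.n, P.Size 6 (arr s' P.adrY j)) ∧
      ∀ x, P.Solvable t x → (∀ i < P.m, P.b i - P.row i (arr s P.adrX) = P.row i x) →
        ∀ j < P.n, arr s' P.adrY j = x j := by
  have hU' : P.adrU = P.adrα + P.n := rfl
  have hX : P.adrX = P.adrU + P.m := rfl
  have hY : P.adrY = P.adrX + P.n := rfl
  have hZ : P.adrZ = P.adrY + P.n := rfl
  have hG : P.adrG = P.adrZ + P.n := rfl
  have hn := P.one_le_n
  have hm2 : 1 * 1 ≤ (P.m + 1) ^ 2 * P.n := Nat.mul_le_mul (Nat.one_le_pow _ _ (by omega)) hn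
  have hm1 : (P.m + 1) * 1 ≤ (P.m + 1) ^ 2 * P.n :=
    Nat.mul_le_mul (by nlinarith) hn
  refine Runs.forDown (N := P.m) (tb := 350 * (P.m + 1) ^ 2 * P.n) (fun c s' => Ready P s' ∧
    Keep P s s' ∧
    (∀ j < P.n, arr s' P.adrX j = arr s P.adrX j) ∧ (∀ j < P.n, P.Size 6 (arr s' P.adrY j)) ∧
      ∀ x, P.Solvable t x → (∀ i < P.m, P.b i - P.row i (arr s P.adrX) = P.row i x) →
        (∀ k, c ≤ k → k < P.m → arr s' P.adrY (P.σ t k) = x (P.σ t k)) ∧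
        ∀ j < P.n, (∀ k, c ≤ k → k < P.m → P.σ t k ≠ j) → arr s' P.adrY j = 0)
    (by norm_num) (by simp) (by simp) (by simpa using h.reg_m) (le_M_of_le_H m_le_H)
    ⟨h.set (by norm_num) _, (Keep.refl P s).set (by norm_num) _, fun _ _ => rfl,
      fun j hj => by rw [arr_set, hY0 j hj]; exact size_zero.mono (by norm_num),
      fun x _ _ => ⟨fun k h1 h2 => by omega, fun j hj _ => hY0 j hj⟩⟩
    (fun k hk s' ⟨h1, h2, h3, h4, h5⟩ _ => ?_)
    (fun s' ⟨h1, h2, h3, h4, h5⟩ => ⟨h1, h2, h3, h4, fun x hx hr j hj => ?_⟩)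
    (by simp; nlinarith)
  · have h1' := h1.set (r := 23) (by norm_num) k
    have h2' := h2.set (r := 23) (by norm_num) k
    have ht' : s'.reg 20 = t := (h2.reg 20 (by norm_num) (by norm_num)).trans ht
    have hσ : P.σ t k < P.n := P.σ_lt t k
    refine Runs.assign_seq (v := P.σ t k) (t' := 300 * (P.m + 1) ^ 2 * P.n + 10)
      (evals_sigmaE h1'.toInput (t := t) (k := k) le_rfl (by norm_num) (by norm_num)
        (by simp [Store.set_reg, ht']) (by simp) hk) (by norm_num)
      (size_of_le_H (hσ.le.trans n_le_H)).abs_le_M ?_ (by nlinarith)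
    have h1'' := h1'.set (r := 24) (by norm_num) (P.σ t k)
    have h2'' := h2'.set (r := 24) (by norm_num) (P.σ t k)
    have hXs : ∀ i, P.row i (arr ((s'.set 23 k).set 24 (P.σ t k)) P.adrX) =
        P.row i (arr s P.adrX) := fun i => row_congr i fun j hj => h3 j hj
    have hq := evals_quotE (w := w) (d := 32) h1''.toParams (rs := 20) (rk := 23) (t := t) (k := k)
      (e := P.findFrom t k 0) le_rfl (by norm_num) (by norm_num) (by simp [Store.set_reg, ht'])
      (by simp [Store.set_reg]) hk (by
        rw [← hU k hk, ← h2''.arr_U k hk]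
        simp [arr]) (P.findFrom_lt t k 0) (fun j hj => by
        rw [arr_set, arr_set, h3 j hj]
        exact hX1 j hj)
    simp only [hXs] at hq
    set q := (∑ i ∈ Finset.range P.m, P.u (P.findFrom t k 0) i *
      (P.b i - P.row i (arr s P.adrX))) / P.dot (P.findFrom t k 0) (P.σ t k) with hqdef
    have hqs : P.Size 6 q := by
      refine (Size.sum (k := 5) m_le_H fun i hi => ?_).div _
      exact (size_u _ i).mul (Size.sub (k := 3) ((size_b hi).mono (by norm_num))
        (Size.sum (k := 2) n_le_H fun j hj => (size_a i j).mul (hX1 j hj)))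
    refine Runs.write hq hqs.abs_le_M (x := P.adrY + P.σ t k) (by simp) (by simp) (by
        simp (disch := omega) only [Flat.eval_add, Flat.eval_var, Store.set_reg_ne,
          Store.set_reg_self, h1.reg_Y])
      ⟨⟨h1''.put (by omega) (by omega) q, h2''.put (by omega) (by omega) q, fun j hj => ?_,
        fun j hj => ?_, fun x hx hr => ?_⟩, ?_⟩ (by simp)
    · rw [arr_put_of_ne _ _ (by omega)]
      exact h3 j hj
    · rw [arr_put]
      by_cases hjσ : j = P.σ t k
      · rw [hjσ, Function.update_self]
        exact hqs
      · rw [Function.update_of_ne hjσ]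
        exact h4 j hj
    · have hqx : q = x (P.σ t k) := hx.div_eq hk (fun he => sep_findFrom he) hr
      obtain ⟨h6, h7⟩ := h5 x hx hr
      rw [arr_put]
      refine ⟨fun l hl hlm => ?_, fun j hj hne => ?_⟩
      · by_cases hlσ : P.σ t l = P.σ t k
        · rw [hlσ, Function.update_self, hqx]
        · rw [Function.update_of_ne hlσ]
          refine h6 l ?_ hlm
          have : l ≠ k := fun h => hlσ (by rw [h])
          omega
      · rw [Function.update_of_ne (hne k le_rfl hk).symm]
        exact h7 j hj fun l hl => hne l (by omega)
    · simp [Store.set_reg]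
  · obtain ⟨h6, h7⟩ := h5 x hx hr
    by_cases hex : ∃ k < P.m, P.σ t k = j
    · obtain ⟨k, hk, rfl⟩ := hex
      exact h6 k (Nat.zero_le _) hk
    · push Not at hex
      rw [h7 j hj fun k _ => hex k, hx.eq_zero_of_forall_ne hj hex]

open Classical in
/-- If the current point dominates all points with a decomposition that belong to the tuple `t` and
the code `z`, then the best point takes them into account after the comparison. -/
theorem runs_compareP (h : Ready P s) (hX0 : ∀ j < P.n, 0 ≤ arr s P.adrX j)
    (hX1 : ∀ j < P.n, P.Size 1 (arr s P.adrX j)) (hY : ∀ j < P.n, P.Size 6 (arr s P.adrY j))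
    {C : ℕ → ℤ → Prop} (hB : Best P C s) {t : ℕ} {z : ℤ}
    (hz : ∀ x' x'', P.code x' = z → P.Decomp t x' x'' →
      (∀ j < P.n, arr s P.adrY j = x'' j) ∧
      (∀ i < P.m, P.row i (arr s P.adrX) = P.row i x') ∧ P.obj x' ≤ P.obj (arr s P.adrX)) :
    Runs w P.M compareP s (300 * (P.m + 1) * P.n) fun s' => Ready P s' ∧
      Best P (fun t' z' => C t' z' ∨ t' = t ∧ z' = z) s' ∧
      (∀ k < P.m, arr s' P.adrU k = arr s P.adrU k) ∧ s'.reg 20 = s.reg 20 ∧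
      s'.reg 21 = s.reg 21 := by
  have hU' : P.adrU = P.adrα + P.n := rfl
  have hX' : P.adrX = P.adrU + P.m := rfl
  have hY' : P.adrY = P.adrX + P.n := rfl
  have hZ' : P.adrZ = P.adrY + P.n := rfl
  have hG' : P.adrG = P.adrZ + P.n := rfl
  have hn := P.one_le_n
  have hmn : 1 * P.n ≤ (P.m + 1) * P.n := Nat.mul_le_mul_right _ (by omega)
  set x : ℕ → ℤ := fun j => arr s P.adrX j + arr s P.adrY j with hx
  have hxs : ∀ j < P.n, P.Size 7 (x j) := fun j hj =>
    Size.add (k := 6) ((hX1 j hj).mono (by norm_num)) (hY j hj)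
  have hobj : P.Size 9 (P.obj x) :=
    Size.sum (k := 1 + 7) n_le_H fun j hj => (size_c hj).mul (hxs j hj)
  -- A point that comes from a decomposition passes both tests.
  have hgood : ∀ x' x'', P.code x' = z → P.Decomp t x' x'' →
      (∀ i < P.m, P.row i x = P.b i) ∧ (∀ j < P.n, 0 ≤ arr s P.adrY j) ∧
        P.obj (fun j => x' j + x'' j) ≤ P.obj x := fun x' x'' hc hd => by
    obtain ⟨h1, h2, h3⟩ := hz x' x'' hc hd
    refine ⟨fun i hi => ?_, fun j hj => by rw [h1 j hj]; exact hd.nonneg j hj, ?_⟩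
    · rw [hx, row_add, row_congr i h1, h2 i hi, ← row_add, hd.row_eq i hi]
    · rw [hx, obj_add, obj_add, obj_congr h1]
      linarith
  -- If a test fails, no decomposition is missed.
  have hskip : ¬ ((∀ i < P.m, P.row i x = P.b i) ∧ ∀ j < P.n, 0 ≤ arr s P.adrY j) →
      ∀ T, 1 ≤ T → Runs w P.M .skip s T fun s' => Ready P s' ∧
      Best P (fun t' z' => C t' z' ∨ t' = t ∧ z' = z) s' ∧
      (∀ k < P.m, arr s' P.adrU k = arr s P.adrU k) ∧ s'.reg 20 = s.reg 20 ∧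
      s'.reg 21 = s.reg 21 := fun hnot T hT =>
    (Runs.skip ⟨h, ⟨hB.found, fun t' x' x'' hc hd => by
      rcases hc with hc | ⟨rfl, hc⟩
      · exact hB.le t' x' x'' hc hd
      · exact absurd ⟨(hgood x' x'' hc hd).1, (hgood x' x'' hc hd).2.1⟩ hnot⟩,
      fun _ _ => rfl, rfl, rfl⟩).mono (fun _ h => h) hT
  refine Runs.cond (t := 150 * P.n) (evals_violatedE h.toParams (k := 7) le_rfl hxs (by norm_num))
    (fun hpos => hskip (fun hnot => ?_) _ (by omega)) (fun hpos => ?_) (by nlinarith)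
  · rw [Finset.sum_eq_zero fun i hi => if_pos (hnot.1 i (Finset.mem_range.1 hi))] at hpos
    exact lt_irrefl _ hpos
  have hrow : ∀ i < P.m, P.row i x = P.b i := fun i hi => by
    by_contra hne
    refine hpos (Finset.sum_pos' (fun i _ => by split_ifs <;> simp)
      ⟨i, Finset.mem_range.2 hi, ?_⟩)
    rw [if_neg hne]
    exact one_pos
  refine Runs.cond (t := 110 * P.n) (evals_negativeE h.toParams le_rfl)
    (fun hpos => hskip (fun hnot => ?_) _ (by omega)) (fun hpos => ?_) (by omega)
  · rw [Finset.sum_eq_zero fun j hj => if_neg (not_lt.2 (hnot.2 j (Finset.mem_range.1 hj)))]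
      at hpos
    exact lt_irrefl _ hpos
  have hYnn : ∀ j < P.n, 0 ≤ arr s P.adrY j := fun j hj => by
    by_contra hneg
    refine hpos (Finset.sum_pos' (fun i _ => by split_ifs <;> simp)
      ⟨j, Finset.mem_range.2 hj, ?_⟩)
    rw [if_pos (not_le.1 hneg)]
    exact one_pos
  have hfeas : P.Feasible x := ⟨fun j hj => add_nonneg (hX0 j hj) (hYnn j hj), hrow⟩
  have hpoint : ∀ s' : Store, Params P s' → s'.mem = s.mem → ∀ (e : ℕ) (j : ℕ), s'.reg e = j →
      (pointE e).eval s' = x j := fun s' hp hm e j hj => by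
    simp only [pointE, entry, Flat.eval_load, Flat.eval_add, Flat.eval_var, hp.reg_X, hp.reg_Y,
      hj, hm, hx, arr]
  refine Runs.assign_seq (v := P.obj x) (t' := 60 * P.n)
    (evals_objE h.toParams (v := x) (k := 7) le_rfl (by simp [pointE, entry])
      (by simp [pointE, entry]) (by simp [pointE, entry]) (fun j hj y => ?_) hxs (by norm_num))
    (by norm_num) hobj.abs_le_M ?_ (by omega)
  · exact hpoint _ ((h.toParams.set (by norm_num) _).set (by norm_num) _) rfl _ j (by simp)
  have h1 := h.set (r := 25) (by norm_num) (P.obj x)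
  refine Runs.cond (t := 45 * P.n) (v := if 0 < s.reg 18 then P.obj x - s.reg 19 else 1)
    (Evals.flat (by simp) (by simp) (by simp [Store.set_reg]) (t := 9) (by simp))
    (fun hpos' => ?_) (fun hpos' => ?_) (by omega)
  · refine Runs.assign_seq (v := 1) (t' := 45 * P.n - 3) (Evals.flat (by simp) (by simp) (by simp)
      le_rfl) (by norm_num) (size_one.abs_le_M (by norm_num)) ?_ (by simp; omega)
    refine Runs.assign_seq (v := P.obj x) (t' := 45 * P.n - 7) (Evals.flat (by simp) (by simp)
      (by simp [Store.set_reg]) le_rfl) (by norm_num) hobj.abs_le_M ?_ (by simp; omega)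
    have h2 := (h1.set (r := 18) (by norm_num) 1).set (r := 19) (by norm_num) (P.obj x)
    set s₂ := ((s.set 25 (P.obj x)).set 18 1).set 19 (P.obj x) with hs₂
    refine Runs.forDown (N := P.n) (tb := 25) (fun c s' => Ready P s' ∧
      (∀ j < P.n, c ≤ j → arr s' P.adrZ j = x j) ∧ s'.reg 18 = 1 ∧ s'.reg 19 = P.obj x ∧
      (∀ j < P.n, arr s' P.adrX j = arr s P.adrX j) ∧
      (∀ j < P.n, arr s' P.adrY j = arr s P.adrY j) ∧
      (∀ k < P.m, arr s' P.adrU k = arr s P.adrU k) ∧ s'.reg 20 = s.reg 20 ∧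
      s'.reg 21 = s.reg 21) (by norm_num) (by simp) (by simp) (by simpa using h2.reg_n)
      (le_M_of_le_H n_le_H)
      ⟨h2.set (by norm_num) _, fun j h1 h2 => by omega, by simp [hs₂, Store.set_reg],
        by simp [hs₂, Store.set_reg], fun _ _ => rfl, fun _ _ => rfl, fun _ _ => rfl,
        by simp [hs₂, Store.set_reg], by simp [hs₂, Store.set_reg]⟩
      (fun c hc s' ⟨e1, e2, e3, e4, e5, e6, e7, e8, e9⟩ _ => ?_)
      (fun s' ⟨e1, e2, e3, e4, e5, e6, e7, e8, e9⟩ => ⟨e1, ⟨Or.inr ⟨e3,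
        hfeas.congr fun j hj => e2 j hj (Nat.zero_le _), ?_⟩, fun t' x' x'' hc hd => ⟨e3, ?_⟩⟩,
        e7, e8, e9⟩) (by simp; omega)
    · have e1' := e1.set (r := 23) (by norm_num) c
      refine Runs.write (v := x c) (x := P.adrZ + c) (t := 13)
        (Evals.flat (by simp [pointE, entry]) (by simp [pointE, entry]) ?_
          (by simp [pointE, entry])) (hxs c hc).abs_le_M (by simp) (by simp)
        (by simp [Store.set_reg, e1.reg_Z])
        ⟨⟨e1'.put (by omega) (by omega) _, fun j hj hcj => ?_, by simp [Store.set_reg, e3],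
          by simp [Store.set_reg, e4], fun j hj => ?_, fun j hj => ?_, fun j hj => ?_,
          by simp [Store.set_reg, e8], by simp [Store.set_reg, e9]⟩, by simp⟩ (by simp)
      · simp only [pointE, entry, Flat.eval_load, Flat.eval_add, Flat.eval_var, e1'.reg_X,
          e1'.reg_Y, Store.set_reg_self, Store.set_mem]
        exact congrArg₂ (· + ·) (e5 c hc) (e6 c hc)
      · rw [arr_put]
        rcases hcj.eq_or_lt with rfl | hlt
        · simp
        · rw [Function.update_of_ne (by omega)]
          exact e2 j hj hlt
      · rw [arr_put_of_ne _ _ (by omega)]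
        exact e5 j hj
      · rw [arr_put_of_ne _ _ (by omega)]
        exact e6 j hj
      · rw [arr_put_of_ne _ _ (by omega)]
        exact e7 j hj
    · rw [obj_congr fun j hj => e2 j hj (Nat.zero_le _), e4]
    · rw [e4]
      rcases hc with hc | ⟨rfl, hc⟩
      · obtain ⟨h5, h6⟩ := hB.le t' x' x'' hc hd
        rw [h5, if_pos one_pos] at hpos'
        omega
      · exact (hgood x' x'' hc hd).2.2
  · have h18 : s.reg 18 = 1 ∧ P.obj x ≤ s.reg 19 := by
      rcases hB.found with h0 | ⟨h0, -⟩
      · rw [h0] at hpos'; simp at hpos'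
      · rw [h0, if_pos one_pos] at hpos'
        exact ⟨h0, by omega⟩
    refine (Runs.skip ⟨h1, ⟨?_, fun t' x' x'' hc hd => ?_⟩, fun _ _ => rfl,
      by simp [Store.set_reg], by simp [Store.set_reg]⟩).mono (fun _ h => h) (by omega)
    · simpa [Store.set_reg] using hB.found
    · simp only [Store.set_reg]
      norm_num
      rcases hc with hc | ⟨rfl, hc⟩
      · exact hB.le t' x' x'' hc hd
      · exact ⟨h18.1, (hgood x' x'' hc hd).2.2.trans h18.2⟩

end

/-! ### The program: table and search -/

/-- The treatment of all tuples. -/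
def searchP : Prog := forDown 20 (.var 15) tupleP

/-- The computation of the table of the recursion, layer by layer. Registers `22` to `25` hold the
index of the layer, its column, the encoded column and the objective coefficient; the code of the
entry is `N` less than the content of register `21`. -/
def tableP : Prog :=
  forDown 20 (.var 17)
    (.seq (assign 22 (Flat.var 17 - .lit 1 - .var 20).code)
    (.seq (assign 23 (Flat.var 22 - .var 22 / .var 1 * .var 1).code)
    (.seq (assign 24 (entry 9 23).code)
    (.seq (assign 25 (Flat.load (.var 0 * .var 1 + .var 0 + .var 23)).code)
    (forDown 21 (.lit 2 * .var 5 + .lit 1)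
      (.seq (assign 26 (Flat.load (.var 13 + .var 22 + (.var 21 + .var 5 - .var 24) * .var 6)).code)
      (.seq (assign 27 (Flat.load (.var 13 + .var 22 + (.var 21 + .var 5) * .var 6)).code)
      (write (.var 13 + .var 22 + .lit 1 + (.var 21 + .var 5) * .var 6)
        (Flat.ite (.var 26) (.ite (.var 26 + .var 25 - .var 27) (.var 26 + .var 25) (.var 27))
          (.var 27)).code))))))))

/-- The table of the recursion holds the values of `f`. -/
structure Table (P : Data) (f : ℕ → ℤ → ℤ) (s : Store) : Prop extends Params P s where
  mem_α : ∀ j < P.n, s.mem (P.adrα + j) = P.α j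
  mem_f : ∀ l ≤ P.L, ∀ z, -(2 * P.N : ℤ) ≤ z → s.mem (P.pos l z) = f l z

theorem Data.adrα_add_le_adrG (P : Data) : P.adrα + P.n ≤ P.adrG := by
  unfold adrG adrZ adrY adrX adrU
  omega

theorem Table.set {P : Data} {f : ℕ → ℤ → ℤ} {s : Store} (h : Table P f s) {r : ℕ} (hr : 18 ≤ r)
    (v : ℤ) : Table P f (s.set r v) := ⟨h.toParams.set hr v, h.mem_α, h.mem_f⟩

theorem Data.pos_injective {P : Data} {l l' : ℕ} (hl : l ≤ P.L) (hl' : l' ≤ P.L) {z z' : ℤ}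
    (h : P.pos l z = P.pos l' z') : l = l' ∧ z = z' := by
  unfold pos at h
  have h1 : (z - z') * ((P.L : ℤ) + 1) = l' - l := by linarith
  have h2 : z = z' := by
    by_contra hne
    have h3 : (P.L : ℤ) + 1 ∣ l' - l := ⟨z - z', by rw [← h1]; ring⟩
    have h4 := Int.eq_zero_of_abs_lt_dvd h3 (by rw [abs_lt]; omega)
    rw [h4] at h1
    rcases mul_eq_zero.1 h1 with h5 | h5 <;> omega
  subst h2
  simp at h1
  omega

theorem Table.put {P : Data} {f : ℕ → ℤ → ℤ} {s : Store} (h : Table P f s) {l : ℕ} (hl : l ≤ P.L)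
    {z : ℤ} (hz : -(2 * P.N : ℤ) ≤ z) {v : ℤ} {f' : ℕ → ℤ → ℤ} (hv : f' l z = v)
    (hf : ∀ l' z', ¬ (l' = l ∧ z' = z) → -(2 * P.N : ℤ) ≤ z' → f' l' z' = f l' z') :
    Table P f' (s.put (P.pos l z) v) := by
  have h1 := P.adrG_le_pos (l := l) hz
  have h2 := P.adrα_add_le_adrG
  refine ⟨h.toParams.put (by omega) v, fun j hj => ?_, fun l' hl' z' hz' => ?_⟩
  · rw [Store.put_mem_ne _ _ (by omega), h.mem_α j hj]
  · by_cases he : l' = l ∧ z' = z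
    · rw [he.1, he.2, Store.put_mem_self, hv]
    · rw [Store.put_mem_ne _ _ (fun h' => he (pos_injective hl' hl h')), h.mem_f l' hl' z' hz',
        hf l' z' he hz']

theorem Table.congr {P : Data} {f f' : ℕ → ℤ → ℤ} {s : Store} (h : Table P f s)
    (hf : ∀ l ≤ P.L, ∀ z, -(2 * P.N : ℤ) ≤ z → f' l z = f l z) : Table P f' s :=
  ⟨h.toParams, h.mem_α, fun l hl z hz => by rw [h.mem_f l hl z hz, hf l hl z hz]⟩

/-- The contents of the table when the layers up to `l` have been computed, and in the next layer
the codes from `c - N` on. -/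
def Data.partialG (P : Data) (l c l' : ℕ) (z : ℤ) : ℤ :=
  if l' ≤ l ∨ l' = l + 1 ∧ c ≤ z + P.N then P.G l' z else 0

section
variable {w : ℕ} {P : Data} [hC : Capacity w P.M] {s : Store}

theorem Data.two_mul_N_add_one_le : ((2 * P.N + 1 : ℕ) : ℤ) ≤ P.M := by
  refine (le_abs_self _).trans ((size_natCast (k := 3) ?_).abs_le_M)
  have h1 := P.two_le_H
  have h2 := P.N_le_H
  calc 2 * P.N + 1 ≤ 2 * P.H + 2 * P.H := by omega
    _ = (2 * 2) * P.H := by ring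
    _ ≤ (P.H * P.H) * P.H := by gcongr
    _ = P.H ^ 3 := by ring

theorem Data.G_eq_zero {l : ℕ} (hl : l ≤ P.L) {z : ℤ} (hz : (P.N : ℤ) ≤ |z|) : P.G l z = 0 := by
  by_contra h
  have := P.abs_lt_of_G_pos hl (lt_of_le_of_ne (P.G_nonneg l z) (Ne.symm h))
  omega

theorem runs_tableP (h : Table P (P.partialG 0 (2 * P.N + 1)) s) :
    Runs w P.M tableP s (400 * P.N * P.L + 10) fun s' => Ready P s' ∧
      s'.reg 18 = s.reg 18 := by
  have hN := P.one_le_N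
  refine Runs.forDown (N := P.L) (tb := 390 * P.N) (fun c s' => c ≤ P.L ∧
    Table P (P.partialG (P.L - c) (2 * P.N + 1)) s' ∧ s'.reg 18 = s.reg 18) (by norm_num) (by simp)
    (by simp) (by simpa using h.reg_L) (le_M_of_le_H L_le_H)
    ⟨le_rfl, by simpa using h.set (by norm_num) _, by simp [Store.set_reg]⟩
    (fun c hc s' ⟨_, h1, h18⟩ _ => ?_)
    (fun s' ⟨_, h1, h18⟩ => ⟨⟨h1.toParams, h1.mem_α, fun l hl z hz => ?_⟩, h18⟩)
    (by simp; nlinarith)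
  · obtain ⟨l, hl⟩ : ∃ l, P.L = c + 1 + l := ⟨P.L - (c + 1), by omega⟩
    rw [show P.L - (c + 1) = l by omega] at h1
    have hlL : l ≤ P.L := by omega
    have hl1 : l + 1 ≤ P.L := by omega
    have hj := P.mod_lt l
    refine Runs.assign_seq (v := l) (t := 8) (t' := 380 * P.N)
      (Evals.flat (by simp) (by simp) ?_ (by simp)) (by norm_num)
      (size_of_le_H (hlL.trans L_le_H)).abs_le_M ?_ (by omega)
    · simp [Store.set_reg, h1.reg_L, hl]
      ring
    refine Runs.assign_seq (v := (l % P.n : ℕ)) (t := 11) (t' := 360 * P.N)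
      (Evals.flat (by simp) (by simp) ?_ (by simp)) (by norm_num)
      (size_of_le_H (hj.le.trans n_le_H)).abs_le_M ?_ (by omega)
    · simp (disch := omega) only [Flat.eval_sub, Flat.eval_div, Flat.eval_mul,
        Flat.eval_var, Store.set_reg_ne, Store.set_reg_self, h1.reg_n]
      have := Int.emod_add_mul_ediv (l : ℤ) P.n
      push_cast
      linarith [mul_comm ((l : ℤ) / P.n) P.n]
    refine Runs.assign_seq (v := P.α (l % P.n)) (t := 10) (t' := 340 * P.N)
      (Evals.flat (by simp [entry]) (by simp [entry]) ?_ (by simp [entry])) (by norm_num)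
      (size_α _).abs_le_M ?_ (by omega)
    · simp (disch := omega) only [entry, Flat.eval_load, Flat.eval_add, Flat.eval_var,
        Store.set_reg_ne, Store.set_reg_self, h1.reg_α, Store.set_mem, h1.mem_α _ hj]
    refine Runs.assign_seq (v := P.c (l % P.n)) (t := 12) (t' := 320 * P.N)
      (Evals.flat (by simp) (by simp) ?_ (by simp)) (by norm_num)
      (size_c hj).abs_le_M ?_ (by omega)
    · simp (disch := omega) only [Flat.eval_load, Flat.eval_add, Flat.eval_mul, Flat.eval_var,
        Store.set_reg_ne, Store.set_reg_self, h1.reg_m, h1.reg_n, Store.set_mem, h1.mem_c _ hj]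
    set s₄ := ((((s'.set 20 c).set 22 l).set 23 (l % P.n : ℕ)).set 24 (P.α (l % P.n))).set 25
      (P.c (l % P.n)) with hs₄
    have h4 : Table P (P.partialG l (2 * P.N + 1)) s₄ :=
      ((((h1.set (by norm_num) _).set (by norm_num) _).set (by norm_num) _).set (by norm_num) _).set
        (by norm_num) _
    refine Runs.forDown (N := 2 * P.N + 1) (tb := 90) (fun i s'' => Table P (P.partialG l i) s'' ∧
      s''.reg 18 = s.reg 18 ∧ s''.reg 20 = c ∧ s''.reg 22 = l ∧ s''.reg 24 = P.α (l % P.n) ∧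
      s''.reg 25 = P.c (l % P.n)) (by norm_num) (by simp) (by simp)
      (by simp [h4.reg_N]) two_mul_N_add_one_le
      ⟨h4.set (by norm_num) _, by simp [hs₄, Store.set_reg, h18], by simp [hs₄, Store.set_reg],
        by simp [hs₄, Store.set_reg], by simp [hs₄, Store.set_reg], by simp [hs₄, Store.set_reg]⟩
      (fun i hi s'' ⟨e1, e2, e3, e4, e5, e6⟩ _ => ?_)
      (fun s'' ⟨e1, e2, e3, e4, e5, e6⟩ => ⟨⟨by omega, ?_, e2⟩, e3⟩) (by simp; omega)
    · have e1' := e1.set (r := 21) (by norm_num) i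
      obtain ⟨z, hz⟩ : ∃ z : ℤ, z = i - P.N := ⟨_, rfl⟩
      have hzi : (i : ℤ) = z + P.N := by omega
      have hα := abs_lt.1 (P.abs_α_lt (l % P.n))
      set y := P.G l (z - P.α (l % P.n)) with hy
      set g := P.G l z with hg
      have hy2 : s''.mem (P.pos l (z - P.α (l % P.n))) = y := by
        rw [e1.mem_f l hlL _ (by omega), partialG, if_pos (Or.inl le_rfl)]
      have hg2 : s''.mem (P.pos l z) = g := by
        rw [e1.mem_f l hlL _ (by omega), partialG, if_pos (Or.inl le_rfl)]
      refine Runs.assign_seq (v := y) (t := 18) (t' := 65)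
        (Evals.flat (by simp) (by simp) ?_ (by simp)) (by norm_num)
        (size_G hlL _).abs_le_M ?_ (by omega)
      · simp (disch := omega) only [Flat.eval_load, Flat.eval_add, Flat.eval_sub, Flat.eval_mul,
          Flat.eval_var, Store.set_reg_ne, Store.set_reg_self, e1.reg_G, e1.reg_N, e1.reg_L1, e4,
          e5, Store.set_mem]
        rw [← hy2]
        exact congrArg _ (by rw [hzi]; unfold pos; ring)
      refine Runs.assign_seq (v := g) (t := 15) (t' := 48)
        (Evals.flat (by simp) (by simp) ?_ (by simp)) (by norm_num)
        (size_G hlL _).abs_le_M ?_ (by omega)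
      · simp (disch := omega) only [Flat.eval_load, Flat.eval_add, Flat.eval_mul,
          Flat.eval_var, Store.set_reg_ne, Store.set_reg_self, e1.reg_G, e1.reg_N, e1.reg_L1, e4,
          Store.set_mem]
        rw [← hg2]
        exact congrArg _ (by rw [hzi]; unfold pos; ring)
      have e2' := (e1'.set (r := 26) (by norm_num) y).set (r := 27) (by norm_num) g
      have hG : P.G (l + 1) z = if 0 < y then if 0 < y + P.c (l % P.n) - g then
          y + P.c (l % P.n) else g else g := by
        rw [G, ← hy, ← hg]
        split_ifs with h1 h2
        · exact max_eq_right (by omega)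
        · exact max_eq_left (by omega)
        · rfl
      refine Runs.write (v := P.G (l + 1) z) (x := P.pos (l + 1) z) (t := 25)
        (Evals.flat (by simp) (by simp) ?_ (by simp))
        (size_G hl1 z).abs_le_M (by simp) (by simp) ?_ ⟨⟨e2'.put hl1 (by omega) ?_ ?_,
          by simp [Store.set_reg, e2], by simp [Store.set_reg, e3], by simp [Store.set_reg, e4],
          by simp [Store.set_reg, e5], by simp [Store.set_reg, e6]⟩, by simp [Store.set_reg]⟩
        (by simp)
      · simp (disch := omega) only [Flat.eval_ite, Flat.eval_add, Flat.eval_sub,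
          Flat.eval_var, Store.set_reg_ne, Store.set_reg_self, e6]
        exact hG.symm
      · simp (disch := omega) only [Flat.eval_add, Flat.eval_mul, Flat.eval_lit,
          Flat.eval_var, Store.set_reg_ne, Store.set_reg_self, e1.reg_G, e1.reg_N, e1.reg_L1, e4]
        rw [hzi]
        unfold pos
        push_cast
        ring
      · rw [partialG, if_pos (Or.inr ⟨rfl, by omega⟩)]
      · intro l' z' hne hz'
        unfold partialG
        refine if_congr (or_congr Iff.rfl (and_congr_right fun h => ?_)) rfl rfl
        have : z' ≠ z := fun h' => hne ⟨h, h'⟩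
        push_cast
        omega
    · rw [show P.L - c = l + 1 by omega]
      refine e1.congr fun l' hl' z hz => ?_
      unfold partialG
      by_cases hll : l' ≤ l
      · rw [if_pos (Or.inl (by omega)), if_pos (Or.inl hll)]
      · by_cases hl2 : l' = l + 1
        · rw [if_pos (Or.inl (by omega))]
          split_ifs with hif
          · rfl
          · refine G_eq_zero hl' ?_
            rw [abs_of_neg] <;> omega
        · rw [if_neg (c := l' ≤ l ∨ _) (by omega)]
          split_ifs with hif
          · refine G_eq_zero hl' ?_
            rw [abs_of_nonneg] <;> omega
          · rfl
  · rw [h1.mem_f l hl z hz, partialG, if_pos (Or.inl (by omega))]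

theorem runs_candidateP (h : Ready P s) {t c : ℕ} (ht : s.reg 20 = t) (hc : s.reg 21 = c)
    (hcN : c ≤ 2 * P.N) (hU : ∀ k < P.m, arr s P.adrU k = P.findFrom t k 0)
    {C : ℕ → ℤ → Prop} (hB : Best P C s) :
    Runs w P.M candidateP s (900 * (P.m + 1) ^ 3 * P.L) fun s' => Ready P s' ∧
      Best P (fun t' z' => C t' z' ∨ t' = t ∧ z' = c - P.N) s' ∧
      (∀ k < P.m, arr s' P.adrU k = P.findFrom t k 0) ∧ s'.reg 20 = t ∧ s'.reg 21 = c := by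
  have hnL : P.n ≤ P.L := Nat.le_mul_of_pos_right _ P.one_le_K
  have hn := P.one_le_n
  have hm3 : 1 ≤ (P.m + 1) ^ 3 := Nat.one_le_pow _ _ (by omega)
  have hm1 : P.m + 1 ≤ (P.m + 1) ^ 3 := by
    calc P.m + 1 = (P.m + 1) ^ 1 := (pow_one _).symm
      _ ≤ _ := Nat.pow_le_pow_right (by omega) (by norm_num)
  have a1 : 1 * P.L ≤ (P.m + 1) ^ 3 * P.L := Nat.mul_le_mul_right _ hm3
  have a2 : (P.m + 1) * P.n ≤ (P.m + 1) ^ 3 * P.L := Nat.mul_le_mul hm1 hnL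
  have a3 : (P.m + 1) ^ 3 * P.n ≤ (P.m + 1) ^ 3 * P.L := Nat.mul_le_mul_left _ hnL
  refine Runs.seq _ (runs_clearP h) (t' := 300 * ((P.m + 1) * P.n) +
    400 * ((P.m + 1) ^ 3 * P.n) + (120 * P.L + 20))
    (fun s₁ ⟨h₁, k₁, hX₁, hY₁⟩ => ?_) (by nlinarith)
  have hc₁ : s₁.reg 21 = c := (k₁.reg 21 (by norm_num) (by norm_num)).trans hc
  refine Runs.seq _ (runs_traceP h₁ hc₁ hcN hX₁ hY₁) (t' := 300 * ((P.m + 1) * P.n) +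
    400 * ((P.m + 1) ^ 3 * P.n)) (fun s₂ ⟨h₂, k₂, hY₂, y, hT⟩ => ?_) (by omega)
  have k₂' := k₁.trans k₂
  have hX₂ : ∀ j < P.n, P.Size 1 (arr s₂ P.adrX j) := fun j hj =>
    size_of_abs_le (y := P.L) (by rw [abs_of_nonneg (hT.nonneg j hj)]; exact hT.le_L hj)
      (size_of_le_H L_le_H)
  refine Runs.seq _ (runs_solveP h₂ ((k₂'.reg 20 (by norm_num) (by norm_num)).trans ht)
    (fun k hk => (k₂'.arr_U k hk).trans (hU k hk)) hX₂ hY₂) (t' := 300 * ((P.m + 1) * P.n))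
    (fun s₃ ⟨h₃, k₃, hX₃, hY₃, hsol⟩ => ?_) (by rw [mul_assoc]; omega)
  have k₃' := k₂'.trans k₃
  have hB₃ : Best P C s₃ := hB.keep (k₃'.reg 18 (by norm_num) (by norm_num))
    (k₃'.reg 19 (by norm_num) (by norm_num)) k₃'.arr_Z
  refine (runs_compareP h₃ (fun j hj => by rw [hX₃ j hj]; exact hT.nonneg j hj)
    (fun j hj => by rw [hX₃ j hj]; exact hX₂ j hj) hY₃ hB₃ (t := t) (z := c - P.N)
    (fun x' x'' hz hd => ?_)).mono (fun s' ⟨e1, e2, e3, e4, e5⟩ => ⟨e1, e2, fun k hk => by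
      rw [e3 k hk, k₃'.arr_U k hk, hU k hk], by
      rw [e4, k₃'.reg 20 (by norm_num) (by norm_num), ht], by
      rw [e5, k₃'.reg 21 (by norm_num) (by norm_num), hc]⟩) (by rw [mul_assoc])
  rw [← hz] at hT
  obtain ⟨h5, h6⟩ := hT.dominates hd.box
  refine ⟨hsol x'' hd.solvable fun i hi => ?_, fun i hi => ?_, ?_⟩
  · rw [h5 i hi, ← hd.row_eq i hi, row_add]
    ring
  · rw [row_congr i hX₃, h5 i hi]
  · rw [obj_congr hX₃]
    exact h6

theorem Data.E_le_N : P.E ≤ P.N := by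
  refine Nat.pow_le_pow_left ?_ _
  unfold B W
  have : 1 * P.K ≤ P.n * P.D * P.K :=
    Nat.mul_le_mul_right _ (Nat.mul_pos P.one_le_n P.one_le_D)
  nlinarith

theorem runs_tupleP (h : Ready P s) {t : ℕ} (ht : s.reg 20 = t) {C : ℕ → ℤ → Prop}
    (hB : Best P C s) :
    Runs w P.M tupleP s (4000 * (P.m + 1) ^ 4 * P.N * P.L) fun s' => Ready P s' ∧
      Best P (fun t' z' => C t' z' ∨ t' = t ∧ |z'| ≤ P.N) s' ∧ s'.reg 20 = t := by
  have hU' : P.adrU = P.adrα + P.n := rfl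
  have hX' : P.adrX = P.adrU + P.m := rfl
  have hY' : P.adrY = P.adrX + P.n := rfl
  have hZ' : P.adrZ = P.adrY + P.n := rfl
  have hG' : P.adrG = P.adrZ + P.n := rfl
  have hN := P.one_le_N
  have hL : 1 ≤ P.L := Nat.mul_pos P.one_le_n P.one_le_K
  have hm3 : 1 ≤ (P.m + 1) ^ 3 := Nat.one_le_pow _ _ (by omega)
  have hm4 : (P.m + 1) ^ 4 = (P.m + 1) ^ 3 * P.m + (P.m + 1) ^ 3 := by ring
  have a0 : 1 ≤ P.N * P.L := Nat.mul_pos hN hL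
  have a1 : (P.m + 1) ^ 3 * P.E * P.m ≤ (P.m + 1) ^ 3 * P.m * (P.N * P.L) := by
    calc (P.m + 1) ^ 3 * P.E * P.m = (P.m + 1) ^ 3 * P.m * (P.E * 1) := by ring
      _ ≤ _ := by gcongr; exact E_le_N
  have a2 : 1 * P.m * 1 ≤ (P.m + 1) ^ 3 * P.m * (P.N * P.L) := by gcongr
  have a3 : 1 * (P.N * P.L) ≤ (P.m + 1) ^ 3 * (P.N * P.L) := by gcongr
  have a4 : P.N * 1 ≤ P.N * P.L := by gcongr
  have a5 : 1 * ((P.m + 1) ^ 3 * P.L) ≤ P.N * ((P.m + 1) ^ 3 * P.L) := by gcongr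
  refine Runs.seq (t := 520 * ((P.m + 1) ^ 3 * P.m * (P.N * P.L)) + 5)
    (t' := 2800 * ((P.m + 1) ^ 3 * (P.N * P.L)))
    (fun s' => Ready P s' ∧ Best P C s' ∧ s'.reg 20 = t ∧
    ∀ k < P.m, arr s' P.adrU k = P.findFrom t k 0) (Runs.forDown (N := P.m)
      (tb := 500 * (P.m + 1) ^ 3 * P.E + 6) (fun c s' => Ready P s' ∧ Best P C s' ∧
        s'.reg 20 = t ∧ ∀ k < P.m, c ≤ k → arr s' P.adrU k = P.findFrom t k 0)
      (by norm_num) (by simp) (by simp) (by simpa using h.reg_m) (le_M_of_le_H m_le_H)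
      ⟨h.set (by norm_num) _, hB.keep (by simp [Store.set_reg]) (by simp [Store.set_reg])
        fun _ _ => rfl, by simp [Store.set_reg, ht], fun k h1 h2 => by omega⟩
      (fun k hk s' ⟨h1, h2, h3, h4⟩ _ => ?_)
      (fun s' ⟨h1, h2, h3, h4⟩ => ⟨h1, h2, h3, fun k hk => h4 k hk (Nat.zero_le _)⟩) ?_)
    (fun s₁ ⟨h₁, hB₁, ht₁, hU₁⟩ => ?_) ?_
  · have h1' := h1.set (r := 23) (by norm_num) k
    refine Runs.write (x := P.adrU + k) (evals_findE h1'.toParams (t := t) (k := k) le_rfl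
      (by norm_num) (by norm_num) (by simp [Store.set_reg, h3]) (by simp) hk)
      (size_of_le_H ((P.findFrom_lt t k 0).le.trans E_le_H)).abs_le_M (by simp) (by simp)
      (by simp [Store.set_reg, h1.reg_U]) ⟨⟨h1'.put (by omega) (by omega) _, h2.keep
        (by simp [Store.set_reg]) (by simp [Store.set_reg]) (fun j hj => ?_),
        by simp [Store.set_reg, h3], fun l hl hkl => ?_⟩, by simp⟩ (by simp)
    · rw [arr_put_of_ne _ _ (by omega), arr_set]
    · rw [arr_put]
      rcases hkl.eq_or_lt with rfl | hlt
      · simp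
      · rw [Function.update_of_ne (by omega)]
        exact h4 l hl hlt
  · simp only [Flat.time_var]
    nlinarith
  · refine Runs.forDown (N := 2 * P.N + 1) (tb := 900 * (P.m + 1) ^ 3 * P.L) (fun c s' =>
      Ready P s' ∧ Best P (fun t' z' => C t' z' ∨ t' = t ∧ c ≤ z' + P.N ∧ z' ≤ P.N) s' ∧
        (∀ k < P.m, arr s' P.adrU k = P.findFrom t k 0) ∧ s'.reg 20 = t)
      (by norm_num) (by simp) (by simp) (by simp [h₁.reg_N]) two_mul_N_add_one_le
      ⟨h₁.set (by norm_num) _, (hB₁.mono fun t' z' => ?_).keep (by simp [Store.set_reg])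
        (by simp [Store.set_reg]) fun _ _ => rfl, hU₁, by simp [Store.set_reg, ht₁]⟩
      (fun c hc s' ⟨h1, h2, h3, h4⟩ _ => ?_)
      (fun s' ⟨h1, h2, h3, h4⟩ => ⟨h1, h2.mono fun t' z' => ?_, h4⟩) ?_
    · rintro (h | ⟨-, h⟩)
      · exact h
      · push_cast at h; omega
    · refine (runs_candidateP (h1.set (r := 21) (by norm_num) c) (t := t) (c := c)
        (by simp [Store.set_reg, h4]) (by simp) (by omega) h3
        (h2.keep (by simp [Store.set_reg]) (by simp [Store.set_reg]) fun _ _ => rfl)).mono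
        (fun s'' ⟨e1, e2, e3, e4, e5⟩ => ⟨⟨e1, e2.mono fun t' z' => ?_, e3, e4⟩, e5⟩) le_rfl
      rintro (h | ⟨h, h'⟩)
      · exact Or.inl (Or.inl h)
      · by_cases hz : z' = c - P.N
        · exact Or.inr ⟨h, hz⟩
        · refine Or.inl (Or.inr ⟨h, ?_⟩)
          push_cast
          omega
    · rintro (h | ⟨h, h'⟩)
      · exact Or.inl h
      · rw [abs_le] at h'
        exact Or.inr ⟨h, by push_cast; omega, h'.2⟩
    · simp
      nlinarith
  · nlinarith

theorem runs_searchP (h : Ready P s) (h18 : s.reg 18 = 0) :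
    Runs w P.M searchP s (4020 * (P.m + 1) ^ 4 * P.N * P.L * P.T) fun s' => Ready P s' ∧
      Best P (fun t z => t < P.T ∧ |z| ≤ P.N) s' := by
  have hT : 1 ≤ P.T := Nat.one_le_pow _ _ P.one_le_n
  have hq : 1 ≤ (P.m + 1) ^ 4 * P.N * P.L := Nat.mul_pos (Nat.mul_pos
    (Nat.one_le_pow _ _ (by omega)) P.one_le_N) (Nat.mul_pos P.one_le_n P.one_le_K)
  refine Runs.forDown (N := P.T) (tb := 4000 * (P.m + 1) ^ 4 * P.N * P.L) (fun c s' =>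
      Ready P s' ∧ Best P (fun t' z' => c ≤ t' ∧ t' < P.T ∧ |z'| ≤ P.N) s')
      (by norm_num) (by simp) (by simp) (by simpa using h.reg_T) (le_M_of_le_H T_le_H)
      ⟨h.set (by norm_num) _, ⟨Or.inl (by simp [Store.set_reg, h18]), fun t' x' x'' hc => ?_⟩⟩
      (fun c hc s' ⟨h1, h2⟩ _ => ?_)
      (fun s' ⟨h1, h2⟩ => ⟨h1, h2.mono fun t' z' h => ⟨Nat.zero_le _, h⟩⟩) ?_
  · omega
  · refine (runs_tupleP (h1.set (r := 20) (by norm_num) c) (t := c) (by simp)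
      (h2.keep (by simp [Store.set_reg]) (by simp [Store.set_reg]) fun _ _ => rfl)).mono
      (fun s'' ⟨e1, e2, e3⟩ => ⟨⟨e1, e2.mono fun t' z' h => ?_⟩, e3⟩) le_rfl
    by_cases hct : t' = c
    · exact Or.inr ⟨hct, h.2.2⟩
    · exact Or.inl ⟨by omega, h.2⟩
  · simp only [Flat.time_var]
    have h2 : 1 * P.T ≤ (P.m + 1) ^ 4 * P.N * P.L * P.T := Nat.mul_le_mul_right _ hq
    nlinarith

end

/-! ### The program: parameters and final answer -/

/-- The largest absolute value of the coefficients of the constraints, and at least `1`. -/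
def maxE : Expr :=
  foldE (.var 0 * .var 1) (.lit 1) fun x i => letE (Flat.load (.var i)).code fun y =>
    (Flat.ite (.var y - .var x) (.var y)
      (.ite (.lit 0 - .var y - .var x) (.lit 0 - .var y) (.var x))).code

/-- The sum of the absolute values of the objective coefficients. -/
def cSumE : Expr :=
  sumE (.var 1) fun j => letE (Flat.load (.var 0 * .var 1 + .var 0 + .var j)).code fun y =>
    (Flat.ite (.var y) (.var y) (.lit 0 - .var y)).code

/-- The computation of the parameters. -/
def paramsP : Prog :=
  .seq (assign 2 maxE)
  (.seq (assign 3 (Flat.var 1 * .var 2).code)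
  (.seq (assign 3 (powE 3 0))
  (.seq (assign 4 (.lit 2 * .var 1 * .var 2 * .var 3 + .lit 1 : Flat).code)
  (.seq (assign 5 (powE 4 0))
  (.seq (assign 17 (Flat.var 1 * .var 3).code)
  (.seq (assign 6 (Flat.var 17 + .lit 1).code)
  (.seq (assign 7 cSumE)
  (.seq (assign 7 (.lit 1 + .var 17 * .var 7 : Flat).code)
  (.seq (assign 9 (.var 0 * .var 1 + .var 0 + .var 1 : Flat).code)
  (.seq (assign 8 (Flat.var 9 + .var 1).code)
  (.seq (assign 10 (Flat.var 8 + .var 0).code)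
  (.seq (assign 11 (Flat.var 10 + .var 1).code)
  (.seq (assign 12 (Flat.var 11 + .var 1).code)
  (.seq (assign 13 (Flat.var 12 + .var 1).code)
  (.seq (assign 16 (.lit 2 * .var 3 + .lit 1 : Flat).code)
  (.seq (assign 14 (powE 16 0))
    (assign 15 (powE 1 0))))))))))))))))))

/-- The computation of the encoded columns and of the first layer of the table. -/
def columnsP : Prog :=
  .seq (forDown 23 (.var 1) (write (.var 9 + .var 23) (alphaE 23)))
    (write (.var 13 + .lit 2 * .var 5 * .var 6) (Flat.var 7).code)

/-- Write the answer to the places where it is expected. -/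
def answerP : Prog :=
  cond (Flat.var 18).code
    (cond (Flat.load (.var 13 + .var 17 + .lit 2 * .var 5 * .var 6) - .var 7).code
      (assign 0 (Flat.lit 1).code)
      (.seq (forDown 23 (.var 1) (write (.var 23) (entry 12 23).code))
        (assign 0 (Flat.lit 2).code)))
    (assign 0 (Flat.lit 0).code)

/-- The program that solves integer programs. -/
def solver : Prog := .seq paramsP (.seq columnsP (.seq tableP (.seq searchP answerP)))

section
variable {w : ℕ} {P : Data} [hC : Capacity w P.M] {s : Store}

theorem evals_maxE (h : Input P s)
    (hD : P.D = max 1 ((Finset.Ico 0 (P.m * P.n)).sup fun k => (s.mem k).natAbs)) :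
    Evals w P.M 32 maxE s P.D (40 * (P.m * P.n) + 10) := by
  set g : ℕ → ℕ := fun c => max 1 ((Finset.Ico c (P.m * P.n)).sup fun k => (s.mem k).natAbs)
    with hg
  have hgD : ∀ c, g c ≤ P.D := fun c => by
    rw [hD]
    exact max_le_max le_rfl (Finset.sup_mono (Finset.Ico_subset_Ico_left (Nat.zero_le _)))
  have hgM : ∀ c, |(g c : ℤ)| ≤ P.M := fun c => (size_of_le_H ((hgD c).trans D_le_H)).abs_le_M
  have hs : ∀ c < P.m * P.n, g c = max (g (c + 1)) (s.mem c).natAbs := fun c hc => by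
    simp only [hg]
    rw [← Finset.insert_Ico_add_one_left_eq_Ico hc, Finset.sup_insert, max_assoc]
    congr 1
    exact sup_comm _ _
  have := Evals.foldE (w := w) (M := P.M) (d := 32) (s := s) (n := .var 0 * .var 1) (e := .lit 1)
    (f := fun x i => letE (Flat.load (.var i)).code fun y =>
    (Flat.ite (.var y - .var x) (.var y)
      (.ite (.lit 0 - .var y - .var x) (.lit 0 - .var y) (.var x))).code)
    (N := P.m * P.n) (g := fun c => g c) (tb := 30) (T := 40 * (P.m * P.n) + 10)
    (by simp) (by simp) (by simp [h.reg_m, h.reg_n])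
    ((le_abs_self _).trans (by
      push_cast
      exact ((size_of_le_H m_le_H).mul (size_of_le_H n_le_H)).abs_le_M))
    (by simp) (by simp) (by simp [hg]) (fun c _ => hgM c)
    (fun c hc => by
      have h1 : |s.mem c| ≤ g c := by
        rw [hs c hc, ← Int.natCast_natAbs]
        exact_mod_cast le_max_right _ _
      refine Evals.letE (v := s.mem c) (t := 3) (t' := 24) (Evals.flat (by simp) (by simp)
        (by simp) (by simp)) (h1.trans ((le_abs_self _).trans (hgM c)))
        (Evals.flat (by simp) (by simp) ?_ (by simp)) (hgM c) (by norm_num)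
      simp (disch := omega) only [Flat.eval_ite, Flat.eval_sub, Flat.eval_var, Flat.eval_lit,
        Store.set_reg_ne, Store.set_reg_self]
      rw [hs c hc]
      push_cast
      have h2 : (1 : ℤ) ≤ g (c + 1) := by exact_mod_cast le_max_left _ _
      split_ifs with h3 h4
      · rw [abs_of_pos (by omega), max_eq_right (by omega)]
      · rw [abs_of_neg (by omega), max_eq_right (by omega)]
        ring
      · rw [max_eq_left]
        rw [abs_le]
        omega)
    (by simp; omega)
  simp only [hg, ← hD] at this
  exact this

theorem evals_cSumE (h : Input P s) : Evals w P.M 32 cSumE s P.cSum (50 * P.n) := by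
  have := evals_sumE (w := w) (d := 32) (s := s) (n := .var 1)
    (f := fun j => letE (Flat.load (.var 0 * .var 1 + .var 0 + .var j)).code fun y =>
    (Flat.ite (.var y) (.var y) (.lit 0 - .var y)).code) (N := P.n) (k := 1)
    (v := fun j => |P.c j|) (tb := 30) (T := 50 * P.n) (by simp) (by simp) (by simp [h.reg_n])
    n_le_H (fun j hj => by simpa [Size] using size_c hj) (by norm_num)
    (fun j hj x => by
      refine Evals.letE (v := P.c j) (t := 12) (t' := 9) (Evals.flat (by simp) (by simp) ?_
        (by simp)) (size_c hj).abs_le_M (Evals.flat (by simp) (by simp) ?_ (by simp))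
        (by rw [abs_abs]; exact (size_c hj).abs_le_M) (by norm_num)
      · simp (disch := omega) only [Flat.eval_load, Flat.eval_add, Flat.eval_mul, Flat.eval_var,
          Store.set_reg_ne, Store.set_reg_self, h.reg_m, h.reg_n, Store.set_mem, h.mem_c j hj]
      · simp only [Flat.eval_ite, Flat.eval_sub, Flat.eval_var, Flat.eval_lit,
          Store.set_reg_self, zero_sub]
        split_ifs with h1
        · rw [abs_of_pos h1]
        · rw [abs_of_nonpos (not_lt.1 h1)])
    (by simp; have := P.one_le_n; omega)
  simpa [cSum, cSumE] using this

theorem size_of_le_adrG {x : ℕ} (hx : x ≤ P.adrG) : P.Size 5 x := by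
  refine size_natCast (hx.trans ?_)
  unfold adrG adrZ adrY adrX adrU adrα
  have hm := P.m_le_H
  have hn := P.n_le_H
  have h2 := P.two_le_H
  have h1 : P.m * P.n ≤ P.H * P.H := Nat.mul_le_mul hm hn
  have h3 : 1 * P.H ≤ P.H * P.H := Nat.mul_le_mul_right _ (by omega)
  calc P.m * P.n + P.m + P.n + P.n + P.m + P.n + P.n + P.n ≤ 8 * (P.H * P.H) := by linarith
    _ = (2 * 2 * 2) * (P.H * P.H) := by ring
    _ ≤ (P.H * P.H * P.H) * (P.H * P.H) := by gcongr
    _ = P.H ^ 5 := by ring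

theorem runs_paramsP (h : Input P s)
    (hD : P.D = max 1 ((Finset.Ico 0 (P.m * P.n)).sup fun k => (s.mem k).natAbs)) :
    Runs w P.M paramsP s (500 * ((P.m + 1) * P.n)) fun s' => Params P s' ∧
      s'.mem = s.mem ∧ s'.reg 18 = s.reg 18 := by
  have hU : P.adrU = P.adrα + P.n := rfl
  have hX : P.adrX = P.adrU + P.m := rfl
  have hY : P.adrY = P.adrX + P.n := rfl
  have hZ : P.adrZ = P.adrY + P.n := rfl
  have hG : P.adrG = P.adrZ + P.n := rfl
  have hm := h.reg_m
  have hn := h.reg_n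
  have hn1 := P.one_le_n
  have hD1 := P.one_le_D
  have hB1 : 1 ≤ P.B := by unfold B; omega
  have hW1 : 1 ≤ P.W := by unfold W; omega
  have hmn : P.m * 1 ≤ P.m * P.n := Nat.mul_le_mul_left _ hn1
  have hT : (P.m + 1) * P.n = P.m * P.n + P.n := by ring
  refine Runs.assign_seq (t' := 400 * P.m + 440 * P.n) (evals_maxE h hD) (by norm_num)
    (size_of_le_H D_le_H).abs_le_M ?_ (by omega)
  refine Runs.assign_seq (v := (P.n * P.D : ℕ)) (t := 5) (t' := 400 * P.m + 430 * P.n)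
    (Evals.flat (by simp) (by simp) (by simp [Store.set_reg, hn]) (by simp)) (by norm_num) ?_ ?_
    (by omega)
  · push_cast
    exact ((size_of_le_H n_le_H).mul (size_of_le_H D_le_H)).abs_le_M
  refine Runs.assign_seq (v := P.K) (t' := 300 * P.m + 420 * P.n)
    (evals_powE (x := P.n * P.D) (k := P.m) (by norm_num) (by norm_num) (by simp)
      (by simp [Store.set_reg, hm]) (le_M_of_le_H m_le_H) (Nat.mul_pos hn1 hD1)
      (le_M_of_le_H K_le_H)) (by norm_num) (size_of_le_H K_le_H).abs_le_M ?_ (by omega)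
  refine Runs.assign_seq (v := P.W) (t := 15) (t' := 300 * P.m + 400 * P.n)
    (Evals.flat (by simp) (by simp) (by simp [Store.set_reg, hn, W]) (by simp)) (by norm_num)
    (size_of_le_H W_le_H).abs_le_M ?_ (by omega)
  refine Runs.assign_seq (v := P.N) (t' := 200 * P.m + 390 * P.n)
    (evals_powE (x := P.W) (k := P.m) (by norm_num) (by norm_num) (by simp)
      (by simp [Store.set_reg, hm]) (le_M_of_le_H m_le_H) hW1
      (le_M_of_le_H N_le_H)) (by norm_num) (size_of_le_H N_le_H).abs_le_M ?_ (by omega)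
  refine Runs.assign_seq (v := P.L) (t := 5) (t' := 200 * P.m + 380 * P.n)
    (Evals.flat (by simp) (by simp) (by simp [Store.set_reg, hn, L]) (by simp)) (by norm_num)
    (size_of_le_H L_le_H).abs_le_M ?_ (by omega)
  refine Runs.assign_seq (v := P.L + 1) (t := 4) (t' := 200 * P.m + 370 * P.n)
    (Evals.flat (by simp) (by simp) (by simp) (by simp)) (by norm_num)
    ((size_of_le_H L_le_H).add (size_one.mono (by norm_num))).abs_le_M ?_ (by omega)
  refine Runs.assign_seq (v := P.cSum) (t' := 200 * P.m + 310 * P.n)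
    (evals_cSumE (((((((h.set (by norm_num) _).set (by norm_num) _).set (by norm_num) _).set
      (by norm_num) _).set (by norm_num) _).set (by norm_num) _).set (by norm_num) _))
    (by norm_num) (size_of_le_H cSum_le_H).abs_le_M ?_ (by omega)
  refine Runs.assign_seq (v := P.big) (t := 7) (t' := 200 * P.m + 300 * P.n)
    (Evals.flat (by simp) (by simp) (by simp [Store.set_reg, big]) (by simp)) (by norm_num)
    (size_of_le_H big_le_H).abs_le_M ?_ (by omega)
  refine Runs.assign_seq (v := P.adrα) (t := 11) (t' := 200 * P.m + 280 * P.n)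
    (Evals.flat (by simp) (by simp) (by simp [Store.set_reg, hm, hn, adrα]) (by simp))
    (by norm_num) (size_of_le_adrG (by omega)).abs_le_M ?_ (by omega)
  refine Runs.assign_seq (v := P.adrU) (t := 5) (t' := 200 * P.m + 270 * P.n)
    (Evals.flat (by simp) (by simp) (by simp [Store.set_reg, hn, adrU]) (by simp))
    (by norm_num) (size_of_le_adrG (by omega)).abs_le_M ?_ (by omega)
  refine Runs.assign_seq (v := P.adrX) (t := 5) (t' := 200 * P.m + 260 * P.n)
    (Evals.flat (by simp) (by simp) (by simp [Store.set_reg, hm, adrX]) (by simp))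
    (by norm_num) (size_of_le_adrG (by omega)).abs_le_M ?_ (by omega)
  refine Runs.assign_seq (v := P.adrY) (t := 5) (t' := 200 * P.m + 250 * P.n)
    (Evals.flat (by simp) (by simp) (by simp [Store.set_reg, hn, adrY]) (by simp))
    (by norm_num) (size_of_le_adrG (by omega)).abs_le_M ?_ (by omega)
  refine Runs.assign_seq (v := P.adrZ) (t := 5) (t' := 200 * P.m + 240 * P.n)
    (Evals.flat (by simp) (by simp) (by simp [Store.set_reg, hn, adrZ]) (by simp))
    (by norm_num) (size_of_le_adrG (by omega)).abs_le_M ?_ (by omega)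
  refine Runs.assign_seq (v := P.adrG) (t := 5) (t' := 200 * P.m + 230 * P.n)
    (Evals.flat (by simp) (by simp) (by simp [Store.set_reg, hn, adrG]) (by simp))
    (by norm_num) (size_of_le_adrG le_rfl).abs_le_M ?_ (by omega)
  refine Runs.assign_seq (v := P.B) (t := 6) (t' := 200 * P.m + 220 * P.n)
    (Evals.flat (by simp) (by simp) (by simp [Store.set_reg, B]) (by simp))
    (by norm_num) (size_of_le_H B_le_H).abs_le_M ?_ (by omega)
  refine Runs.assign_seq (v := P.E) (t' := 100 * P.m + 210 * P.n)
    (evals_powE (x := P.B) (k := P.m) (by norm_num) (by norm_num) (by simp)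
      (by simp [Store.set_reg, hm]) (le_M_of_le_H m_le_H) hB1
      (le_M_of_le_H E_le_H)) (by norm_num) (size_of_le_H E_le_H).abs_le_M ?_ (by omega)
  refine Runs.assign (v := P.T)
    (evals_powE (x := P.n) (k := P.m) (by norm_num) (by norm_num) (by simp [Store.set_reg, hn])
      (by simp [Store.set_reg, hm]) (le_M_of_le_H m_le_H) hn1
      (le_M_of_le_H T_le_H)) (by norm_num) (size_of_le_H T_le_H).abs_le_M
    ⟨⟨⟨?_, ?_, h.mem_a, h.mem_b, h.mem_c⟩, ?_, ?_, ?_, ?_, ?_, ?_, ?_, ?_, ?_, ?_, ?_, ?_, ?_, ?_,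
      ?_, ?_⟩, rfl, ?_⟩ (by omega) <;> simp [Store.set_reg, hm, hn]

theorem runs_columnsP (h : Params P s) (h0 : ∀ x : ℤ, P.adrα ≤ x → s.mem x = 0) :
    Runs w P.M columnsP s (100 * ((P.m + 1) * P.n)) fun s' =>
      Table P (P.partialG 0 (2 * P.N + 1)) s' ∧ s'.reg 18 = s.reg 18 := by
  have hα := P.adrα_add_le_adrG
  have hn1 := P.one_le_n
  have hL : 1 ≤ P.L := Nat.mul_pos P.one_le_n P.one_le_K
  have hT : (P.m + 1) * P.n = P.m * P.n + P.n := by ring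
  refine Runs.seq (t := 5 + P.n * (50 * (P.m + 1) + 13)) (t' := 20)
    (fun s' => Params P s' ∧ (∀ j < P.n, s'.mem (P.adrα + j) = P.α j) ∧
      (∀ x : ℤ, P.adrα + P.n ≤ x → s'.mem x = 0) ∧ s'.reg 18 = s.reg 18)
    (Runs.forDown (N := P.n) (tb := 50 * (P.m + 1) + 6) (fun c s' => Params P s' ∧
      (∀ j < P.n, c ≤ j → s'.mem (P.adrα + j) = P.α j) ∧
      (∀ x : ℤ, P.adrα + P.n ≤ x → s'.mem x = 0) ∧ s'.reg 18 = s.reg 18)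
      (by norm_num) (by simp) (by simp) (by simpa using h.reg_n) (le_M_of_le_H n_le_H)
      ⟨h.set (by norm_num) _, fun j h1 h2 => by omega, fun x hx => h0 x (by omega),
        by simp [Store.set_reg]⟩
      (fun c hc s' ⟨h1, h2, h3, h4⟩ _ => ?_)
      (fun s' ⟨h1, h2, h3, h4⟩ => ⟨h1, fun j hj => h2 j hj (Nat.zero_le _), h3, h4⟩)
      (by simp))
    (fun s₁ ⟨h1, h2, h3, h4⟩ => ?_) (by nlinarith)
  · refine Runs.write (x := P.adrα + c) (evals_alphaE (h1.set (by norm_num) _) le_rfl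
      (by norm_num) (by simp) hc) (size_α c).abs_le_M (by simp) (by simp)
      (by simp [Store.set_reg, h1.reg_α]) ⟨⟨(h1.set (by norm_num) _).put (by omega) _,
        fun j hj hcj => ?_, fun x hx => ?_, by simp [Store.set_reg, h4]⟩, by simp⟩ (by simp)
    · rcases hcj.eq_or_lt with rfl | hlt
      · simp
      · rw [Store.put_mem_ne _ _ (by omega)]
        exact h2 j hj hlt
    · rw [Store.put_mem_ne _ _ (by omega)]
      exact h3 x hx
  · have hz : -(2 * P.N : ℤ) ≤ 0 := by omega
    refine Runs.write (x := P.pos 0 0) (v := P.big) (t := 2) (Evals.flat (by simp) (by simp)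
      (by simpa using h1.reg_big) (by simp)) (size_of_le_H big_le_H).abs_le_M (by simp) (by simp)
      (by simp [h1.reg_G, h1.reg_N, h1.reg_L1, pos]) ⟨?_, by simpa using h4⟩ (by simp)
    have h5 : Table P (fun _ _ => 0) s₁ := ⟨h1, h2, fun l _ z hz => h3 _ (by
      have := P.adrG_le_pos (l := l) hz
      omega)⟩
    refine h5.put (Nat.zero_le _) hz ?_ fun l' z' hne _ => ?_
    · simp [partialG, G]
    · unfold partialG
      split_ifs with hif
      · by_cases hl : l' = 0
        · subst hl
          rw [G, if_neg fun h => hne ⟨rfl, h⟩]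
        · obtain rfl : l' = 1 := by omega
          refine G_eq_zero hL ?_
          replace hif := hif.resolve_left (by omega)
          have h6 := hif.2
          push_cast at h6
          rw [abs_of_nonneg] <;> omega
      · rfl

/-- The answer `k` and the point `x` are correct. -/
def Data.Correct (P : Data) (k : ℤ) (x : ℕ → ℤ) : Prop :=
  (k = 0 ∧ ¬ ∃ y, P.Feasible y) ∨
  (k = 1 ∧ ∀ M : ℤ, ∃ y, P.Feasible y ∧ M < P.obj y) ∨
  (k = 2 ∧ P.Feasible x ∧ ∀ y, P.Feasible y → P.obj y ≤ P.obj x)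

/-- Multiples of a kernel vector that improves the objective may be added to a feasible point. -/
theorem Data.unbounded_of_big_lt (h : P.big < P.G P.L 0) {x : ℕ → ℤ} (hx : P.Feasible x) (M : ℤ) :
    ∃ y, P.Feasible y ∧ M < P.obj y := by
  obtain ⟨y, h1, h2, h3⟩ := exists_of_big_lt h
  obtain ⟨k, hk⟩ : ∃ k : ℤ, k = |M - P.obj x| + 1 := ⟨_, rfl⟩
  have hk0 : 0 ≤ k := by have := abs_nonneg (M - P.obj x); omega
  refine ⟨fun j => x j + k * y j, ⟨fun j hj => ?_, fun i hi => ?_⟩, ?_⟩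
  · exact add_nonneg (hx.1 j hj) (mul_nonneg hk0 (h1 j hj))
  · rw [row_add, hx.2 i hi]
    have : P.row i (fun j => k * y j) = k * P.row i y := by
      simp only [row, Finset.mul_sum]
      exact Finset.sum_congr rfl fun _ _ => by ring
    rw [this, h2 i hi, mul_zero, add_zero]
  · rw [obj_add]
    have : P.obj (fun j => k * y j) = k * P.obj y := by
      simp only [obj, Finset.mul_sum]
      exact Finset.sum_congr rfl fun _ _ => by ring
    rw [this]
    nlinarith [le_abs_self (M - P.obj x)]

theorem Data.Decomp.abs_code_le {t : ℕ} {x' x'' : ℕ → ℤ} (h : P.Decomp t x' x'') :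
    |P.code x'| ≤ P.N := (P.abs_lt_of_G_pos le_rfl (le_G_of_le_K h.box).2).le

/-- A feasible point is found if there is one, by the decomposition for the objective `0`. The
program is then unbounded if a kernel vector improves the objective, which the last layer of the
table shows; otherwise the best point is optimal, by the decomposition for the objective `c`. -/
theorem runs_answerP (h : Ready P s) (hB : Best P (fun t z => t < P.T ∧ |z| ≤ P.N) s) :
    Runs w P.M answerP s (60 * P.n) fun s' => P.Correct (s'.reg 0) (arr s' 0) := by
  have hn := P.one_le_n
  have hZ : P.n ≤ P.adrZ := by
    unfold adrZ adrY adrX adrU adrα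
    omega
  have hZ' : P.adrG = P.adrZ + P.n := rfl
  have hsize := size_of_le_adrG (P := P) le_rfl
  have hle : ∀ {t x' x''}, t < P.T → P.Decomp t x' x'' → s.reg 18 = 1 ∧
      P.obj (fun j => x' j + x'' j) ≤ s.reg 19 :=
    fun {t x' x''} ht hd => hB.le t x' x'' ⟨ht, hd.abs_code_le⟩ hd
  refine Runs.cond (v := s.reg 18) (te := 2) (t := 55 * P.n) (Evals.flat (by simp) (by simp)
    (by simp) (by simp)) (fun h18 => ?_) (fun h18 => ?_) (by omega)
  · obtain ⟨-, hf, ho⟩ := hB.found.resolve_left (by omega)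
    have hlast : s.mem (P.pos P.L 0) = P.G P.L 0 := h.mem_G _ le_rfl 0 (by omega)
    refine Runs.cond (v := P.G P.L 0 - P.big) (te := 17) (t := 29 * P.n)
      (Evals.flat (by simp) (by simp) ?_ (by simp)) (fun hp => ?_) (fun hp => ?_) (by omega)
    · rw [← hlast]
      simp [h.reg_G, h.reg_N, h.reg_L1, h.reg_L, h.reg_big, pos]
    · refine Runs.assign (v := 1) (t := 1) (Evals.flat (by simp) (by simp) (by simp) (by simp))
        (by norm_num) (size_one.abs_le_M) (Or.inr (Or.inl ⟨by simp, fun M => ?_⟩)) (by omega)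
      exact unbounded_of_big_lt (by omega) hf M
    · refine Runs.seq (t := 5 + P.n * 20) (t' := 3) (fun s' => ∀ j < P.n, arr s' 0 j =
        arr s P.adrZ j) (Runs.forDown (N := P.n) (tb := 13) (fun c s' => s'.reg 12 = P.adrZ ∧
        (∀ j < P.n, arr s' P.adrZ j = arr s P.adrZ j) ∧
        ∀ j < P.n, c ≤ j → arr s' 0 j = arr s P.adrZ j)
        (by norm_num) (by simp) (by simp) (by simpa using h.reg_n) (le_M_of_le_H n_le_H)
        ⟨by simpa [Store.set_reg] using h.reg_Z, fun _ _ => rfl, fun j h1 h2 => by omega⟩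
        (fun c hc s' ⟨h1, h2, h3⟩ _ => ?_) (fun s' ⟨h1, h2, h3⟩ j hj => h3 j hj (Nat.zero_le _))
        (by simp)) (fun s' hs' => ?_) (by omega)
      · intro hb
        have hbm := hb.2 (P.adrZ + c)
        refine Runs.write (x := c) (v := arr s' P.adrZ c) (t := 6) (Evals.flat (by simp [entry])
          (by simp [entry]) (by simp [entry, Store.set_reg, h1, arr]) (by simp [entry])) hbm
          (by simp) (by simp) (by simp) ⟨⟨by simpa [Store.set_reg] using h1, fun j hj => ?_,
          fun j hj hcj => ?_⟩, by simp⟩ (by simp) hb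
        · rw [arr_put_of_ne _ _ (by omega), ← h2 j hj]
          rfl
        · rcases hcj.eq_or_lt with rfl | hlt
          · rw [← h2 c hj]
            simp [arr]
          · rw [arr_put_of_ne _ _ (by push_cast; omega), ← h3 j hj hlt]
            rfl
      · refine Runs.assign (v := 2) (t := 1) (Evals.flat (by simp) (by simp) (by simp) (by simp))
          (by norm_num) ?_ (Or.inr (Or.inr ⟨by simp, ?_, fun y hy => ?_⟩)) (by omega)
        · exact Size.abs_le_M (k := 1) (by simpa [Size] using P.two_le_H)
        · exact hf.congr fun j hj => hs' j hj
        · obtain ⟨t, ht, x', x'', hd, hle'⟩ := exists_decomp P.c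
            (fun z hz hrow => obj_nonpos_of_le (by omega) hz hrow) hy
          refine hle'.trans ((hle ht hd).2.trans ?_)
          rw [← ho]
          exact (obj_congr fun j hj => hs' j hj).ge
  · refine Runs.assign (v := 0) (t := 1) (Evals.flat (by simp) (by simp) (by simp) (by simp))
      (by norm_num) (size_zero.abs_le_M) (Or.inl ⟨by simp, ?_⟩) (by omega)
    rintro ⟨x, hx⟩
    obtain ⟨t, ht, x', x'', hd, -⟩ := exists_decomp (fun _ => 0) (fun _ _ _ => by simp) hx
    have := (hle ht hd).1
    omega

theorem runs_solver (h : Input P s)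
    (hD : P.D = max 1 ((Finset.Ico 0 (P.m * P.n)).sup fun k => (s.mem k).natAbs))
    (h0 : ∀ x : ℤ, P.adrα ≤ x → s.mem x = 0) (h18 : s.reg 18 = 0) :
    Runs w P.M solver s (6000 * ((P.m + 1) ^ 4 * P.N * P.L * P.T)) fun s' =>
      P.Correct (s'.reg 0) (arr s' 0) := by
  have hT : 1 ≤ P.T := Nat.one_le_pow _ _ P.one_le_n
  have hN := P.one_le_N
  have hL : P.n ≤ P.L := Nat.le_mul_of_pos_right _ P.one_le_K
  have hn := P.one_le_n
  have hm : P.m + 1 ≤ (P.m + 1) ^ 4 := Nat.le_self_pow (by norm_num) _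
  have hm1 : 1 ≤ (P.m + 1) ^ 4 := by omega
  set q := (P.m + 1) ^ 4 * P.N * P.L * P.T with hq
  have a1 : (P.m + 1) * P.n ≤ q := by
    calc (P.m + 1) * P.n = (P.m + 1) * 1 * P.n * 1 := by ring
      _ ≤ q := by rw [hq]; gcongr
  have a2 : P.N * P.L ≤ q := by
    calc P.N * P.L = 1 * P.N * P.L * 1 := by ring
      _ ≤ q := by rw [hq]; gcongr
  have a3 : 4020 * (P.m + 1) ^ 4 * P.N * P.L * P.T = 4020 * q := by rw [hq]; ring
  have a4 : 1 ≤ P.N * P.L := Nat.mul_pos hN (by omega)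
  have a5 : 1 * P.n ≤ (P.m + 1) * P.n := Nat.mul_le_mul_right _ (by omega)
  refine Runs.seq (t' := 5400 * q) _ (runs_paramsP h hD) (fun s₁ ⟨h1, h1m, h1r⟩ => ?_) (by omega)
  refine Runs.seq (t' := 5200 * q) _ (runs_columnsP h1 fun x hx => by rw [h1m]; exact h0 x hx)
    (fun s₂ ⟨h2, h2r⟩ => ?_) (by omega)
  refine Runs.seq (t' := 4100 * q) _ (runs_tableP h2)
    (fun s₃ ⟨h3, h3r⟩ => ?_) (by rw [mul_assoc]; omega)
  refine Runs.seq (t' := 60 * q) _ (runs_searchP h3 (by rw [h3r, h2r, h1r, h18]))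
    (fun s₄ ⟨h4, hB⟩ => ?_) (by omega)
  exact (runs_answerP h4 hB).mono (fun _ h => h) (by omega)

end

/-! ### The data in the initial storage -/

section
variable {m n : ℕ} (A : Matrix (Fin m) (Fin n) ℤ) (b : Fin m → ℤ) (c : Fin n → ℤ)

theorem length_inputList : (inputList A b c).length = m * n + m + n := by
  simp [inputList, add_assoc]

theorem initial_mem_natCast (k : ℕ) :
    (initial A b c).mem k = (inputList A b c).getD k 0 := by
  simp [initial]

theorem initial_mem_divNat (k : Fin (m * n)) :
    (initial A b c).mem (k : ℕ) = A k.divNat k.modNat := by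
  rw [initial_mem_natCast, List.getD_eq_getElem _ _ (by rw [length_inputList]; omega)]
  simp only [inputList, List.append_assoc]
  rw [List.getElem_append_left (by simp)]
  simp

theorem initial_mem_a (i : Fin m) (j : Fin n) : (initial A b c).mem (i * n + j : ℕ) = A i j := by
  have h := initial_mem_divNat A b c (finProdFinEquiv (i, j))
  have h1 : (finProdFinEquiv (i, j)).divNat = i ∧ (finProdFinEquiv (i, j)).modNat = j := by
    have := finProdFinEquiv.symm_apply_apply (i, j)
    rwa [finProdFinEquiv_symm_apply, Prod.mk.injEq] at this
  rw [h1.1, h1.2] at h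
  rw [← h]
  congr 2
  simp [finProdFinEquiv]
  ring

theorem initial_mem_b (i : Fin m) : (initial A b c).mem (m * n + i : ℕ) = b i := by
  rw [initial_mem_natCast, List.getD_eq_getElem _ _ (by rw [length_inputList]; omega)]
  simp only [inputList, List.append_assoc]
  rw [List.getElem_append_right (by simp), List.getElem_append_left (by simp)]
  simp

theorem initial_mem_c (j : Fin n) : (initial A b c).mem (m * n + m + j : ℕ) = c j := by
  rw [initial_mem_natCast, List.getD_eq_getElem _ _ (by rw [length_inputList]; omega)]
  simp only [inputList]
  rw [List.getElem_append_right (by simp)]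
  simp

theorem initial_mem_of_le {x : ℤ} (hx : ((m * n + m + n : ℕ) : ℤ) ≤ x) :
    (initial A b c).mem x = 0 := by
  obtain ⟨k, rfl⟩ := Int.eq_ofNat_of_zero_le ((Int.natCast_nonneg _).trans hx)
  rw [initial_mem_natCast, List.getD_eq_default]
  rw [length_inputList]
  exact_mod_cast hx

/-- The largest absolute value of the entries of `A`, and at least `1`. -/
def maxEntry : ℕ := max 1 ((Finset.Ico 0 (m * n)).sup fun k => ((initial A b c).mem k).natAbs)

theorem natAbs_le_maxEntry (i : Fin m) (j : Fin n) : (A i j).natAbs ≤ maxEntry A b c := by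
  refine le_trans ?_ (le_max_right _ _)
  rw [← initial_mem_a A b c]
  refine Finset.le_sup (f := fun k : ℕ => ((initial A b c).mem k).natAbs) (Finset.mem_Ico.2
    ⟨Nat.zero_le _, ?_⟩)
  have : (i + 1) * n ≤ m * n := Nat.mul_le_mul_right _ i.2
  rw [add_mul] at this
  omega

theorem maxEntry_le {Δ : ℕ} (hΔ : 1 ≤ Δ) (h : ∀ i j, (A i j).natAbs ≤ Δ) :
    maxEntry A b c ≤ Δ := by
  refine max_le hΔ (Finset.sup_le fun k hk => ?_)
  rw [initial_mem_divNat A b c ⟨k, (Finset.mem_Ico.1 hk).2⟩]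
  exact h _ _

/-- The data of an integer program with indices in `Fin m` and `Fin n`. -/
def toData (hn : 1 ≤ n) : Data where
  m := m
  n := n
  D := maxEntry A b c
  a i j := if h : i < m ∧ j < n then A ⟨i, h.1⟩ ⟨j, h.2⟩ else 0
  b i := if h : i < m then b ⟨i, h⟩ else 0
  c j := if h : j < n then c ⟨j, h⟩ else 0
  one_le_n := hn
  one_le_D := le_max_left _ _
  abs_a_le i j := by
    split_ifs with h
    · rw [← Int.natCast_natAbs]
      exact_mod_cast natAbs_le_maxEntry A b c _ _
    · simp

variable (hn : 1 ≤ n)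

theorem toData_row (i : Fin m) (x : ℕ → ℤ) :
    (toData A b c hn).row i x = A.mulVec (fun j => x j) i := by
  simp [row, toData, Matrix.mulVec, dotProduct, Finset.sum_range]

theorem toData_obj (x : ℕ → ℤ) :
    (toData A b c hn).obj x = dotProduct c (fun j => x j) := by
  simp [obj, toData, dotProduct, Finset.sum_range]

theorem toData_feasible (x : ℕ → ℤ) :
    (toData A b c hn).Feasible x ↔ IsFeasible A b (fun j => x j) := by
  constructor
  · rintro ⟨h1, h2⟩
    refine ⟨funext fun i => ?_, fun j => h1 j j.2⟩
    rw [← toData_row A b c hn, h2 i i.2]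
    simp [toData]
  · rintro ⟨h1, h2⟩
    refine ⟨fun j hj => h2 ⟨j, hj⟩, fun i hi => ?_⟩
    have := congrFun h1 ⟨i, hi⟩
    rw [← toData_row A b c hn] at this
    rw [this]
    have hi' : i < m := hi
    simp [toData, hi']

theorem exists_extension (y : Fin n → ℤ) : ∃ x : ℕ → ℤ, (fun j : Fin n => x j) = y :=
  ⟨fun j => if h : j < n then y ⟨j, h⟩ else 0, funext fun j => by simp⟩

theorem isAnswer_of_correct {s : Store}
    (h : (toData A b c hn).Correct (s.reg 0) (arr s 0)) : IsAnswer A b c s := by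
  have harr : (fun j : Fin n => arr s 0 j) = fun j : Fin n => s.mem (j : ℕ) := by
    ext j
    simp [arr]
  rcases h with ⟨h1, h2⟩ | ⟨h1, h2⟩ | ⟨h1, h2, h3⟩
  · refine Or.inl ⟨h1, fun ⟨y, hy⟩ => h2 ?_⟩
    obtain ⟨x, rfl⟩ := exists_extension y
    exact ⟨x, (toData_feasible A b c hn x).2 hy⟩
  · refine Or.inr (Or.inl ⟨h1, fun M => ?_⟩)
    obtain ⟨x, hx, hM⟩ := h2 M
    exact ⟨_, (toData_feasible A b c hn x).1 hx, by rwa [toData_obj] at hM⟩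
  · refine Or.inr (Or.inr ⟨h1, ?_⟩)
    rw [toData_feasible, harr] at h2
    refine ⟨h2, fun y hy => ?_⟩
    obtain ⟨x, rfl⟩ := exists_extension y
    have := h3 x ((toData_feasible A b c hn x).2 hy)
    rwa [toData_obj, toData_obj, harr] at this

theorem input_initial : Input (toData A b c hn) (initial A b c) := by
  refine ⟨rfl, rfl, fun i hi j hj => ?_, fun i hi => ?_, fun j hj => ?_⟩
  · have hi' : i < m := hi
    have hj' : j < n := hj
    have := initial_mem_a A b c ⟨i, hi⟩ ⟨j, hj⟩
    simp only [toData, hi', hj', and_self, dif_pos]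
    exact_mod_cast this
  · have hi' : i < m := hi
    have := initial_mem_b A b c ⟨i, hi⟩
    simp only [toData, hi', dif_pos]
    exact_mod_cast this
  · have hj' : j < n := hj
    have := initial_mem_c A b c ⟨j, hj⟩
    simp only [toData, hj', dif_pos]
    exact_mod_cast this

theorem bounded_initial : Bounded (toData A b c hn).M 32 (initial A b c) := by
  set P := toData A b c hn
  have h := input_initial A b c hn
  have hm : P.m = m := rfl
  have hn' : P.n = n := rfl
  have h0 : |(0 : ℤ)| ≤ P.M := (size_zero (P := P)).abs_le_M
  refine ⟨fun r _ => ?_, fun x => ?_⟩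
  · simp only [initial]
    split_ifs
    exacts [(size_of_le_H (P := P) m_le_H).abs_le_M, (size_of_le_H (P := P) n_le_H).abs_le_M, h0]
  · by_cases hx : 0 ≤ x
    · obtain ⟨k, rfl⟩ := Int.eq_ofNat_of_zero_le hx
      by_cases h1 : k < m * n
      · refine (size_of_le_H (P := P) (x := ((initial A b c).mem k).natAbs)
          (le_trans ?_ D_le_H)).abs_le_M.trans' (by simp)
        exact (Finset.le_sup (f := fun k : ℕ => ((initial A b c).mem k).natAbs)
          (Finset.mem_Ico.2 ⟨Nat.zero_le _, h1⟩)).trans (le_max_right _ _)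
      · by_cases h2 : k < m * n + m
        · have := h.mem_b (k - m * n) (show k - m * n < m by omega)
          rw [hm, hn', ← Nat.cast_mul, ← Nat.cast_add, Nat.add_sub_cancel' (by omega)] at this
          rw [this]
          exact (size_b (show k - m * n < m by omega)).abs_le_M
        · by_cases h3 : k < m * n + m + n
          · have := h.mem_c (k - (m * n + m)) (show k - (m * n + m) < n by omega)
            rw [hm, hn', ← Nat.cast_mul, ← Nat.cast_add, ← Nat.cast_add,
              Nat.add_sub_cancel' (by omega)] at this
            rw [this]
            exact (size_c (show k - (m * n + m) < n by omega)).abs_le_M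
          · rw [initial_mem_of_le A b c (by exact_mod_cast not_lt.1 h3)]
            exact h0
    · simp only [initial, if_neg hx]
      exact h0

/-! ### The size of the integers and the number of steps -/

theorem dims_le_inputSize : m + n ≤ inputSize A b c := by
  unfold inputSize
  omega

theorem natAbs_a_le (i : Fin m) (j : Fin n) : (A i j).natAbs ≤ 2 ^ inputSize A b c := by
  refine (Nat.lt_size_self _).le.trans (Nat.pow_le_pow_right (by norm_num) ?_)
  have h1 := Finset.single_le_sum (f := fun j => (A i j).natAbs.size) (fun _ _ => Nat.zero_le _)
    (Finset.mem_univ j)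
  have h2 := Finset.single_le_sum (f := fun i => ∑ j, (A i j).natAbs.size)
    (fun _ _ => Nat.zero_le _) (Finset.mem_univ i)
  unfold inputSize
  omega

theorem natAbs_b_le (i : Fin m) : (b i).natAbs ≤ 2 ^ inputSize A b c := by
  refine (Nat.lt_size_self _).le.trans (Nat.pow_le_pow_right (by norm_num) ?_)
  have h1 := Finset.single_le_sum (f := fun i => (b i).natAbs.size) (fun _ _ => Nat.zero_le _)
    (Finset.mem_univ i)
  unfold inputSize
  omega

theorem natAbs_c_le (j : Fin n) : (c j).natAbs ≤ 2 ^ inputSize A b c := by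
  refine (Nat.lt_size_self _).le.trans (Nat.pow_le_pow_right (by norm_num) ?_)
  have h1 := Finset.single_le_sum (f := fun j => (c j).natAbs.size) (fun _ _ => Nat.zero_le _)
    (Finset.mem_univ j)
  unfold inputSize
  omega

theorem cSum_le : (toData A b c hn).cSum ≤ 2 ^ (2 * inputSize A b c) := by
  have h := dims_le_inputSize A b c
  calc (toData A b c hn).cSum ≤ n * 2 ^ inputSize A b c := by
        refine (Finset.sum_le_card_nsmul (Finset.range n) _ (2 ^ inputSize A b c)
          fun j hj => ?_).trans (by simp)
        have hj' := Finset.mem_range.1 hj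
        simpa [toData, hj'] using natAbs_c_le A b c ⟨j, hj'⟩
    _ ≤ 2 ^ inputSize A b c * 2 ^ inputSize A b c := by
        gcongr
        exact (by omega : n ≤ inputSize A b c).trans Nat.lt_two_pow_self.le
    _ = _ := by ring

theorem bSum_le : ∑ i ∈ Finset.range m, ((toData A b c hn).b i).natAbs ≤
    2 ^ (2 * inputSize A b c) := by
  have h := dims_le_inputSize A b c
  calc _ ≤ m * 2 ^ inputSize A b c := by
        refine (Finset.sum_le_card_nsmul (Finset.range m) _ (2 ^ inputSize A b c)
          fun j hj => ?_).trans (by simp)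
        have hj' := Finset.mem_range.1 hj
        simpa [toData, hj'] using natAbs_b_le A b c ⟨j, hj'⟩
    _ ≤ 2 ^ inputSize A b c * 2 ^ inputSize A b c := by
        gcongr
        exact (by omega : m ≤ inputSize A b c).trans Nat.lt_two_pow_self.le
    _ = _ := by ring

end

/-- All parameters have a number of digits that is cubic in the length of the data. -/
theorem Data.H_le {P : Data} {l : ℕ} (hl : P.m + P.n ≤ l) (hD : P.D ≤ 2 ^ l)
    (hc : P.cSum ≤ 2 ^ (2 * l)) (hb : ∑ i ∈ Finset.range P.m, (P.b i).natAbs ≤ 2 ^ (2 * l)) :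
    P.H ≤ 2 ^ (10 * l ^ 3) := by
  have hl1 : 1 ≤ l := by have := P.one_le_n; omega
  have hl2 : l ≤ l ^ 2 := Nat.le_self_pow (by norm_num) l
  have hl3 : l ^ 2 ≤ l ^ 3 := Nat.pow_le_pow_right hl1 (by norm_num)
  have two : ∀ {x y : ℕ}, x ≤ y → (2 : ℕ) ^ x ≤ 2 ^ y := Nat.pow_le_pow_right (by norm_num)
  have hml : P.m ≤ l := by omega
  have hm : P.m ≤ 2 ^ l := hml.trans Nat.lt_two_pow_self.le
  have hn : P.n ≤ 2 ^ l := (by omega : P.n ≤ l).trans Nat.lt_two_pow_self.le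
  have pow : ∀ {x y : ℕ}, x ≤ 2 ^ y → x ^ P.m ≤ 2 ^ (y * l) := fun {x y} h => by
    calc x ^ P.m ≤ (2 ^ y) ^ P.m := Nat.pow_le_pow_left h _
      _ = 2 ^ (y * P.m) := (pow_mul _ _ _).symm
      _ ≤ _ := two (Nat.mul_le_mul_left _ hml)
  have hnD : P.n * P.D ≤ 2 ^ (2 * l) := by
    calc P.n * P.D ≤ 2 ^ l * 2 ^ l := Nat.mul_le_mul hn hD
      _ = _ := by ring
  have hK : P.K ≤ 2 ^ (2 * l ^ 2) := (pow hnD).trans (two (by ring_nf; exact le_rfl))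
  have hW : P.W ≤ 2 ^ (6 * l ^ 2) := by
    calc P.W = 2 * (P.n * P.D * P.K) + 1 := by unfold W; ring
      _ ≤ 4 * (P.n * P.D * P.K) := by
        have := Nat.mul_pos (Nat.mul_pos P.one_le_n P.one_le_D) P.one_le_K
        omega
      _ ≤ 2 ^ 2 * (2 ^ (2 * l) * 2 ^ (2 * l ^ 2)) := by gcongr; norm_num
      _ = 2 ^ (2 + (2 * l + 2 * l ^ 2)) := by rw [pow_add, pow_add]
      _ ≤ _ := two (by omega)
  have hN : P.N ≤ 2 ^ (6 * l ^ 3) := (pow hW).trans (two (by ring_nf; exact le_rfl))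
  have hL : P.L ≤ 2 ^ (3 * l ^ 2) := by
    calc P.L ≤ 2 ^ l * 2 ^ (2 * l ^ 2) := Nat.mul_le_mul hn hK
      _ = 2 ^ (l + 2 * l ^ 2) := (pow_add _ _ _).symm
      _ ≤ _ := two (by omega)
  have hB : P.B ≤ 2 ^ (4 * l ^ 2) := by
    calc P.B ≤ 2 ^ 2 * P.K := by unfold B; have := P.one_le_K; omega
      _ ≤ 2 ^ 2 * 2 ^ (2 * l ^ 2) := by gcongr
      _ = 2 ^ (2 + 2 * l ^ 2) := (pow_add _ _ _).symm
      _ ≤ _ := two (by omega)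
  have hE : P.E ≤ 2 ^ (4 * l ^ 3) := (pow hB).trans (two (by ring_nf; exact le_rfl))
  have hT : P.T ≤ 2 ^ (l ^ 2) := (pow hn).trans (two (by ring_nf; exact le_rfl))
  have hbig : P.big ≤ 2 ^ (6 * l ^ 2) := by
    have h0 : 1 ≤ 2 ^ (3 * l ^ 2) * 2 ^ (2 * l) := Nat.one_le_iff_ne_zero.2 (by positivity)
    calc P.big ≤ 1 + 2 ^ (3 * l ^ 2) * 2 ^ (2 * l) :=
          Nat.add_le_add_left (Nat.mul_le_mul hL hc) _
      _ ≤ 2 ^ 1 * (2 ^ (3 * l ^ 2) * 2 ^ (2 * l)) := by omega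
      _ = 2 ^ (1 + (3 * l ^ 2 + 2 * l)) := by rw [pow_add, pow_add]
      _ ≤ _ := two (by omega)
  have weaken : ∀ {x y : ℕ}, x ≤ 2 ^ y → y ≤ 6 * l ^ 3 → x ≤ 2 ^ (6 * l ^ 3) :=
    fun h h' => h.trans (two h')
  have h1 := weaken hm (by omega)
  have h2 := weaken hn (by omega)
  have h3 := weaken hD (by omega)
  have h4 := weaken hK (by omega)
  have h5 := weaken hW (by omega)
  have h6 := weaken hL (by omega)
  have h7 := weaken hbig (by omega)
  have h8 := weaken hE (by omega)
  have h9 := weaken hT (by omega)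
  have h10 := weaken hb (by omega)
  have h11 := weaken hc (by omega)
  have h13' := weaken hB (by omega)
  have h13 : 2 ≤ 2 ^ (6 * l ^ 3) := by
    calc 2 = 2 ^ 1 := rfl
      _ ≤ _ := two (by omega)
  calc P.H ≤ 2 ^ 4 * 2 ^ (6 * l ^ 3) := by unfold H; omega
    _ = 2 ^ (4 + 6 * l ^ 3) := (pow_add _ _ _).symm
    _ ≤ _ := two (by omega)

theorem Data.capacity {P : Data} {l w : ℕ} (hH : P.H ≤ 2 ^ (10 * l ^ 3)) (hw : 6400 * l ^ 3 < w) :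
    Capacity w P.M := by
  refine ⟨P.two_le_H.trans (Nat.le_self_pow (by norm_num) _), ?_⟩
  have hM : P.M ≤ 2 ^ (100 * l ^ 3) := by
    calc P.M ≤ (2 ^ (10 * l ^ 3)) ^ 10 := Nat.pow_le_pow_left hH _
      _ = _ := by rw [← pow_mul]; congr 1; ring
  calc P.M ^ 64 ≤ (2 ^ (100 * l ^ 3)) ^ 64 := Nat.pow_le_pow_left hM _
    _ = 2 ^ (6400 * l ^ 3) := by rw [← pow_mul]; congr 1; ring
    _ < 2 ^ w := Nat.pow_lt_pow_right (by norm_num) hw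

/-- The factor `4 ^ m` in the bound pays for the factor `3 ^ m` in `N` and for the polynomial factor
in `m`. -/
theorem pow_four_mul_three_pow_le (m : ℕ) : (m + 1) ^ 4 * 3 ^ m ≤ 1000 * 4 ^ m := by
  -- The quotient of both sides decreases from `m = 14` on.
  rcases lt_or_ge m 14 with hm | hm
  · interval_cases m <;> norm_num
  · induction m, hm using Nat.le_induction with
    | base => norm_num
    | succ m hm ih =>
      have h : (m + 1 + 1) ^ 4 * 3 ≤ 4 * (m + 1) ^ 4 := by
        obtain ⟨k, rfl⟩ := Nat.exists_eq_add_of_le hm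
        ring_nf
        nlinarith
      calc (m + 1 + 1) ^ 4 * 3 ^ (m + 1) = (m + 1 + 1) ^ 4 * 3 * 3 ^ m := by ring
        _ ≤ 4 * (m + 1) ^ 4 * 3 ^ m := Nat.mul_le_mul_right _ h
        _ = 4 * ((m + 1) ^ 4 * 3 ^ m) := by ring
        _ ≤ 4 * (1000 * 4 ^ m) := Nat.mul_le_mul_left _ ih
        _ = _ := by ring

theorem Data.steps_le {P : Data} {Δ : ℕ} (hΔ : P.D ≤ Δ) :
    (P.m + 1) ^ 4 * P.N * P.L * P.T ≤ 1000 * (2 ^ (2 * P.m) *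
      Δ ^ (P.m ^ 3 + 3 * P.m ^ 2 + 2 * P.m) * P.n ^ (P.m ^ 3 + 5 * P.m ^ 2 + 6 * P.m + 1)) := by
  set m := P.m with hm
  set q := P.n * P.D with hq
  have hq1 : 1 ≤ q := Nat.mul_pos P.one_le_n P.one_le_D
  have hW : P.W ≤ 3 * q ^ (m + 1) := by
    have : P.W = 2 * q ^ (m + 1) + 1 := by unfold W K; rw [← hm, ← hq]; rw [hq]; ring
    have h1 : 1 ≤ q ^ (m + 1) := Nat.one_le_pow _ _ hq1
    omega
  have hN : P.N ≤ 3 ^ m * q ^ ((m + 1) * m) := by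
    calc P.N ≤ (3 * q ^ (m + 1)) ^ m := Nat.pow_le_pow_left hW _
      _ = _ := by rw [mul_pow, ← pow_mul]
  have hL : P.L = P.n * q ^ m := rfl
  have hT : P.T = P.n ^ m := rfl
  have e1 : m ^ 2 + 2 * m ≤ m ^ 3 + 3 * m ^ 2 + 2 * m := by nlinarith [Nat.zero_le (m ^ 3)]
  have e2 : m ^ 2 + 3 * m + 1 ≤ m ^ 3 + 5 * m ^ 2 + 6 * m + 1 := by
    nlinarith [Nat.zero_le (m ^ 3)]
  calc (m + 1) ^ 4 * P.N * P.L * P.T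
      ≤ (m + 1) ^ 4 * (3 ^ m * q ^ ((m + 1) * m)) * (P.n * q ^ m) * P.n ^ m := by
        rw [hL, hT]
        gcongr
    _ = (m + 1) ^ 4 * 3 ^ m * (P.D ^ (m ^ 2 + 2 * m) * P.n ^ (m ^ 2 + 3 * m + 1)) := by
        rw [hq]
        ring
    _ ≤ 1000 * 4 ^ m * (Δ ^ (m ^ 3 + 3 * m ^ 2 + 2 * m) *
          P.n ^ (m ^ 3 + 5 * m ^ 2 + 6 * m + 1)) := by
        refine Nat.mul_le_mul (pow_four_mul_three_pow_le m) (Nat.mul_le_mul ?_ ?_)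
        · exact (Nat.pow_le_pow_left hΔ _).trans
            (Nat.pow_le_pow_right (P.one_le_D.trans hΔ) e1)
        · exact Nat.pow_le_pow_right P.one_le_n e2
    _ = _ := by
        rw [show (4 : ℕ) = 2 ^ 2 by norm_num, ← pow_mul]
        ring

end IntProg

theorem theorem2 :
    ∃ (P : RAM.Prog) (C d : ℕ), ∀ (m n Δ : ℕ) (A : Matrix (Fin m) (Fin n) ℤ)
      (b : Fin m → ℤ) (c : Fin n → ℤ), 1 ≤ n → 1 ≤ Δ → (∀ i j, |A i j| ≤ (Δ : ℤ)) →
      ∃ (s : RAM.Store) (t : ℕ),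
        RAM.Exec (C * IntProg.inputSize A b c ^ d) P (IntProg.initial A b c) s t ∧
        IntProg.IsAnswer A b c s ∧
        t ≤ C * (2 ^ (2 * m) * Δ ^ (m ^ 3 + 3 * m ^ 2 + 2 * m) *
          n ^ (m ^ 3 + 5 * m ^ 2 + 6 * m + 1)) := by
  refine ⟨IntProg.solver, 6000000, 3, fun m n Δ A b c hn hΔ hA => ?_⟩
  set l := IntProg.inputSize A b c with hl
  have hdim := IntProg.dims_le_inputSize A b c
  have hl1 : 1 ≤ l ^ 3 := Nat.one_le_pow _ _ (by omega)
  have hD : IntProg.maxEntry A b c ≤ Δ := IntProg.maxEntry_le A b c hΔ fun i j => by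
    have := hA i j
    rw [← Int.natCast_natAbs] at this
    exact_mod_cast this
  have hC : RAM.Capacity (6000000 * l ^ 3) (IntProg.toData A b c hn).M :=
    IntProg.Data.capacity (l := l) (IntProg.Data.H_le hdim (IntProg.maxEntry_le A b c
      Nat.one_le_two_pow fun i j => IntProg.natAbs_a_le A b c i j) (IntProg.cSum_le A b c hn)
      (IntProg.bSum_le A b c hn)) (by omega)
  obtain ⟨s', -, hs', h⟩ := IntProg.runs_solver (w := 6000000 * l ^ 3)
    (IntProg.input_initial A b c hn) rfl
    (fun x hx => IntProg.initial_mem_of_le A b c hx) rfl (IntProg.bounded_initial A b c hn)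
  obtain ⟨σ, t, h1, h2, h3⟩ := h _ (RAM.Agree.refl 32 _)
  refine ⟨σ, t, h1, IntProg.isAnswer_of_correct A b c hn ?_, h2.trans ?_⟩
  · rwa [← h3.2 0 (by norm_num), show IntProg.arr σ 0 = IntProg.arr s' 0 by
      unfold IntProg.arr; rw [h3.1]]
  · have := IntProg.Data.steps_le (P := IntProg.toData A b c hn) hD
    exact (Nat.mul_le_mul_left 6000 this).trans_eq (by rw [← mul_assoc]; rfl)
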